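/- **Setting.** Let $f\in\mathbb C[x,y]$, let $\mathcal U\subset\mathbb C^2$ be an open neighborhood of $0$ such that $f$ has no critical points in $\mathcal U\setminus\{0\}$, and suppose $f|_{\mathcal U}=f_1f_2$ with $f_1,f_2$ analytic on $\mathcal U$, $f_1(0)=0$, $d_0f_1=dy$, such that $f_1(p)=f_2(p)=0$ with $p\in\mathcal U$ implies $p=0$. Thus $C_1=\{f_1=0\}$ is a smooth analytic branch at $0$ of the curve $f=0$, tangent to the $x$-axis; near $0$ it is the graph $y=h_f(x)$ of an analytic germ $h_f$ with $h_f(0)=0$. Let $m$ be the order of vanishing of $f_2(t,h_f(t))$ at $t=0$ (the intersection multiplicity at $0$ of $C_1$ with $C_2=\{f_2=0\}$). For an integer $M$, let $\mathbb C[x,y]^{\le M}$ be the affine space of polynomials of degree $\le M$. Given an open set $P\subset\mathbb C[x,y]^{\le M}$ containing $f$, a radius $r>0$, an integer $K\ge 0$ and $\varepsilon>0$, put $\mathcal D=\{|t|<r\}$ and let $R\subset P$ be the set of those $g\in P$ for which there is an analytic function $h_g:\mathcal D\to\mathbb C$ with $g(t,h_g(t))=0$ for all $t\in\mathcal D$ and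 $|h_g^{(k)}(t)-h_f^{(k)}(t)|<\varepsilon$ for all $t\in\mathcal D$ and $0\le k\le K$. A *test ring* is a local commutative $\mathbb C$-algebra $A$ with $1$ of finite dimension over $\mathbb C$; $\mathfrak m$ is its maximal ideal. Let $R_f(A)$ denote the set of $A$-points of the formal neighborhood of $f$ in $R$: the set of $\mathbb C$-algebra homomorphisms $\mathcal O_{R,f}\to A$, where $\mathcal O_{R,f}$ is the ring of germs at $f$ of analytic functions on $\mathbb C[x,y]^{\le M}$ modulo those that vanish on $R$ near $f$; such a homomorphism is identified with the polynomial $\tilde f\in A[x,y]^{\le M}$ whose coefficients are the images of the coordinate functions on $\mathbb C[x,y]^{\le M}$. **Lemma 2.1.** For every sufficiently large $M$, every sufficiently small $r>0$, every $K\ge0$, every sufficiently small $\varepsilon>0$ (depending on $f,M,r,K$) and every sufficiently small open neighborhood $P$ of $f$ in $\mathbb C[x,y]^{\le M}$ (depending on $f,M,r,K,\varepsilon$), we have $f\in R$, for every $g\in R$ the function $h_g$ is unique, and, writing $h_g(t)=\sum_{k\ge0}b_k(g)t^k$: (i) $R$ is a smooth (closed) analytic subvariety of $P$ of codimension $m$.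 (ii) $R$ is a local analytic branch at $f$ of some algebraic subvariety $Z$ of $\mathbb C[x,y]^{\le M}$: the germ of $R$ at $f$ is irreducible, and $Z\cap P=R\cup R'$ for an analytic subset $R'$ of $P$ whose germ at $f$ does not contain that of $R$. (iii) The functions $b_k:R\to\mathbb C$ $(k\ge 0)$ are complex analytic. (iv) For every test ring $A$ with maximal ideal $\mathfrak m$, $R_f(A)$ is the set of all $\tilde f\in A[x,y]^{\le M}$ such that $\tilde f\equiv f\pmod{\mathfrak m}$ and there is an $\tilde h\in A[[t]]$ with $\tilde h\equiv h_f\pmod{\mathfrak m}$ (where $h_f$ stands for its Taylor series at $0$) and $\tilde f(t,\tilde h(t))=0$ in $A[[t]]$. -/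

import Mathlib

open Filter Topology

noncomputable section

namespace PlaneCurves

/-! ### The affine space of plane polynomials of degree at most `M` -/

/-- Index set of the monomials `x ^ i * y ^ j` with `i + j ≤ M`. -/
abbrev PolyIdx (M : ℕ) : Type :=
  {p : Fin (M + 1) × Fin (M + 1) // (p.1 : ℕ) + (p.2 : ℕ) ≤ M}

/-- The exponent of a monomial; variable `0` is `x`, variable `1` is `y`. -/
def PolyIdx.exponent {M : ℕ} (p : PolyIdx M) : Fin 2 →₀ ℕ :=
  Finsupp.single 0 (p.1.1 : ℕ) + Finsupp.single 1 (p.1.2 : ℕ)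

/-- The affine space `ℂ[x, y]^{≤ M}`, as the space of coefficient vectors. -/
abbrev PolySpace (M : ℕ) : Type := PolyIdx M → ℂ

/-- The polynomial with a given coefficient vector. -/
def toPoly {M : ℕ} (g : PolySpace M) : MvPolynomial (Fin 2) ℂ :=
  ∑ p : PolyIdx M, MvPolynomial.monomial p.exponent (g p)

/-- The coefficient vector of a polynomial (of degree at most `M`). -/
def coeffVec (M : ℕ) (f : MvPolynomial (Fin 2) ℂ) : PolySpace M :=
  fun p => f.coeff p.exponent

/-- Polynomials of degree at most `M` are determined by their coefficient vectors. -/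
theorem toPoly_coeffVec {M : ℕ} (f : MvPolynomial (Fin 2) ℂ) (hf : f.totalDegree ≤ M) :
    toPoly (coeffVec M f) = f := by
  have key : ∀ s : Fin 2 →₀ ℕ, (toPoly (coeffVec M f)).coeff s = f.coeff s := by
    intro s
    unfold toPoly coeffVec
    rw [MvPolynomial.coeff_sum]
    simp only [MvPolynomial.coeff_monomial]
    by_cases hs : s 0 + s 1 ≤ M
    · let p : PolyIdx M := ⟨(⟨s 0, by omega⟩, ⟨s 1, by omega⟩), hs⟩
      have hp : p.exponent = s := by
        ext i; fin_cases i <;> simp [PolyIdx.exponent, p]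
      rw [Finset.sum_eq_single p]
      · rw [if_pos hp, hp]
      · intro q _ hq
        rw [if_neg]
        intro hqs
        apply hq
        have h0 : (q.1.1 : ℕ) = s 0 := by rw [← hqs]; simp [PolyIdx.exponent]
        have h1 : (q.1.2 : ℕ) = s 1 := by rw [← hqs]; simp [PolyIdx.exponent]
        exact Subtype.ext (Prod.ext (Fin.ext h0) (Fin.ext h1))
      · simp
    · have : f.coeff s = 0 := by
        by_contra hne
        have h2 := MvPolynomial.le_totalDegree (MvPolynomial.mem_support_iff.mpr hne)
        rw [Finsupp.sum_fintype _ _ (by simp)] at h2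
        simp [Fin.sum_univ_two] at h2
        omega
      rw [this]
      apply Finset.sum_eq_zero
      intro q _
      rw [if_neg]
      intro hqs
      apply hs
      rw [← hqs]
      simpa [PolyIdx.exponent] using q.2
  ext s
  exact key s

/-! ### Complex analytic subsets of an open set of `ℂⁿ` -/

section Analytic

variable {ι : Type} [Fintype ι]

/-- `S` is a (closed) complex analytic subset of the open set `P`. -/
def IsAnalyticSubset (P S : Set (ι → ℂ)) : Prop :=
  S ⊆ P ∧ ∀ p ∈ P, ∃ V : Set (ι → ℂ), IsOpen V ∧ p ∈ V ∧ V ⊆ P ∧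
    ∃ (n : ℕ) (F : Fin n → (ι → ℂ) → ℂ), (∀ i, AnalyticOnNhd ℂ (F i) V) ∧
      S ∩ V = {g | g ∈ V ∧ ∀ i, F i g = 0}

/-- `S` is a smooth (closed) complex analytic subvariety of the open set `P`, of codimension `m`
at each of its points: near each point of `S` it is the zero set of `m` analytic functions
with linearly independent differentials. -/
def IsSmoothAnalyticSubvariety (P S : Set (ι → ℂ)) (m : ℕ) : Prop :=
  IsAnalyticSubset P S ∧ ∀ p ∈ S, ∃ V : Set (ι → ℂ), IsOpen V ∧ p ∈ V ∧ V ⊆ P ∧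
    ∃ Φ : (ι → ℂ) → (Fin m → ℂ), AnalyticOnNhd ℂ Φ V ∧
      (∀ g ∈ V, Function.Surjective (fderiv ℂ Φ g)) ∧
      S ∩ V = {g | g ∈ V ∧ Φ g = 0}

/-- A function on a subvariety `S` is analytic if it is locally the restriction of an analytic
function of the ambient space. -/
def IsAnalyticOnSubvariety (S : Set (ι → ℂ)) (b : (ι → ℂ) → ℂ) : Prop :=
  ∀ p ∈ S, ∃ F : (ι → ℂ) → ℂ, AnalyticAt ℂ F p ∧ ∀ᶠ g in 𝓝[S] p, b g = F g

/-- The germ of `S` at `p` is contained in the germ of `T` at `p`. -/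
def GermSubset (p : ι → ℂ) (S T : Set (ι → ℂ)) : Prop := ∀ᶠ g in 𝓝 p, g ∈ S → g ∈ T

/-- The germ of `S` at `p` is nonempty and irreducible as a germ of an analytic set. -/
def IsIrreducibleGerm (p : ι → ℂ) (S : Set (ι → ℂ)) : Prop :=
  p ∈ S ∧ ∀ V : Set (ι → ℂ), IsOpen V → p ∈ V → ∀ S₁ S₂ : Set (ι → ℂ),
    IsAnalyticSubset V S₁ → IsAnalyticSubset V S₂ → GermSubset p S (S₁ ∪ S₂) →
      GermSubset p S S₁ ∨ GermSubset p S S₂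

/-- `S ⊆ P` is a local analytic branch at `p` of the algebraic subvariety `Z`, i.e. an irreducible
component of the analytic germ of `Z` at `p`: the germ of `S` is irreducible, and
`Z ∩ P` is the union of `S` and an analytic subset of `P` that does not contain the germ of `S`. -/
def IsLocalAnalyticBranch (P : Set (ι → ℂ)) (p : ι → ℂ) (S Z : Set (ι → ℂ)) : Prop :=
  IsAnalyticSubset P S ∧ IsIrreducibleGerm p S ∧
    ∃ S' : Set (ι → ℂ), IsAnalyticSubset P S' ∧ Z ∩ P = S ∪ S' ∧ ¬ GermSubset p S S'

/-! ### Local rings and formal neighborhoods -/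

/-- The algebra of functions that are analytic at `p`; its quotient by the functions vanishing
near `p` is the local ring of germs of analytic functions. -/
def analyticFunctionsAt (p : ι → ℂ) : Subalgebra ℂ ((ι → ℂ) → ℂ) where
  carrier := {F | AnalyticAt ℂ F p}
  mul_mem' hF hG := AnalyticAt.mul hF hG
  add_mem' hF hG := AnalyticAt.add hF hG
  algebraMap_mem' _ := analyticAt_const

/-- The ideal of those functions whose germ at `p` vanishes on the germ of `S`. -/
def vanishingIdeal (S : Set (ι → ℂ)) (p : ι → ℂ) : Ideal (analyticFunctionsAt p) where
  carrier := {F | ∀ᶠ g in 𝓝[S] p, F.1 g = 0}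
  add_mem' {F G} hF hG := by
    change ∀ᶠ g in 𝓝[S] p, F.1 g + G.1 g = 0
    have hF' : ∀ᶠ g in 𝓝[S] p, F.1 g = 0 := hF
    have hG' : ∀ᶠ g in 𝓝[S] p, G.1 g = 0 := hG
    exact (hF'.and hG').mono fun g hg => by rw [hg.1, hg.2, add_zero]
  zero_mem' := by simp
  smul_mem' c F hF := by
    change ∀ᶠ g in 𝓝[S] p, c.1 g * F.1 g = 0
    have hF' : ∀ᶠ g in 𝓝[S] p, F.1 g = 0 := hF
    exact hF'.mono fun g hg => by rw [hg, mul_zero]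

/-- The local ring `𝒪_{S, p}` of germs at `p` of analytic functions on `S`. -/
abbrev LocalRingAt (S : Set (ι → ℂ)) (p : ι → ℂ) : Type :=
  analyticFunctionsAt p ⧸ vanishingIdeal S p

/-- The class of the `i`-th coordinate function in `𝒪_{S, p}`. -/
def coordGerm (S : Set (ι → ℂ)) (p : ι → ℂ) (i : ι) : LocalRingAt S p :=
  Ideal.Quotient.mk (vanishingIdeal S p)
    ⟨fun g => g i, (ContinuousLinearMap.proj (R := ℂ) (φ := fun _ : ι => ℂ) i).analyticAt p⟩

end Analytic

/-- The set `S_p(A)` of `A`-points of the formal neighborhood of `p` in a subvariety `S` of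
`ℂ[x, y]^{≤ M}`: the homomorphisms `𝒪_{S, p} → A` of `ℂ`-algebras (these are automatically local
when `A` is a local `ℂ`-algebra of finite dimension), each of them regarded as the polynomial of
degree at most `M` over `A` whose coefficients are the images of the coordinate functions. -/
def formalNbhd {M : ℕ} (S : Set (PolySpace M)) (p : PolySpace M)
    (A : Type*) [CommRing A] [Algebra ℂ A] : Set (MvPolynomial (Fin 2) A) :=
  {F | F.totalDegree ≤ M ∧ ∃ φ : LocalRingAt S p →ₐ[ℂ] A,
    ∀ i : PolyIdx M, φ (coordGerm S p i) = F.coeff i.exponent}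

/-! ### Polynomials having a branch close to a given smooth branch -/

/-- The `k`-th coefficient of the Taylor series of `u` at `0`. -/
def taylorCoeff (k : ℕ) (u : ℂ → ℂ) : ℂ := iteratedDeriv k u 0 / (k.factorial : ℂ)

/-- The graph of `u` over the disc `|t| < r` is an analytic branch of the curve `g = 0`, and it is
`ε`-close, with all derivatives of order at most `K`, to the graph of `h`. (With `K` and `ε`
arbitrary, these are the basic neighborhoods of `h` in the `C^∞` topology on the disc.) -/
def IsCloseBranch {M : ℕ} (h : ℂ → ℂ) (r : ℝ) (K : ℕ) (ε : ℝ) (g : PolySpace M)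
    (u : ℂ → ℂ) : Prop :=
  AnalyticOnNhd ℂ u (Metric.ball 0 r) ∧
  (∀ t ∈ Metric.ball (0 : ℂ) r, MvPolynomial.eval ![t, u t] (toPoly g) = 0) ∧
  ∀ k ≤ K, ∀ t ∈ Metric.ball (0 : ℂ) r, ‖iteratedDeriv k u t - iteratedDeriv k h t‖ < ε

/-- The locus `R ⊆ P` of the polynomials that have a branch close to the graph of `h`. -/
def branchLocus {M : ℕ} (P : Set (PolySpace M)) (h : ℂ → ℂ) (r : ℝ) (K : ℕ) (ε : ℝ) :
    Set (PolySpace M) :=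
  {g | g ∈ P ∧ ∃ u : ℂ → ℂ, IsCloseBranch h r K ε g u}

open Classical in
/-- The function `h_g` whose graph is the branch of `g = 0` close to the graph of `h`
(zero if there is none). -/
def branchFun {M : ℕ} (h : ℂ → ℂ) (r : ℝ) (K : ℕ) (ε : ℝ) (g : PolySpace M) : ℂ → ℂ :=
  if H : ∃ u : ℂ → ℂ, IsCloseBranch h r K ε g u then H.choose else 0

end PlaneCurves

end

/-!
A branch `y = h(t)` of the curve `f = 0` is a solution of `f(T, h) = 0` in the disc algebra `B` of a
small closed disc, where `T` is the coordinate. On the branch `f₁ = 0` of `f = f₁ f₂` one has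
`∂f/∂y = ∂f₁/∂y · f₂`, so that `f_y(T, h) = T ^ m e` with a unit `e` (`exists_isBranchOver`).
Division by `T ^ m e` with remainder of degree less than `m` is possible and unique in `B`. Hence
the derivative at `(f, h)` of the map that sends `(g, u)` to `g(T, u)` and to the coefficients of
`g` at the monomials other than `x ^ i`, `i < m`, is bijective, and by the inverse function theorem
the pairs `(g, u)` near `(f, h)` with `g(T, u) = 0` are parametrized analytically by these high
coefficients: `g = γ(s)` and `u = w(s)` (`exists_parametrization`). A comparison with the same
statement on a smaller disc shows that closeness of the branch in the supremum norm is enough for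
this (`IsBranchChart.eventually_of_isCloseBranch`), and Cauchy's estimates give closeness of
derivatives (`IsBranchChart.eventually_isCloseBranch`). So the locus `R` is the graph of an analytic
map that expresses the `m` low coefficients by the high ones, which gives uniqueness of branches,
smoothness, the codimension, and analyticity of the Taylor coefficients of `w(s)`.

For the points over a test ring `A`, a homomorphism from the local ring of `R` at `f` sends the
Taylor coefficients of `w` to those of a solution over `A`. Conversely, coefficients in `A` that
reduce to those of `f` define a homomorphism from the analytic germs to `A`, by Taylor expansion
(`exists_killsGerms`). If there is a solution over `A`, then the point has to agree with its
projection to `R`, because both have the same high coefficients, and the linearized equation, which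
expresses zero as `∑_{i < m} δ_i t^i + t^m ε(t)`, forces `δ = 0` (`eq_of_substSeries_eq_zero`).

The locus is algebraic because its members satisfy an algebraic condition: if `g(T, u) = 0` and `d`
is the Weierstrass polynomial of `g_y(T, u)`, of degree `m`, then the remainder `v` of `u` modulo
`d` is a polynomial with `d ∣ g_y(X, v)` and `d ^ 2 ∣ g(X, v)` (`exists_monicPoly_lowerPoly`). The
`g` with these two properties form a polynomial family with as many parameters as there are high
coefficients (`family`), and so each low coefficient is algebraic over the high ones, with relations
`Q_i(s, γ_i(s)) = 0` (`exists_relation`). If these are chosen of minimal degree, then `γ_i` is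
generically a simple root, and the relations cut out near `f` the union of `R` and an analytic set
on which a product of divided differences of the `Q_i` vanishes
(`IsGraphOn.isLocalAnalyticBranch`). The germ of `R` is irreducible as it is smooth: analytic germs
in affine space have no zero divisors.
-/

noncomputable section

namespace PlaneCurves

/-! ### Division with remainder in a Banach algebra -/

section Division

variable {B : Type*} [NormedCommRing B] [NormedAlgebra ℂ B]

/-- The operator `(r, b) ↦ ∑_{i < n} r_i T^i + q b` of division by `q` with a remainder of degree
less than `n` in `T`: division by `q` is possible and unique exactly if it is bijective. -/
def divOp (T : B) (n : ℕ) (q : B) : ((Fin n → ℂ) × B) →L[ℂ] B :=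
  (∑ i : Fin n, (ContinuousLinearMap.proj (R := ℂ) (φ := fun _ : Fin n => ℂ) i).smulRight
    (T ^ (i : ℕ))).coprod (ContinuousLinearMap.mul ℂ B q)

theorem divOp_apply (T : B) (n : ℕ) (q : B) (p : (Fin n → ℂ) × B) :
    divOp T n q p = ∑ i : Fin n, p.1 i • T ^ (i : ℕ) + q * p.2 := by
  simp [divOp]

/-- `T` is a coordinate of the algebra `B`: every element is uniquely of the form `c + T b`. -/
def IsCoordinate (T : B) : Prop :=
  (∀ a : B, ∃ (c : ℂ) (b : B), a = algebraMap ℂ B c + T * b) ∧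
    ∀ (c : ℂ) (b : B), algebraMap ℂ B c + T * b = 0 → c = 0 ∧ b = 0

theorem divOp_pow_bijective {T : B} (hT : IsCoordinate T) (n : ℕ) :
    Function.Bijective (divOp T n (T ^ n)) := by
  induction n with
  | zero =>
    refine ⟨(injective_iff_map_eq_zero _).2 fun p hp => ?_, fun a => ⟨(0, a), ?_⟩⟩
    · rw [divOp_apply] at hp
      exact Prod.ext (Subsingleton.elim _ _) (by simpa using hp)
    · simp [divOp_apply]
  | succ n ih =>
    have key : ∀ (r : Fin (n + 1) → ℂ) (b : B), divOp T (n + 1) (T ^ (n + 1)) (r, b) =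
        algebraMap ℂ B (r 0) + T * divOp T n (T ^ n) (Fin.tail r, b) := by
      intro r b
      rw [divOp_apply, divOp_apply, Fin.sum_univ_succ, mul_add, Finset.mul_sum]
      simp only [Fin.val_zero, pow_zero, Fin.val_succ, Fin.tail, pow_succ', mul_smul_comm,
        Algebra.algebraMap_eq_smul_one]
      ring
    refine ⟨(injective_iff_map_eq_zero _).2 fun p hp => ?_, fun a => ?_⟩
    · obtain ⟨r, b⟩ := p
      rw [key] at hp
      obtain ⟨h0, h1⟩ := hT.2 _ _ hp
      have h2 := (injective_iff_map_eq_zero _).1 ih.1 _ h1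
      rw [Prod.mk_eq_zero] at h2
      refine Prod.ext (funext fun i => ?_) h2.2
      refine Fin.cases h0 (fun j => ?_) i
      exact congrFun h2.1 j
    · obtain ⟨c, b, rfl⟩ := hT.1 a
      obtain ⟨⟨r, b'⟩, rfl⟩ := ih.2 b
      exact ⟨(Fin.cons c r, b'), by rw [key]; simp⟩

theorem divOp_mul_unit_bijective {T : B} {n : ℕ} {q e : B} (hq : Function.Bijective (divOp T n q))
    (he : IsUnit e) : Function.Bijective (divOp T n (q * e)) := by
  obtain ⟨u, rfl⟩ := he
  have key : ∀ p, divOp T n (q * u) p = divOp T n q (p.1, u * p.2) := by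
    intro p
    simp only [divOp_apply, mul_assoc]
  refine ⟨fun p p' hp => ?_, fun a => ?_⟩
  · rw [key, key] at hp
    have := hq.1 hp
    rw [Prod.mk.injEq] at this
    exact Prod.ext this.1 (u.mul_right_inj.1 this.2)
  · obtain ⟨p, rfl⟩ := hq.2 a
    exact ⟨(p.1, (↑u⁻¹ : B) * p.2), by rw [key]; simp⟩

theorem continuous_divOp (T : B) (n : ℕ) : Continuous (divOp T n) := by
  have : divOp T n = fun q => (divOp T n 0) +
      (ContinuousLinearMap.mul ℂ B q).comp (ContinuousLinearMap.snd ℂ (Fin n → ℂ) B) := by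
    ext q p <;> simp [divOp_apply]
  rw [this]
  fun_prop

theorem eventually_divOp_bijective [CompleteSpace B] {T : B} {n : ℕ} {q : B}
    (hq : Function.Bijective (divOp T n q)) :
    ∀ᶠ q' in 𝓝 q, Function.Bijective (divOp T n q') := by
  let e := ContinuousLinearEquiv.ofBijective (divOp T n q) (LinearMap.ker_eq_bot.2 hq.1)
    (LinearMap.range_eq_top.2 hq.2)
  have h1 : Set.range ((↑) : (((Fin n → ℂ) × B) ≃L[ℂ] B) → _) ∈ 𝓝 (divOp T n q) :=
    ContinuousLinearEquiv.nhds e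
  filter_upwards [(continuous_divOp T n).continuousAt.preimage_mem_nhds h1] with q' hq'
  obtain ⟨e', he'⟩ := hq'
  rw [← he']
  exact e'.bijective

/-- If division by `aeval T d` is unique, then a polynomial divisible by `d` after the substitution
of `T` is divisible by `d`. -/
theorem dvd_of_aeval_dvd {T : B} {n : ℕ} {d : Polynomial ℂ} (hd : d.Monic) (hn : d.natDegree = n)
    (hinj : Function.Injective (divOp T n (Polynomial.aeval T d))) {P : Polynomial ℂ}
    (h : Polynomial.aeval T d ∣ Polynomial.aeval T P) : d ∣ P := by
  rw [← Polynomial.modByMonic_eq_zero_iff_dvd hd]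
  obtain ⟨b, hb⟩ := h
  by_cases hd1 : d = 1
  · simp [hd1]
  have hdeg : (P %ₘ d).natDegree < n := by
    rw [← hn]; exact Polynomial.natDegree_modByMonic_lt P hd hd1
  have h1 : Polynomial.aeval T (P %ₘ d) =
      Polynomial.aeval T d * (b - Polynomial.aeval T (P /ₘ d)) := by
    have := congrArg (Polynomial.aeval T) (Polynomial.modByMonic_add_div P d)
    rw [map_add, map_mul, hb] at this
    linear_combination this
  have h2 : divOp T n (Polynomial.aeval T d)
      (fun i => (P %ₘ d).coeff i, -(b - Polynomial.aeval T (P /ₘ d))) = 0 := by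
    rw [divOp_apply]
    simp only
    rw [Fin.sum_univ_eq_sum_range (fun i => (P %ₘ d).coeff i • T ^ i) n,
      ← Polynomial.aeval_eq_sum_range' hdeg, h1]
    ring
  have h3 := (injective_iff_map_eq_zero _).1 hinj _ h2
  rw [Prod.mk_eq_zero] at h3
  ext i
  rcases lt_or_ge i n with hi | hi
  · exact congrFun h3.1 ⟨i, hi⟩
  · simp [Polynomial.coeff_eq_zero_of_natDegree_lt (lt_of_lt_of_le hdeg hi)]

/-- If division by `d` is unique, with remainders of degree less than `deg d`, then so is division
by `d ^ 2`. -/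
theorem divOp_sq_injective {T : B} {n : ℕ} {d : Polynomial ℂ} (hd : d.Monic) (hn : d.natDegree = n)
    (hT : Function.Injective (divOp T n (Polynomial.aeval T d))) :
    Function.Injective (divOp T (2 * n) (Polynomial.aeval T (d ^ 2))) := by
  refine (injective_iff_map_eq_zero _).2 fun p hp => ?_
  obtain ⟨r, b⟩ := p
  set P : Polynomial ℂ := ∑ i : Fin (2 * n), Polynomial.monomial (i : ℕ) (r i) with hP
  have hPr : ∀ i : Fin (2 * n), P.coeff i = r i := by
    intro i
    rw [hP, Polynomial.finsetSum_coeff, Finset.sum_eq_single i]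
    · simp
    · intro j _ hj
      rw [Polynomial.coeff_monomial, if_neg]
      exact fun h => hj (Fin.ext h)
    · simp
  have hPT : Polynomial.aeval T P = ∑ i : Fin (2 * n), r i • T ^ (i : ℕ) := by
    rw [hP, map_sum]
    refine Finset.sum_congr rfl fun i _ => ?_
    rw [Polynomial.aeval_monomial, Algebra.smul_def]
  rw [divOp_apply, ← hPT, map_pow] at hp
  simp only at hp
  have h1 : d ∣ P := dvd_of_aeval_dvd hd hn hT ⟨-(Polynomial.aeval T d * b), by
    linear_combination hp⟩
  obtain ⟨Q, hQ⟩ := h1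
  have hinj0 : ∀ c : B, Polynomial.aeval T d * c = 0 → c = 0 := by
    intro c hc
    have : divOp T n (Polynomial.aeval T d) (0, c) = 0 := by simp [divOp_apply, hc]
    have := (injective_iff_map_eq_zero _).1 hT _ this
    exact (Prod.mk_eq_zero.1 this).2
  have h2 : Polynomial.aeval T Q + Polynomial.aeval T d * b = 0 := by
    apply hinj0
    rw [hQ, map_mul] at hp
    linear_combination hp
  have h3 : d ∣ Q := dvd_of_aeval_dvd hd hn hT ⟨-b, by linear_combination h2⟩
  have hPdeg : P.degree < (2 * n : ℕ) := by
    rw [hP]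
    refine lt_of_le_of_lt (Polynomial.degree_sum_le _ _) ?_
    rw [Finset.sup_lt_iff (WithBot.bot_lt_coe _)]
    intro i _
    exact lt_of_le_of_lt (Polynomial.degree_monomial_le _ _) (by exact_mod_cast i.2)
  have hP0 : P = 0 := by
    by_contra hne
    obtain ⟨S, hS⟩ := h3
    have hdvd : d ^ 2 ∣ P := ⟨S, by rw [hQ, hS]; ring⟩
    have := Polynomial.degree_le_of_dvd hdvd hne
    rw [Polynomial.degree_eq_natDegree (hd.pow 2).ne_zero, hd.natDegree_pow, hn] at this
    exact absurd (lt_of_le_of_lt this hPdeg) (lt_irrefl _)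
  refine Prod.ext (funext fun i => (hPr i).symm.trans (by simp [hP0])) ?_
  apply hinj0
  apply hinj0
  rw [hP0, map_zero] at hp
  linear_combination hp

end Division

/-! ### Splitting off the monomials `x ^ i` with `i < m` -/

section Splitting

variable {M : ℕ} (m : ℕ)

/-- The monomial is `x ^ i` with `i < m`. -/
abbrev IsLow (p : PolyIdx M) : Prop := (p.1.2 : ℕ) = 0 ∧ (p.1.1 : ℕ) < m

/-- Index set of the monomials other than `x ^ i` with `i < m`. -/
abbrev HighIdx (M m : ℕ) : Type := {p : PolyIdx M // ¬ IsLow m p}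

/-- The high coefficients of a polynomial: those at the monomials other than `x ^ i` with `i < m`.
The other `m` coefficients are the low ones. -/
def high : PolySpace M →L[ℂ] (HighIdx M m → ℂ) :=
  ContinuousLinearMap.pi fun p => ContinuousLinearMap.proj p.1

@[simp] theorem high_apply (g : PolySpace M) (p : HighIdx M m) : high m g p = g p.1 := rfl

variable {m}

/-- The coefficient vector with given entries at the `x ^ i` with `i < m` and elsewhere. -/
def glue (s : HighIdx M m → ℂ) (c : Fin m → ℂ) : PolySpace M :=
  fun p => if hp : IsLow m p then c ⟨p.1.1, hp.2⟩ else s ⟨p, hp⟩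

@[simp] theorem high_glue (s : HighIdx M m → ℂ) (c : Fin m → ℂ) : high m (glue s c) = s := by
  ext p
  simp [glue, p.2]

/-- The index of the monomial `x ^ i`. -/
def lowIdx (hm : m ≤ M) (i : Fin m) : PolyIdx M :=
  ⟨(⟨i, by omega⟩, 0), by simp; omega⟩

theorem lowIdx_isLow (hm : m ≤ M) (i : Fin m) : IsLow m (lowIdx hm i) := by
  simp [IsLow, lowIdx]

theorem IsLow.eq_lowIdx (hm : m ≤ M) {p : PolyIdx M} (hp : IsLow m p) :
    p = lowIdx hm ⟨p.1.1, hp.2⟩ := by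
  obtain ⟨⟨a, b⟩, hab⟩ := p
  refine Subtype.ext (Prod.ext rfl (Fin.ext ?_))
  simpa [lowIdx] using hp.1

theorem lowIdx_injective (hm : m ≤ M) : Function.Injective (lowIdx (M := M) hm) := by
  intro i j hij
  have := congrArg (fun p : PolyIdx M => (p.1.1 : ℕ)) hij
  exact Fin.ext this

theorem glue_lowIdx (hm : m ≤ M) (s : HighIdx M m → ℂ) (c : Fin m → ℂ) (i : Fin m) :
    glue s c (lowIdx hm i) = c i := by
  rw [glue, dif_pos (lowIdx_isLow hm i)]
  rfl

theorem glue_high_low (hm : m ≤ M) (g : PolySpace M) :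
    glue (high m g) (fun i => g (lowIdx hm i)) = g := by
  ext p
  by_cases hp : IsLow m p
  · conv_rhs => rw [hp.eq_lowIdx hm]
    rw [glue, dif_pos hp]
  · rw [glue, dif_neg hp, high_apply]

/-- A coefficient vector is determined by its entries at the `x ^ i`, `i < m`, and elsewhere. -/
theorem ext_high_low (hm : m ≤ M) {g g' : PolySpace M} (h : high m g = high m g')
    (h' : ∀ i, g (lowIdx hm i) = g' (lowIdx hm i)) : g = g' := by
  rw [← glue_high_low hm g, ← glue_high_low hm g', h, funext h']

end Splitting

/-! ### Substitution of algebra elements into plane polynomials -/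

section Substitution

variable {M : ℕ}

theorem aeval_monomial_exponent {R B : Type*} [CommRing R] [CommRing B] [Algebra R B] (T u : B)
    (p : PolyIdx M) (a : R) : MvPolynomial.aeval ![T, u] (MvPolynomial.monomial p.exponent a) =
      a • (T ^ (p.1.1 : ℕ) * u ^ (p.1.2 : ℕ)) := by
  rw [MvPolynomial.aeval_monomial, PolyIdx.exponent, Finsupp.prod_add_index',
    Finsupp.prod_single_index, Finsupp.prod_single_index, Algebra.smul_def]
  · simp
  · simp
  · simp
  · simp
  · simp [pow_add]

theorem aeval_toPoly {B : Type*} [CommRing B] [Algebra ℂ B] (T u : B) (g : PolySpace M) :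
    MvPolynomial.aeval ![T, u] (toPoly g) =
      ∑ p : PolyIdx M, g p • (T ^ (p.1.1 : ℕ) * u ^ (p.1.2 : ℕ)) := by
  simp only [toPoly, map_sum, aeval_monomial_exponent]

theorem aeval_pderiv_toPoly {B : Type*} [CommRing B] [Algebra ℂ B] (T u : B) (g : PolySpace M) :
    MvPolynomial.aeval ![T, u] (MvPolynomial.pderiv 1 (toPoly g)) =
      ∑ p : PolyIdx M, g p •
        (T ^ (p.1.1 : ℕ) * ((p.1.2 : ℕ) • u ^ ((p.1.2 : ℕ) - 1))) := by
  simp only [toPoly, map_sum]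
  refine Finset.sum_congr rfl fun p _ => ?_
  rw [MvPolynomial.pderiv_monomial, MvPolynomial.aeval_monomial, Algebra.smul_def, map_mul,
    mul_assoc]
  have h1 : (p.exponent 1 : ℕ) = p.1.2 := by simp [PolyIdx.exponent]
  have h2 : p.exponent - Finsupp.single 1 1 =
      Finsupp.single 0 (p.1.1 : ℕ) + Finsupp.single 1 ((p.1.2 : ℕ) - 1) := by
    ext i; fin_cases i <;> simp [PolyIdx.exponent]
  rw [h1, h2, Finsupp.prod_add_index', Finsupp.prod_single_index, Finsupp.prod_single_index]
  · simp; ring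
  · simp
  · simp
  · simp
  · simp [pow_add]

theorem aeval_toPoly_glue {m : ℕ} (hm : m ≤ M) {B : Type*} [CommRing B] [Algebra ℂ B] (T u : B)
    (s : HighIdx M m → ℂ) (c : Fin m → ℂ) :
    MvPolynomial.aeval ![T, u] (toPoly (glue s c)) =
      MvPolynomial.aeval ![T, u] (toPoly (glue s 0)) + ∑ i : Fin m, c i • T ^ (i : ℕ) := by
  have h1 : ∑ i : Fin m, c i • T ^ (i : ℕ) = ∑ p : PolyIdx M,
      (if hp : IsLow m p then c ⟨p.1.1, hp.2⟩ else 0) • (T ^ (p.1.1 : ℕ) * u ^ (p.1.2 : ℕ)) := by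
    symm
    rw [← Finset.sum_subset (Finset.subset_univ (Finset.univ.map ⟨lowIdx hm, lowIdx_injective hm⟩))]
    · rw [Finset.sum_map]
      refine Finset.sum_congr rfl fun i _ => ?_
      rw [Function.Embedding.coeFn_mk, dif_pos (lowIdx_isLow hm i)]
      simp [lowIdx]
    · intro p _ hp
      rw [dif_neg, zero_smul]
      intro hlow
      apply hp
      rw [Finset.mem_map]
      exact ⟨_, Finset.mem_univ _, (hlow.eq_lowIdx hm).symm⟩
  rw [aeval_toPoly, aeval_toPoly, h1, ← Finset.sum_add_distrib]
  refine Finset.sum_congr rfl fun p _ => ?_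
  rw [← add_smul]
  congr 1
  by_cases hp : IsLow m p
  · simp only [glue]
    rw [dif_pos hp, dif_pos hp, dif_pos hp, Pi.zero_apply, zero_add]
  · simp only [glue]
    rw [dif_neg hp, dif_neg hp, dif_neg hp, add_zero]

end Substitution

/-! ### The polynomials near `f` with a solution near a given one -/

section ImplicitFunction

variable {B : Type*} [NormedCommRing B] [NormedAlgebra ℂ B] {M : ℕ}

/-- Substitution of `T` and of a varying algebra element into a varying polynomial. -/
def substMap (M : ℕ) (T : B) (x : PolySpace M × B) : B :=
  MvPolynomial.aeval ![T, x.2] (toPoly x.1)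

theorem contDiff_substMap (T : B) {n : WithTop ℕ∞} : ContDiff ℂ n (substMap M T) := by
  unfold substMap
  simp only [aeval_toPoly]
  refine ContDiff.sum fun p _ => ?_
  have h1 : ContDiff ℂ n fun x : PolySpace M × B => T ^ (p.1.1 : ℕ) * x.2 ^ (p.1.2 : ℕ) := by
    fun_prop
  have h2 : ContDiff ℂ n fun x : PolySpace M × B => x.1 p :=
    ((ContinuousLinearMap.proj (R := ℂ) (φ := fun _ : PolyIdx M => ℂ) p).comp
      (ContinuousLinearMap.fst ℂ (PolySpace M) B)).contDiff
  exact h2.smul h1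

/-- The derivative of `substMap` at `(f, h)`. -/
def substDeriv (M : ℕ) (T h q : B) : PolySpace M × B →L[ℂ] B :=
  (∑ p : PolyIdx M, (ContinuousLinearMap.proj (R := ℂ) (φ := fun _ : PolyIdx M => ℂ) p).smulRight
    (T ^ (p.1.1 : ℕ) * h ^ (p.1.2 : ℕ))).coprod (ContinuousLinearMap.mul ℂ B q)

theorem substDeriv_apply (T h q : B) (x : PolySpace M × B) :
    substDeriv M T h q x = MvPolynomial.aeval ![T, h] (toPoly x.1) + q * x.2 := by
  simp [substDeriv, aeval_toPoly]

theorem hasFDerivAt_substMap (T : B) (f : PolySpace M) (h : B) :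
    HasFDerivAt (substMap M T) (substDeriv M T h
      (MvPolynomial.aeval ![T, h] (MvPolynomial.pderiv 1 (toPoly f)))) (f, h) := by
  have ha : ∀ p : PolyIdx M, HasFDerivAt (fun x : PolySpace M × B => x.1 p)
      ((ContinuousLinearMap.proj (R := ℂ) (φ := fun _ : PolyIdx M => ℂ) p).comp
        (ContinuousLinearMap.fst ℂ (PolySpace M) B)) (f, h) := fun p =>
    ((ContinuousLinearMap.proj (R := ℂ) (φ := fun _ : PolyIdx M => ℂ) p).comp
      (ContinuousLinearMap.fst ℂ (PolySpace M) B)).hasFDerivAt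
  have hb : HasFDerivAt (fun x : PolySpace M × B => x.2)
      (ContinuousLinearMap.snd ℂ (PolySpace M) B) (f, h) := hasFDerivAt_snd
  have h1 := fun (p : PolyIdx M) (_ : p ∈ (Finset.univ : Finset (PolyIdx M))) =>
    (ha p).fun_smul ((hb.pow (p.1.2 : ℕ)).const_mul (T ^ (p.1.1 : ℕ)))
  have h2 := HasFDerivAt.fun_sum h1
  have h3 : substMap M T =
      fun x => ∑ p : PolyIdx M, x.1 p • (T ^ (p.1.1 : ℕ) * x.2 ^ (p.1.2 : ℕ)) := by
    funext x; rw [substMap, aeval_toPoly]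
  rw [h3]
  refine h2.congr_fderiv ?_
  refine ContinuousLinearMap.ext fun x => ?_
  rw [substDeriv_apply, aeval_toPoly, aeval_pderiv_toPoly, Finset.sum_mul,
    ← Finset.sum_add_distrib]
  simp only [FunLike.coe_sum, Finset.sum_apply]
  refine Finset.sum_congr rfl fun p _ => ?_
  simp [smul_smul]
  ring_nf

variable {m : ℕ}

/-- Derivative of `(g, u) ↦ (high m g, g(T, u))`. -/
def solveDeriv (M m : ℕ) (T h q : B) : PolySpace M × B →L[ℂ] (HighIdx M m → ℂ) × B :=
  ((high m).comp (ContinuousLinearMap.fst ℂ (PolySpace M) B)).prod (substDeriv M T h q)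

/-- The linearized equation `g'(T, h) + q u' = 0` can be solved uniquely for `u'` and the low
coefficients of `g'`, as this amounts to division by `q`. -/
theorem solveDeriv_bijective (hm : m ≤ M) {T h q : B} (hq : Function.Bijective (divOp T m q)) :
    Function.Bijective (solveDeriv M m T h q) := by
  refine ⟨(injective_iff_map_eq_zero _).2 fun x hx => ?_, fun y => ?_⟩
  · obtain ⟨g, b⟩ := x
    have hx' : high m g = 0 ∧ substDeriv M T h q (g, b) = 0 := by
      simpa [solveDeriv, Prod.ext_iff] using hx
    obtain ⟨h1, h2⟩ := hx'
    rw [substDeriv_apply, ← glue_high_low hm g, h1] at h2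
    simp only at h2
    rw [aeval_toPoly_glue hm] at h2
    have h3 : MvPolynomial.aeval ![T, h] (toPoly (glue (0 : HighIdx M m → ℂ) 0)) = 0 := by
      rw [aeval_toPoly]; simp [glue]
    rw [h3, zero_add] at h2
    have h4 := (injective_iff_map_eq_zero _).1 hq.1 (fun i => g (lowIdx hm i), b)
      (by rw [divOp_apply]; exact h2)
    rw [Prod.mk_eq_zero] at h4
    refine Prod.ext (ext_high_low hm (by simpa using h1) fun i => congrFun h4.1 i) h4.2
  · obtain ⟨s, a⟩ := y
    obtain ⟨⟨c, b⟩, hcb⟩ := hq.2 (a - MvPolynomial.aeval ![T, h] (toPoly (glue s 0)))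
    refine ⟨(glue s c, b), ?_⟩
    rw [divOp_apply] at hcb
    refine Prod.ext ?_ ?_
    · simp [solveDeriv]
    · change substDeriv M T h q (glue s c, b) = a
      rw [substDeriv_apply]
      simp only at hcb ⊢
      rw [aeval_toPoly_glue hm]
      linear_combination hcb

/-- If `f(T, h) = 0` and division by `f_y(T, h)` with remainder of degree less than `m` is possible
and unique, then the pairs `(g, u)` near `(f, h)` with `g(T, u) = 0` are parametrized analytically
by the coefficients of `g` at the monomials other than `x ^ i` with `i < m`. -/
theorem exists_parametrization [CompleteSpace B] (hm : m ≤ M) {T h : B} {f : PolySpace M}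
    (hf : MvPolynomial.aeval ![T, h] (toPoly f) = 0)
    (hq : Function.Bijective
      (divOp T m (MvPolynomial.aeval ![T, h] (MvPolynomial.pderiv 1 (toPoly f))))) :
    ∃ (γ : (HighIdx M m → ℂ) → PolySpace M) (w : (HighIdx M m → ℂ) → B),
      AnalyticAt ℂ γ (high m f) ∧ AnalyticAt ℂ w (high m f) ∧
      γ (high m f) = f ∧ w (high m f) = h ∧
      (∀ᶠ s in 𝓝 (high m f), high m (γ s) = s ∧
        MvPolynomial.aeval ![T, w s] (toPoly (γ s)) = 0) ∧
      ∀ᶠ x in 𝓝 (f, h), MvPolynomial.aeval ![T, x.2] (toPoly x.1) = 0 →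
        x.1 = γ (high m x.1) ∧ x.2 = w (high m x.1) := by
  set Ψ : PolySpace M × B → (HighIdx M m → ℂ) × B := fun x => (high m x.1, substMap M T x) with hΨ
  set q := MvPolynomial.aeval ![T, h] (MvPolynomial.pderiv 1 (toPoly f)) with hqdef
  have hcd : ContDiffAt ℂ (⊤ : WithTop ℕ∞) Ψ (f, h) :=
    ((((high m).comp (ContinuousLinearMap.fst ℂ (PolySpace M) B)).contDiff).prodMk
      (contDiff_substMap T)).contDiffAt
  have hbij := solveDeriv_bijective (M := M) hm (h := h) hq
  let e := ContinuousLinearEquiv.ofBijective (solveDeriv M m T h q) (LinearMap.ker_eq_bot.2 hbij.1)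
    (LinearMap.range_eq_top.2 hbij.2)
  have hder : HasFDerivAt Ψ (e : PolySpace M × B →L[ℂ] (HighIdx M m → ℂ) × B) (f, h) := by
    have : (e : PolySpace M × B →L[ℂ] (HighIdx M m → ℂ) × B) = solveDeriv M m T h q :=
      ContinuousLinearEquiv.coe_ofBijective _ _ _
    rw [this]
    exact (((high m).comp (ContinuousLinearMap.fst ℂ (PolySpace M) B)).hasFDerivAt).prodMk
      (hasFDerivAt_substMap T f h)
  have hst := hcd.hasStrictFDerivAt' hder (by simp)
  set inv := hst.localInverse Ψ e (f, h) with hinv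
  have hΨf : Ψ (f, h) = (high m f, 0) := by simp [hΨ, substMap, hf]
  have hinvan : AnalyticAt ℂ inv (high m f, 0) := by
    rw [← hΨf]
    exact (hcd.to_localInverse hder (by simp)).analyticAt
  have hinvf : inv (high m f, 0) = (f, h) := by
    rw [← hΨf]; exact hst.localInverse_apply_image
  have hemb : AnalyticAt ℂ (fun s : HighIdx M m → ℂ => (s, (0 : B))) (high m f) :=
    analyticAt_id.prod analyticAt_const
  have hcomp : AnalyticAt ℂ (fun s : HighIdx M m → ℂ => inv (s, 0)) (high m f) :=
    AnalyticAt.comp (g := inv) (f := fun s : HighIdx M m → ℂ => (s, (0 : B))) hinvan hemb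
  refine ⟨fun s => (inv (s, 0)).1, fun s => (inv (s, 0)).2, ?_, ?_, ?_, ?_, ?_, ?_⟩
  · exact ((ContinuousLinearMap.fst ℂ (PolySpace M) B).analyticAt _).comp hcomp
  · exact ((ContinuousLinearMap.snd ℂ (PolySpace M) B).analyticAt _).comp hcomp
  · simp only [hinvf]
  · simp only [hinvf]
  · have h1 := hst.eventually_right_inverse
    rw [hΨf] at h1
    have h2 := hemb.continuousAt.eventually h1
    filter_upwards [h2] with s hs
    rw [← hinv] at hs
    exact ⟨congrArg Prod.fst hs, congrArg Prod.snd hs⟩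
  · filter_upwards [hst.eventually_left_inverse] with x hx h0
    have h3 : Ψ x = (high m x.1, 0) := by simp [hΨ, substMap, h0]
    rw [h3, ← hinv] at hx
    simp [hx]

end ImplicitFunction

/-! ### The disc algebra -/

section DiscAlgebra

variable {ρ : ℝ}

/-- Extension by zero of a function on the closed disc. -/
def discExt (F : C(Metric.closedBall (0 : ℂ) ρ, ℂ)) : ℂ → ℂ := Function.extend Subtype.val F 0

theorem discExt_apply (F : C(Metric.closedBall (0 : ℂ) ρ, ℂ)) {z : ℂ}
    (hz : z ∈ Metric.closedBall (0 : ℂ) ρ) : discExt F z = F ⟨z, hz⟩ :=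
  Subtype.val_injective.extend_apply F 0 ⟨z, hz⟩

theorem continuousOn_discExt (F : C(Metric.closedBall (0 : ℂ) ρ, ℂ)) :
    ContinuousOn (discExt F) (Metric.closedBall 0 ρ) := by
  rw [continuousOn_iff_continuous_domRestrict]
  convert F.continuous using 1
  ext z
  exact discExt_apply F z.2

variable (ρ) in
/-- The algebra of the continuous functions on the closed disc of radius `ρ` that are holomorphic
in its interior. -/
def DiscAlgebra : Subalgebra ℂ C(Metric.closedBall (0 : ℂ) ρ, ℂ) where
  carrier := {F | DifferentiableOn ℂ (discExt F) (Metric.ball 0 ρ)}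
  mul_mem' {F G} hF hG := (DifferentiableOn.mul hF hG).congr fun z hz => by
    have hz' := Metric.ball_subset_closedBall hz
    simp [discExt_apply _ hz']
  add_mem' {F G} hF hG := (DifferentiableOn.add hF hG).congr fun z hz => by
    have hz' := Metric.ball_subset_closedBall hz
    simp [discExt_apply _ hz']
  algebraMap_mem' c := (differentiableOn_const c).congr fun z hz => by
    have hz' := Metric.ball_subset_closedBall hz
    simp [discExt_apply _ hz']

theorem isClosed_discAlgebra : IsClosed (DiscAlgebra ρ : Set C(Metric.closedBall (0 : ℂ) ρ, ℂ)) := by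
  refine IsSeqClosed.isClosed fun F G hF hFG => ?_
  rw [ContinuousMap.tendsto_iff_tendstoUniformly] at hFG
  have h1 : TendstoUniformlyOn (fun n => discExt (F n)) (discExt G) atTop (Metric.ball 0 ρ) := by
    rw [Metric.tendstoUniformlyOn_iff]
    rw [Metric.tendstoUniformly_iff] at hFG
    intro ε hε
    filter_upwards [hFG ε hε] with n hn z hz
    have hz' := Metric.ball_subset_closedBall hz
    rw [discExt_apply _ hz', discExt_apply _ hz']
    exact hn _
  exact h1.tendstoLocallyUniformlyOn.differentiableOn (Eventually.of_forall fun n => hF n)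
    Metric.isOpen_ball

instance : CompleteSpace (DiscAlgebra ρ) := isClosed_discAlgebra.completeSpace_coe

/-- The element of the disc algebra given by a function on `ℂ`. -/
def discMk (u : ℂ → ℂ) (hc : ContinuousOn u (Metric.closedBall 0 ρ))
    (hd : DifferentiableOn ℂ u (Metric.ball 0 ρ)) : DiscAlgebra ρ :=
  ⟨⟨fun z => u z, continuousOn_iff_continuous_domRestrict.1 hc⟩, hd.congr fun _ hz =>
    discExt_apply _ (Metric.ball_subset_closedBall hz)⟩

theorem discExt_discMk (u : ℂ → ℂ) (hc : ContinuousOn u (Metric.closedBall 0 ρ))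
    (hd : DifferentiableOn ℂ u (Metric.ball 0 ρ)) {z : ℂ} (hz : z ∈ Metric.closedBall (0 : ℂ) ρ) :
    discExt (discMk u hc hd).1 z = u z := discExt_apply _ hz

theorem discAlgebra_ext {a b : DiscAlgebra ρ}
    (h : ∀ z ∈ Metric.closedBall (0 : ℂ) ρ, discExt a.1 z = discExt b.1 z) : a = b := by
  refine Subtype.ext (ContinuousMap.ext fun z => ?_)
  have := h z.1 z.2
  rwa [discExt_apply _ z.2, discExt_apply _ z.2] at this

/-- Evaluation at a point of the closed disc. -/
def discEval (z : Metric.closedBall (0 : ℂ) ρ) : DiscAlgebra ρ →ₐ[ℂ] ℂ :=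
  (ContinuousMap.evalAlgHom ℂ ℂ z).comp (DiscAlgebra ρ).val

theorem discEval_apply (z : Metric.closedBall (0 : ℂ) ρ) (a : DiscAlgebra ρ) :
    discEval z a = a.1 z := rfl

theorem discEval_eq (z : Metric.closedBall (0 : ℂ) ρ) (a : DiscAlgebra ρ) :
    discEval z a = discExt a.1 z := (discExt_apply _ z.2).symm

theorem dist_discExt_le (a b : DiscAlgebra ρ) {z : ℂ} (hz : z ∈ Metric.closedBall (0 : ℂ) ρ) :
    dist (discExt a.1 z) (discExt b.1 z) ≤ dist a b := by
  rw [discExt_apply _ hz, discExt_apply _ hz]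
  exact ContinuousMap.dist_apply_le_dist _

theorem dist_discAlgebra_le (a b : DiscAlgebra ρ) {C : ℝ} (hC : 0 ≤ C)
    (h : ∀ z ∈ Metric.closedBall (0 : ℂ) ρ, dist (discExt a.1 z) (discExt b.1 z) ≤ C) :
    dist a b ≤ C := by
  change dist a.1 b.1 ≤ C
  rw [ContinuousMap.dist_le hC]
  intro z
  have := h z z.2
  rwa [discExt_apply _ z.2, discExt_apply _ z.2] at this

variable (ρ) in
/-- The coordinate function of the disc. -/
def discCoord : DiscAlgebra ρ := discMk (fun z => z) continuousOn_id differentiableOn_id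

theorem isCoordinate_discCoord (hρ : 0 < ρ) : IsCoordinate (discCoord ρ) := by
  have h0 : (0 : ℂ) ∈ Metric.closedBall (0 : ℂ) ρ := Metric.mem_closedBall_self hρ.le
  have hT : ∀ z, discEval z (discCoord ρ) = z := fun z => rfl
  refine ⟨fun a => ?_, fun c b hcb => ?_⟩
  · have hball : Metric.ball (0 : ℂ) ρ ∈ 𝓝 (0 : ℂ) := Metric.ball_mem_nhds _ hρ
    have hd : DifferentiableOn ℂ (discExt a.1) (Metric.ball 0 ρ) := a.2
    refine ⟨discExt a.1 0, discMk (dslope (discExt a.1) 0) ?_ ?_, ?_⟩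
    · rw [continuousOn_dslope (Metric.closedBall_mem_nhds _ hρ)]
      exact ⟨continuousOn_discExt _, hd.differentiableAt hball⟩
    · exact (Complex.differentiableOn_dslope hball).2 hd
    · refine Subtype.ext (ContinuousMap.ext fun z => ?_)
      have h1 := sub_smul_dslope (discExt a.1) 0 z
      rw [sub_zero, smul_eq_mul, discExt_apply _ z.2] at h1
      change a.1 z = discExt a.1 0 + z * dslope (discExt a.1) 0 z
      rw [h1]
      simp
  · have h1 : ∀ z, c + z * b.1 z = 0 := fun z => by
      have := congrArg (discEval z) hcb
      rw [map_add, map_mul, hT, AlgHom.commutes, map_zero] at this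
      simpa [discEval_apply] using this
    have hc : c = 0 := by simpa using h1 ⟨0, h0⟩
    refine ⟨hc, ?_⟩
    have h2 : ∀ z : ℂ, z ∈ Metric.closedBall (0 : ℂ) ρ → z ≠ 0 → discExt b.1 z = 0 := by
      intro z hz hz0
      have := h1 ⟨z, hz⟩
      rw [hc, zero_add, mul_eq_zero] at this
      rw [discExt_apply _ hz]
      exact this.resolve_left hz0
    refine discAlgebra_ext fun z hz => ?_
    have h00 : discExt (0 : DiscAlgebra ρ).1 z = 0 := by rw [discExt_apply _ hz]; rfl
    rw [h00]
    by_cases hz0 : z = 0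
    · subst hz0
      have hcont : Tendsto (discExt b.1) (𝓝[≠] 0) (𝓝 (discExt b.1 0)) :=
        ((continuousOn_discExt b.1).continuousAt
          (Metric.closedBall_mem_nhds _ hρ)).tendsto.mono_left nhdsWithin_le_nhds
      have hz : Tendsto (discExt b.1) (𝓝[≠] 0) (𝓝 0) := by
        refine tendsto_const_nhds.congr' ?_
        filter_upwards [self_mem_nhdsWithin,
          nhdsWithin_le_nhds (Metric.closedBall_mem_nhds (0 : ℂ) hρ)] with z hz hz'
        exact (h2 z hz' hz).symm
      exact tendsto_nhds_unique hcont hz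
    · exact h2 z hz hz0

theorem discExt_aeval (a : DiscAlgebra ρ) (P : MvPolynomial (Fin 2) ℂ) {z : ℂ}
    (hz : z ∈ Metric.closedBall (0 : ℂ) ρ) :
    discExt (MvPolynomial.aeval ![discCoord ρ, a] P).1 z =
      MvPolynomial.eval ![z, discExt a.1 z] P := by
  have h1 := discEval_eq ⟨z, hz⟩ (MvPolynomial.aeval ![discCoord ρ, a] P)
  rw [← h1, MvPolynomial.comp_aeval_apply, ← MvPolynomial.aeval_eq_eval]
  congr 2
  ext i
  fin_cases i
  · rfl
  · exact discEval_eq _ _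

theorem isUnit_discMk {e : ℂ → ℂ} (hc : ContinuousOn e (Metric.closedBall 0 ρ))
    (hd : DifferentiableOn ℂ e (Metric.ball 0 ρ)) (h0 : ∀ z ∈ Metric.closedBall (0 : ℂ) ρ, e z ≠ 0) :
    IsUnit (discMk e hc hd) := by
  refine IsUnit.of_mul_eq_one (discMk (fun z => (e z)⁻¹) (hc.inv₀ h0)
    (hd.fun_inv fun z hz => h0 z (Metric.ball_subset_closedBall hz))) ?_
  refine Subtype.ext (ContinuousMap.ext fun z => ?_)
  exact mul_inv_cancel₀ (h0 z z.2)

theorem analyticOnNhd_discExt (a : DiscAlgebra ρ) :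
    AnalyticOnNhd ℂ (discExt a.1) (Metric.ball 0 ρ) :=
  DifferentiableOn.analyticOnNhd a.2 Metric.isOpen_ball

/-- Restriction to a smaller disc. -/
def discRestrict {ρ' : ℝ} (h : ρ' ≤ ρ) (a : DiscAlgebra ρ) : DiscAlgebra ρ' :=
  discMk (discExt a.1) ((continuousOn_discExt _).mono (Metric.closedBall_subset_closedBall h))
    ((show DifferentiableOn ℂ (discExt a.1) (Metric.ball 0 ρ) from a.2).mono
      (Metric.ball_subset_ball h))

theorem continuous_discRestrict {ρ' : ℝ} (h : ρ' ≤ ρ) : Continuous (discRestrict h) := by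
  refine (LipschitzWith.of_dist_le_mul (K := 1) fun a b => ?_).continuous
  rw [NNReal.coe_one, one_mul]
  refine dist_discAlgebra_le _ _ dist_nonneg fun z hz => ?_
  rw [discRestrict, discRestrict, discExt_discMk _ _ _ hz, discExt_discMk _ _ _ hz]
  exact dist_discExt_le _ _ (Metric.closedBall_subset_closedBall h hz)

/-- Cauchy's estimates, for the derivatives of the difference of two elements of the disc algebra
on a smaller disc. -/
theorem norm_iteratedDeriv_discExt_sub_le (a b : DiscAlgebra ρ) {r : ℝ} (hr : r < ρ) (k : ℕ) {t : ℂ}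
    (ht : t ∈ Metric.ball (0 : ℂ) r) :
    ‖iteratedDeriv k (discExt a.1) t - iteratedDeriv k (discExt b.1) t‖ ≤
      k.factorial * dist a b / ((ρ - r) / 2) ^ k := by
  have hsub : Metric.closedBall t ((ρ - r) / 2) ⊆ Metric.ball (0 : ℂ) ρ := by
    intro z hz
    rw [Metric.mem_closedBall] at hz
    rw [Metric.mem_ball] at ht ⊢
    linarith [dist_triangle z t 0]
  have htρ : t ∈ Metric.ball (0 : ℂ) ρ := Metric.ball_subset_ball hr.le ht
  have ha := analyticOnNhd_discExt a
  have hb := analyticOnNhd_discExt b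
  rw [← iteratedDeriv_sub (ha t htρ).contDiffAt (hb t htρ).contDiffAt]
  refine Complex.norm_iteratedDeriv_le_of_forall_mem_sphere_norm_le k (by linarith) ?_ ?_
  · refine DifferentiableOn.diffContOnCl ?_
    refine ((ha.sub hb).differentiableOn).mono ?_
    exact (closure_mono Metric.ball_subset_closedBall).trans
      (Metric.isClosed_closedBall.closure_subset.trans hsub)
  · intro z hz
    rw [Pi.sub_apply, ← dist_eq_norm]
    exact dist_discExt_le a b
      (Metric.ball_subset_closedBall (hsub (Metric.sphere_subset_closedBall hz)))

end DiscAlgebra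

/-! ### The branch locus as a graph -/

section Graph

variable {M m : ℕ} {f : PolySpace M} {h e : ℂ → ℂ} {ρ : ℝ}

/-- The graph of `h` over the closed disc of radius `ρ` lies on the curve `f = 0`, and on it
`∂f/∂y` is `t ^ m` times the nowhere vanishing function `e`. -/
structure IsBranchOver (f : PolySpace M) (h e : ℂ → ℂ) (m : ℕ) (ρ : ℝ) : Prop where
  analytic : AnalyticOnNhd ℂ h (Metric.closedBall 0 ρ)
  analytic_unit : AnalyticOnNhd ℂ e (Metric.closedBall 0 ρ)
  unit_ne_zero : ∀ z ∈ Metric.closedBall (0 : ℂ) ρ, e z ≠ 0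
  eval_eq_zero : ∀ z ∈ Metric.closedBall (0 : ℂ) ρ, MvPolynomial.eval ![z, h z] (toPoly f) = 0
  eval_pderiv : ∀ z ∈ Metric.closedBall (0 : ℂ) ρ,
    MvPolynomial.eval ![z, h z] (MvPolynomial.pderiv 1 (toPoly f)) = z ^ m * e z

theorem IsBranchOver.mono (H : IsBranchOver f h e m ρ) {ρ' : ℝ} (hρ : ρ' ≤ ρ) :
    IsBranchOver f h e m ρ' := by
  have hs := Metric.closedBall_subset_closedBall (x := (0 : ℂ)) hρ
  exact ⟨H.1.mono hs, H.2.mono hs, fun z hz => H.3 z (hs hz), fun z hz => H.4 z (hs hz),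
    fun z hz => H.5 z (hs hz)⟩

/-- The function `h` as an element of the disc algebra. -/
def IsBranchOver.fn (H : IsBranchOver f h e m ρ) : DiscAlgebra ρ :=
  discMk h H.analytic.continuousOn
    ((H.analytic.mono Metric.ball_subset_closedBall).differentiableOn)

/-- The function `e` as an element of the disc algebra. -/
def IsBranchOver.unit (H : IsBranchOver f h e m ρ) : DiscAlgebra ρ :=
  discMk e H.analytic_unit.continuousOn
    ((H.analytic_unit.mono Metric.ball_subset_closedBall).differentiableOn)

theorem IsBranchOver.isUnit_unit (H : IsBranchOver f h e m ρ) : IsUnit H.unit :=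
  isUnit_discMk _ _ H.unit_ne_zero

theorem IsBranchOver.discExt_fn (H : IsBranchOver f h e m ρ) {z : ℂ}
    (hz : z ∈ Metric.closedBall (0 : ℂ) ρ) : discExt H.fn.1 z = h z :=
  discExt_discMk _ _ _ hz

theorem IsBranchOver.aeval_eq_zero (H : IsBranchOver f h e m ρ) :
    MvPolynomial.aeval ![discCoord ρ, H.fn] (toPoly f) = 0 := by
  refine discAlgebra_ext fun z hz => ?_
  rw [discExt_aeval _ _ hz, H.discExt_fn hz, H.eval_eq_zero z hz, discExt_apply _ hz]
  rfl

theorem IsBranchOver.aeval_pderiv (H : IsBranchOver f h e m ρ) :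
    MvPolynomial.aeval ![discCoord ρ, H.fn] (MvPolynomial.pderiv 1 (toPoly f)) =
      discCoord ρ ^ m * H.unit := by
  refine discAlgebra_ext fun z hz => ?_
  rw [discExt_aeval _ _ hz, H.discExt_fn hz, H.eval_pderiv z hz, discExt_apply _ hz]
  rfl

theorem IsBranchOver.divOp_bijective (H : IsBranchOver f h e m ρ) (hρ : 0 < ρ) :
    Function.Bijective (divOp (discCoord ρ) m
      (MvPolynomial.aeval ![discCoord ρ, H.fn] (MvPolynomial.pderiv 1 (toPoly f)))) := by
  rw [H.aeval_pderiv]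
  exact divOp_mul_unit_bijective (divOp_pow_bijective (isCoordinate_discCoord hρ) m) H.isUnit_unit

/-- `γ` and `w` parametrize, by the high coefficients, the polynomials near `f` that have a branch
close to `h`, and these branches. -/
structure IsBranchChart (H : IsBranchOver f h e m ρ) (γ : (HighIdx M m → ℂ) → PolySpace M)
    (w : (HighIdx M m → ℂ) → DiscAlgebra ρ) : Prop where
  analytic : AnalyticAt ℂ γ (high m f)
  analytic_branch : AnalyticAt ℂ w (high m f)
  map_base : γ (high m f) = f
  branch_base : w (high m f) = H.fn
  eventually_solution : ∀ᶠ s in 𝓝 (high m f), high m (γ s) = s ∧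
    MvPolynomial.aeval ![discCoord ρ, w s] (toPoly (γ s)) = 0
  eventually_unique : ∀ᶠ x in 𝓝 (f, H.fn),
    MvPolynomial.aeval ![discCoord ρ, x.2] (toPoly x.1) = 0 →
      x.1 = γ (high m x.1) ∧ x.2 = w (high m x.1)

theorem IsBranchOver.exists_chart (H : IsBranchOver f h e m ρ) (hρ : 0 < ρ) (hm : m ≤ M) :
    ∃ γ w, IsBranchChart H γ w := by
  obtain ⟨γ, w, h1, h2, h3, h4, h5, h6⟩ :=
    exists_parametrization hm H.aeval_eq_zero (H.divOp_bijective hρ)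
  exact ⟨γ, w, h1, h2, h3, h4, h5, h6⟩

theorem continuous_high : Continuous (high (M := M) m) := (high m).continuous

/-- Near `f`, the members of the chart have a branch close to `h`. -/
theorem IsBranchChart.eventually_isCloseBranch {H : IsBranchOver f h e m ρ}
    {γ : (HighIdx M m → ℂ) → PolySpace M} {w : (HighIdx M m → ℂ) → DiscAlgebra ρ}
    (C : IsBranchChart H γ w) {r : ℝ} (hr : r < ρ) (K : ℕ) {ε : ℝ} (hε : 0 < ε) :
    ∀ᶠ s in 𝓝 (high m f), IsCloseBranch h r K ε (γ s) (discExt (w s).1) := by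
  set c : ℝ := ∑ k ∈ Finset.range (K + 1), (k.factorial : ℝ) / ((ρ - r) / 2) ^ k with hc
  have hpos : 0 < (ρ - r) / 2 := by linarith
  have hc0 : 0 ≤ c := Finset.sum_nonneg fun k _ => by positivity
  have h1 : ∀ᶠ s in 𝓝 (high m f), dist (w s) H.fn < ε / (c + 1) := by
    have h2 := C.analytic_branch.continuousAt
    rw [ContinuousAt, C.branch_base] at h2
    exact h2.eventually (Metric.ball_mem_nhds _ (by positivity))
  filter_upwards [h1, C.eventually_solution] with s hs hs'
  have hsub : Metric.ball (0 : ℂ) r ⊆ Metric.ball 0 ρ := Metric.ball_subset_ball hr.le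
  refine ⟨(analyticOnNhd_discExt _).mono hsub, fun t ht => ?_, fun k hk t ht => ?_⟩
  · have ht' := Metric.ball_subset_closedBall (hsub ht)
    rw [← discExt_aeval _ _ ht', hs'.2, discExt_apply _ ht']
    rfl
  · have h3 : iteratedDeriv k h t = iteratedDeriv k (discExt H.fn.1) t := by
      refine Filter.EventuallyEq.iteratedDeriv_eq k ?_
      filter_upwards [Metric.isOpen_ball.mem_nhds (hsub ht)] with z hz
      exact (H.discExt_fn (Metric.ball_subset_closedBall hz)).symm
    rw [h3]
    refine lt_of_le_of_lt (norm_iteratedDeriv_discExt_sub_le _ _ hr k ht) ?_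
    have h4 : (k.factorial : ℝ) / ((ρ - r) / 2) ^ k ≤ c :=
      Finset.single_le_sum (f := fun k : ℕ => (k.factorial : ℝ) / ((ρ - r) / 2) ^ k)
        (fun k _ => by positivity) (Finset.mem_range.2 (by omega))
    rw [mul_div_right_comm]
    calc _ ≤ c * dist (w s) H.fn := mul_le_mul_of_nonneg_right h4 dist_nonneg
      _ ≤ c * (ε / (c + 1)) := mul_le_mul_of_nonneg_left hs.le hc0
      _ < ε := by
        rw [mul_div_assoc', div_lt_iff₀ (by linarith)]
        nlinarith

/-- Polynomials near `f` with a branch close to `h` are members of the chart, and their branch is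
the one given by the chart. Closeness is needed only on a disc, in the supremum norm. -/
theorem IsBranchChart.eventually_of_isCloseBranch {H : IsBranchOver f h e m ρ}
    {γ : (HighIdx M m → ℂ) → PolySpace M} {w : (HighIdx M m → ℂ) → DiscAlgebra ρ}
    (C : IsBranchChart H γ w) (hm : m ≤ M) {r : ℝ} (hr0 : 0 < r) (hr : r < ρ) :
    ∃ ε₀ > (0 : ℝ), ∀ᶠ g in 𝓝 f, ∀ (K : ℕ) (ε : ℝ), ε ≤ ε₀ → ∀ u, IsCloseBranch h r K ε g u →
      γ (high m g) = g ∧ Set.EqOn u (discExt (w (high m g)).1) (Metric.ball 0 r) := by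
  -- The chart over a smaller closed disc has a uniqueness property in terms of values there.
  have hr2 : (0 : ℝ) < r / 2 := by linarith
  have hle : r / 2 ≤ ρ := by linarith
  set H' := H.mono hle with hH'
  obtain ⟨γ', w', C'⟩ := H'.exists_chart hr2 hm
  obtain ⟨δ, hδ, hball⟩ := Metric.eventually_nhds_iff_ball.1 C'.eventually_unique
  refine ⟨δ / 2, by linarith, ?_⟩
  have hrestr : discRestrict hle H.fn = H'.fn := by
    refine discAlgebra_ext fun z hz => ?_
    rw [discRestrict, discExt_discMk _ _ _ hz, H'.discExt_fn hz,
      H.discExt_fn (Metric.closedBall_subset_closedBall hle hz)]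
  have hhigh : Tendsto (high m) (𝓝 f) (𝓝 (high m f)) := continuous_high.continuousAt
  have h1 : Tendsto (fun s => (γ s, discRestrict hle (w s))) (𝓝 (high m f)) (𝓝 (f, H'.fn)) := by
    have ha := C.analytic.continuousAt.tendsto
    have hb := ((continuous_discRestrict hle).tendsto _).comp C.analytic_branch.continuousAt.tendsto
    rw [C.map_base] at ha
    rw [C.branch_base, hrestr] at hb
    exact ha.prodMk_nhds hb
  have h2 := h1.eventually C'.eventually_unique
  filter_upwards [Metric.ball_mem_nhds f hδ, hhigh.eventually h2,
    hhigh.eventually C.eventually_solution] with g hg hg2 hg3 K ε hε u hu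
  obtain ⟨hu1, hu2, hu3⟩ := hu
  have hsub : Metric.closedBall (0 : ℂ) (r / 2) ⊆ Metric.ball 0 r :=
    Metric.closedBall_subset_ball (by linarith)
  set a : DiscAlgebra (r / 2) := discMk u (hu1.mono hsub).continuousOn
    ((hu1.mono (Metric.ball_subset_closedBall.trans hsub)).differentiableOn) with ha
  have hau : ∀ z ∈ Metric.closedBall (0 : ℂ) (r / 2), discExt a.1 z = u z :=
    fun z hz => discExt_discMk _ _ _ hz
  have hdist : dist a H'.fn < δ := by
    refine lt_of_le_of_lt (dist_discAlgebra_le _ _ (C := δ / 2) (by linarith) fun z hz => ?_)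
      (by linarith)
    rw [hau z hz, H'.discExt_fn hz, dist_eq_norm]
    have := hu3 0 (Nat.zero_le _) z (hsub hz)
    rw [iteratedDeriv_zero, iteratedDeriv_zero] at this
    linarith
  have h3 := hball (g, a) (by
    rw [Metric.mem_ball, Prod.dist_eq]
    exact max_lt hg hdist) (by
    refine discAlgebra_ext fun z hz => ?_
    rw [discExt_aeval _ _ hz, hau z hz, hu2 z (hsub hz), discExt_apply _ hz]
    rfl)
  have h4 := hg2 (by
    refine discAlgebra_ext fun z hz => ?_
    have hz' := Metric.closedBall_subset_closedBall hle hz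
    rw [discExt_aeval _ _ hz, discRestrict, discExt_discMk _ _ _ hz, ← discExt_aeval _ _ hz', hg3.2,
      discExt_apply _ hz', discExt_apply _ hz]
    rfl)
  simp only [hg3.1] at h3 h4
  refine ⟨h4.1.trans h3.1.symm, ?_⟩
  refine hu1.eqOn_of_preconnected_of_eventuallyEq (z₀ := 0)
    ((analyticOnNhd_discExt _).mono (Metric.ball_subset_ball hr.le))
    (convex_ball _ _).isPreconnected (Metric.mem_ball_self hr0) ?_
  filter_upwards [Metric.closedBall_mem_nhds (0 : ℂ) hr2] with z hz
  have h5 := h3.2.trans h4.2.symm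
  rw [← hau z hz, h5, discRestrict, discExt_discMk _ _ _ hz]

end Graph

/-! ### Taylor series -/

section Taylor

/-- The Taylor series of `u` at `0`. -/
def taylorSeries (u : ℂ → ℂ) : PowerSeries ℂ := PowerSeries.mk fun k => taylorCoeff k u

@[simp] theorem coeff_taylorSeries (k : ℕ) (u : ℂ → ℂ) :
    PowerSeries.coeff k (taylorSeries u) = taylorCoeff k u := PowerSeries.coeff_mk _ _

theorem taylorCoeff_congr {u v : ℂ → ℂ} (huv : u =ᶠ[𝓝 0] v) (k : ℕ) :
    taylorCoeff k u = taylorCoeff k v := by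
  rw [taylorCoeff, taylorCoeff, huv.iteratedDeriv_eq]

theorem taylorSeries_congr {u v : ℂ → ℂ} (huv : u =ᶠ[𝓝 0] v) : taylorSeries u = taylorSeries v := by
  ext k
  simp [taylorCoeff_congr huv k]

theorem taylorSeries_const (c : ℂ) : taylorSeries (fun _ => c) = PowerSeries.C c := by
  ext k
  rw [coeff_taylorSeries, taylorCoeff, iteratedDeriv_const, PowerSeries.coeff_C]
  by_cases hk : k = 0 <;> simp [hk]

theorem taylorSeries_id : taylorSeries (fun t => t) = PowerSeries.X := by
  ext k
  rw [coeff_taylorSeries, taylorCoeff, PowerSeries.coeff_X]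
  rcases k with _ | _ | k
  · simp
  · simp
  · rw [iteratedDeriv_succ']
    have : deriv (fun t : ℂ => t) = fun _ => 1 := by funext; simp
    rw [this, iteratedDeriv_const]
    simp

theorem taylorSeries_add {u v : ℂ → ℂ} (hu : AnalyticAt ℂ u 0) (hv : AnalyticAt ℂ v 0) :
    taylorSeries (u + v) = taylorSeries u + taylorSeries v := by
  ext k
  simp only [coeff_taylorSeries, map_add, taylorCoeff]
  rw [iteratedDeriv_add hu.contDiffAt hv.contDiffAt, add_div]

theorem taylorSeries_mul {u v : ℂ → ℂ} (hu : AnalyticAt ℂ u 0) (hv : AnalyticAt ℂ v 0) :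
    taylorSeries (u * v) = taylorSeries u * taylorSeries v := by
  ext k
  rw [PowerSeries.coeff_mul]
  simp only [coeff_taylorSeries, taylorCoeff]
  rw [iteratedDeriv_mul hu.contDiffAt hv.contDiffAt, Finset.sum_div,
    Finset.Nat.sum_antidiagonal_eq_sum_range_succ
      (fun i j => iteratedDeriv i u 0 / (i.factorial : ℂ) * (iteratedDeriv j v 0 / j.factorial))]
  refine Finset.sum_congr rfl fun i hi => ?_
  have hik : i ≤ k := by simpa [Nat.lt_succ_iff] using hi
  rw [Nat.cast_choose ℂ hik]
  have h1 : (k.factorial : ℂ) ≠ 0 := by exact_mod_cast k.factorial_ne_zero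
  have h2 : (i.factorial : ℂ) ≠ 0 := by exact_mod_cast i.factorial_ne_zero
  have h3 : ((k - i).factorial : ℂ) ≠ 0 := by exact_mod_cast (k - i).factorial_ne_zero
  field_simp

/-- The algebra of the functions of one variable that are analytic at `0`. -/
def analyticAtZero : Subalgebra ℂ (ℂ → ℂ) where
  carrier := {u | AnalyticAt ℂ u 0}
  mul_mem' hu hv := AnalyticAt.mul hu hv
  add_mem' hu hv := AnalyticAt.add hu hv
  algebraMap_mem' _ := analyticAt_const

/-- Taylor expansion at `0` as a homomorphism. -/
def taylorHom : analyticAtZero →ₐ[ℂ] PowerSeries ℂ where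
  toFun u := taylorSeries u.1
  map_one' := taylorSeries_const 1
  map_mul' u v := taylorSeries_mul u.2 v.2
  map_zero' := (taylorSeries_const 0).trans (map_zero _)
  map_add' u v := taylorSeries_add u.2 v.2
  commutes' c := taylorSeries_const c

theorem taylorSeries_eval {u : ℂ → ℂ} (hu : AnalyticAt ℂ u 0) (P : MvPolynomial (Fin 2) ℂ) :
    taylorSeries (fun t => MvPolynomial.eval ![t, u t] P) =
      MvPolynomial.aeval ![(PowerSeries.X : PowerSeries ℂ), taylorSeries u] P := by
  let a : Fin 2 → analyticAtZero := ![⟨fun t => t, analyticAt_id⟩, ⟨u, hu⟩]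
  have h1 : (fun t => MvPolynomial.eval ![t, u t] P) = (MvPolynomial.aeval a P).1 := by
    funext t
    have h2 : (MvPolynomial.aeval a P).1 t =
        ((Pi.evalAlgHom ℂ (fun _ : ℂ => ℂ) t).comp analyticAtZero.val) (MvPolynomial.aeval a P) :=
      rfl
    rw [h2, MvPolynomial.comp_aeval_apply, ← MvPolynomial.aeval_eq_eval]
    congr 2
    ext i
    fin_cases i <;> rfl
  rw [h1]
  change taylorHom (MvPolynomial.aeval a P) = _
  rw [MvPolynomial.comp_aeval_apply]
  congr 2
  ext1 i
  fin_cases i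
  · exact taylorSeries_id
  · rfl

variable {ρ : ℝ}

/-- The Taylor coefficient at `0` as a continuous linear functional on the disc algebra. -/
def discTaylorCoeff (hρ : 0 < ρ) (k : ℕ) : DiscAlgebra ρ →L[ℂ] ℂ :=
  LinearMap.mkContinuous
    { toFun := fun a => taylorCoeff k (discExt a.1)
      map_add' := fun a b => by
        have h0 : (0 : ℂ) ∈ Metric.ball (0 : ℂ) ρ := Metric.mem_ball_self hρ
        have h1 := taylorSeries_add (analyticOnNhd_discExt a 0 h0) (analyticOnNhd_discExt b 0 h0)
        rw [← coeff_taylorSeries, ← coeff_taylorSeries, ← coeff_taylorSeries, ← map_add, ← h1,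
          coeff_taylorSeries, coeff_taylorSeries]
        refine taylorCoeff_congr ?_ k
        filter_upwards [Metric.closedBall_mem_nhds (0 : ℂ) hρ] with z hz
        rw [Pi.add_apply, discExt_apply _ hz, discExt_apply _ hz, discExt_apply _ hz]
        rfl
      map_smul' := fun c a => by
        have h0 : (0 : ℂ) ∈ Metric.ball (0 : ℂ) ρ := Metric.mem_ball_self hρ
        have h1 := taylorSeries_mul (analyticAt_const (v := c)) (analyticOnNhd_discExt a 0 h0)
        rw [RingHom.id_apply, smul_eq_mul, ← coeff_taylorSeries k (discExt a.1),
          ← PowerSeries.coeff_C_mul, ← taylorSeries_const, ← h1, coeff_taylorSeries]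
        refine taylorCoeff_congr ?_ k
        filter_upwards [Metric.closedBall_mem_nhds (0 : ℂ) hρ] with z hz
        rw [Pi.mul_apply, discExt_apply _ hz, discExt_apply _ hz]
        rfl }
    (1 / (ρ / 2 / 2) ^ k) fun a => by
      have h1 := norm_iteratedDeriv_discExt_sub_le a 0 (r := ρ / 2) (by linarith) k
        (t := 0) (Metric.mem_ball_self (by linarith))
      have h2 : iteratedDeriv k (discExt (0 : DiscAlgebra ρ).1) 0 = 0 := by
        have : discExt (0 : DiscAlgebra ρ).1 =ᶠ[𝓝 0] fun _ => 0 := by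
          filter_upwards [Metric.closedBall_mem_nhds (0 : ℂ) hρ] with z hz
          rw [discExt_apply _ hz]
          rfl
        rw [this.iteratedDeriv_eq, iteratedDeriv_const]
        simp
      rw [h2, sub_zero, dist_zero_right, sub_half] at h1
      change ‖taylorCoeff k (discExt a.1)‖ ≤ _
      have h3 : (0 : ℝ) < k.factorial := by exact_mod_cast k.factorial_pos
      rw [taylorCoeff, norm_div, Complex.norm_natCast, div_le_iff₀ h3]
      refine h1.trans (le_of_eq ?_)
      ring

end Taylor

/-! ### Homomorphisms from rings of analytic germs to test rings -/

section TestRings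

variable {ι : Type} [Fintype ι] {p : ι → ℂ}

/-- The `i`-th coordinate as a function analytic at `p`. -/
def coordFn (p : ι → ℂ) (i : ι) : analyticFunctionsAt p :=
  ⟨fun g => g i, (ContinuousLinearMap.proj (R := ℂ) (φ := fun _ : ι => ℂ) i).analyticAt p⟩

/-- Evaluation of functions at a point, which need not be the base point. -/
def evalFn (p g : ι → ℂ) : analyticFunctionsAt p →ₐ[ℂ] ℂ :=
  (Pi.evalAlgHom ℂ (fun _ : ι → ℂ => ℂ) g).comp (analyticFunctionsAt p).val

theorem evalFn_apply (p g : ι → ℂ) (G : analyticFunctionsAt p) : evalFn p g G = G.1 g := rfl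

/-- Hadamard's lemma for analytic functions. -/
theorem exists_hadamard (G : analyticFunctionsAt p) : ∃ D : ι → analyticFunctionsAt p,
    ∀ᶠ x in 𝓝 p, G.1 x = G.1 p + ∑ i, (x i - p i) * (D i).1 x := by
  obtain ⟨q, r, hq⟩ := (show AnalyticAt ℂ G.1 p from G.2)
  have hrad : 0 < q.shift.radius := by
    rw [FormalMultilinearSeries.radius_shift]
    exact lt_of_lt_of_le hq.r_pos hq.r_le
  have hs := q.shift.hasFPowerSeriesOnBall hrad
  set D : (ι → ℂ) → ((ι → ℂ) →L[ℂ] ℂ) := fun x => q.shift.sum (x - p) with hD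
  have hDan : AnalyticAt ℂ D p := by
    have h1 : AnalyticAt ℂ q.shift.sum (p - p) := by
      rw [sub_self]; exact hs.analyticAt
    exact AnalyticAt.comp (g := q.shift.sum) (f := fun x => x - p) h1
      (analyticAt_id.sub analyticAt_const)
  classical
  refine ⟨fun i => ⟨fun x => D x (Pi.single i 1), ?_⟩, ?_⟩
  · exact ((ContinuousLinearMap.apply ℂ ℂ (Pi.single i (1 : ℂ))).analyticAt _).comp hDan
  · have hball : Metric.eball p (min r q.shift.radius) ∈ 𝓝 p :=
      Metric.eball_mem_nhds p (lt_min hq.r_pos hrad)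
    filter_upwards [hball] with x hx
    set y := x - p with hy
    have hy1 : y ∈ Metric.eball (0 : ι → ℂ) (min r q.shift.radius) := by
      rw [Metric.mem_eball, edist_zero_right, hy, ← edist_eq_enorm_sub]
      exact hx
    have h1 := hq.hasSum (Metric.eball_subset_eball (min_le_left _ _) hy1)
    have h2 := hs.hasSum (Metric.eball_subset_eball (min_le_right _ _) hy1)
    have h3 := (ContinuousLinearMap.apply ℂ ℂ y).hasSum h2
    have h4 : D x y = ∑ i, (x i - p i) * D x (Pi.single i 1) := by
      conv_lhs => rw [pi_eq_sum_univ' y]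
      rw [map_sum]
      refine Finset.sum_congr rfl fun i _ => ?_
      rw [map_smul, smul_eq_mul, hy, Pi.sub_apply]
    rw [← h4]
    have h5 := (hasSum_nat_add_iff' 1).2 h1
    have h6 : HasSum (fun n => q (n + 1) fun _ => y) (D x y) := by
      have h7 : (fun n => q (n + 1) fun _ => y) =
          fun n => (ContinuousLinearMap.apply ℂ ℂ y) (q.shift n fun _ => y) := by
        funext n
        have h8 : (Fin.snoc (fun _ : Fin n => y) y : Fin (n + 1) → ι → ℂ) = fun _ => y := by
          funext j
          simp [Fin.snoc]
        change _ = q (n + 1) (Fin.snoc (fun _ : Fin n => y) y)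
        rw [h8]
      rw [h7]
      rw [zero_add] at h3
      exact h3
    have h7 := h5.unique h6
    have h8 : q 0 (fun _ => y) = G.1 p := hq.coeff_zero _
    rw [Finset.sum_range_one, h8, hy, add_sub_cancel] at h7
    rw [← hy] at h7
    rw [← h7]; ring

/-- A homomorphism from the ring of functions analytic at `p` that depends only on germs. -/
def KillsGerms {A : Type*} [CommRing A] [Algebra ℂ A] (φ : analyticFunctionsAt p →ₐ[ℂ] A) : Prop :=
  ∀ G : analyticFunctionsAt p, (∀ᶠ x in 𝓝 p, G.1 x = 0) → φ G = 0

variable {A : Type*} [CommRing A] [Algebra ℂ A] [IsLocalRing A]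

theorem exists_sub_algebraMap_mem [Module.Finite ℂ A] (a : A) :
    ∃ c : ℂ, a - algebraMap ℂ A c ∈ IsLocalRing.maximalIdeal A := by
  have hint : Algebra.IsIntegral ℂ (IsLocalRing.ResidueField A) := inferInstance
  obtain ⟨c, hc⟩ := (IsAlgClosed.algebraMap_bijective_of_isIntegral (k := ℂ)
    (K := IsLocalRing.ResidueField A)).2 (IsLocalRing.residue A a)
  refine ⟨c, ?_⟩
  rw [← IsLocalRing.residue_eq_zero_iff, map_sub, ← hc]
  exact sub_self _

/-- Homomorphisms that depend only on germs are local. -/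
theorem KillsGerms.sub_mem [Module.Finite ℂ A] {φ : analyticFunctionsAt p →ₐ[ℂ] A}
    (hφ : KillsGerms φ) (G : analyticFunctionsAt p) :
    φ G - algebraMap ℂ A (G.1 p) ∈ IsLocalRing.maximalIdeal A := by
  obtain ⟨c, hc⟩ := exists_sub_algebraMap_mem (φ G)
  by_cases hcp : G.1 p = c
  · rwa [hcp]
  exfalso
  have hG : AnalyticAt ℂ G.1 p := G.2
  have hne : G.1 p - c ≠ 0 := sub_ne_zero.2 hcp
  have han : AnalyticAt ℂ (fun x => G.1 x - c) p := hG.sub analyticAt_const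
  let I : analyticFunctionsAt p := ⟨fun x => (G.1 x - c)⁻¹, han.inv hne⟩
  have h1 : φ ((G - algebraMap ℂ _ c) * I - 1) = 0 := by
    refine hφ _ ?_
    filter_upwards [han.continuousAt.eventually_ne hne] with x hx
    change (G.1 x - c) * (G.1 x - c)⁻¹ - 1 = 0
    rw [mul_inv_cancel₀ hx, sub_self]
  rw [map_sub, map_mul, map_sub, AlgHom.commutes, map_one, sub_eq_zero] at h1
  exact (IsLocalRing.mem_maximalIdeal _).1 hc (IsUnit.of_mul_eq_one _ h1)

theorem exists_maximalIdeal_pow_eq_bot [Module.Finite ℂ A] :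
    ∃ N : ℕ, IsLocalRing.maximalIdeal A ^ N = ⊥ := by
  have : IsArtinianRing A := IsArtinianRing.of_finite ℂ A
  exact IsArtinianRing.isNilpotent_jacobson_bot (R := A) |> fun ⟨n, hn⟩ =>
    ⟨n, by rwa [IsLocalRing.jacobson_eq_maximalIdeal ⊥ bot_ne_top] at hn⟩

/-- A homomorphism to a test ring that depends only on germs is determined by the images of the
coordinates. -/
theorem KillsGerms.eq_of_coord [Module.Finite ℂ A] {φ ψ : analyticFunctionsAt p →ₐ[ℂ] A}
    (hφ : KillsGerms φ) (hψ : KillsGerms ψ) (h : ∀ i, φ (coordFn p i) = ψ (coordFn p i)) :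
    φ = ψ := by
  have key : ∀ (n : ℕ) (G : analyticFunctionsAt p),
      φ G - ψ G ∈ IsLocalRing.maximalIdeal A ^ n := by
    intro n
    induction n with
    | zero => intro G; simp
    | succ n ih =>
      intro G
      obtain ⟨D, hD⟩ := exists_hadamard G
      have h1 : ∀ χ : analyticFunctionsAt p →ₐ[ℂ] A, KillsGerms χ → χ G =
          algebraMap ℂ A (G.1 p) +
            ∑ i, (χ (coordFn p i) - algebraMap ℂ A (p i)) * χ (D i) := by
        intro χ hχ
        have h2 : χ (G - (algebraMap ℂ _ (G.1 p) +
            ∑ i, (coordFn p i - algebraMap ℂ _ (p i)) * D i)) = 0 := by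
          refine hχ _ ?_
          filter_upwards [hD] with x hx
          rw [← evalFn_apply p x]
          simp only [map_sub, map_add, map_sum, map_mul, AlgHom.commutes]
          simp only [evalFn_apply, coordFn, Algebra.algebraMap_self, RingHom.id_apply]
          rw [hx, sub_self]
        rw [map_sub, sub_eq_zero] at h2
        rw [h2]
        simp only [map_sub, map_add, map_sum, map_mul, AlgHom.commutes]
      rw [h1 φ hφ, h1 ψ hψ, add_sub_add_left_eq_sub, ← Finset.sum_sub_distrib]
      refine Ideal.sum_mem _ fun i _ => ?_
      rw [h i, ← mul_sub, pow_succ']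
      exact Ideal.mul_mem_mul (hψ.sub_mem (coordFn p i)) (ih (D i))
  obtain ⟨N, hN⟩ := exists_maximalIdeal_pow_eq_bot (A := A)
  ext G
  have := key N G
  rw [hN, Ideal.mem_bot, sub_eq_zero] at this
  exact this

end TestRings

/-! ### Taylor expansion evaluated at points of test rings -/

section JetEvaluation

variable {ι : Type} [Fintype ι] {p : ι → ℂ}

variable (p) in
/-- The ideal of the analytic functions that vanish at `p`. -/
def pointIdeal : Ideal (analyticFunctionsAt p) := RingHom.ker (evalFn p p)

theorem mem_pointIdeal {G : analyticFunctionsAt p} : G ∈ pointIdeal p ↔ G.1 p = 0 := Iff.rfl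

/-- Functions with zero germ belong to all powers of the maximal ideal: they are unchanged by
multiplication with the indicator function of their support, which has zero germ too. -/
theorem mem_pointIdeal_pow_of_eventually {G : analyticFunctionsAt p} (hG : ∀ᶠ x in 𝓝 p, G.1 x = 0)
    (n : ℕ) : G ∈ pointIdeal p ^ n := by
  classical
  let χ : (ι → ℂ) → ℂ := fun x => if G.1 x = 0 then 0 else 1
  have hχ : χ =ᶠ[𝓝 p] fun _ => 0 := by
    filter_upwards [hG] with x hx
    simp [χ, hx]
  let X : analyticFunctionsAt p := ⟨χ, analyticAt_const.congr hχ.symm⟩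
  have h1 : X * G = G := by
    refine Subtype.ext (funext fun x => ?_)
    change χ x * G.1 x = G.1 x
    by_cases hx : G.1 x = 0 <;> simp [χ, hx]
  have h2 : ∀ n : ℕ, X ^ n * G = G := by
    intro n
    induction n with
    | zero => simp
    | succ n ih => rw [pow_succ, mul_assoc, h1, ih]
  rw [← h2 n]
  refine Ideal.mul_mem_right _ _ (Ideal.pow_mem_pow ?_ n)
  exact mem_pointIdeal.2 hχ.self_of_nhds

/-- Polynomials as analytic functions. -/
def polyFn (p : ι → ℂ) : MvPolynomial ι ℂ →ₐ[ℂ] analyticFunctionsAt p :=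
  MvPolynomial.aeval (coordFn p)

/-- Analytic functions are polynomials up to any power of the maximal ideal. -/
theorem exists_polyFn_sub_mem (n : ℕ) (G : analyticFunctionsAt p) :
    ∃ P, G - polyFn p P ∈ pointIdeal p ^ n := by
  induction n generalizing G with
  | zero => exact ⟨0, by simp⟩
  | succ n ih =>
    obtain ⟨D, hD⟩ := exists_hadamard G
    choose P hP using fun i => ih (D i)
    refine ⟨MvPolynomial.C (G.1 p) +
      ∑ i, (MvPolynomial.X i - MvPolynomial.C (p i)) * P i, ?_⟩
    have h1 : G - (algebraMap ℂ _ (G.1 p) +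
        ∑ i, (coordFn p i - algebraMap ℂ _ (p i)) * D i) ∈ pointIdeal p ^ (n + 1) := by
      refine mem_pointIdeal_pow_of_eventually ?_ _
      filter_upwards [hD] with x hx
      rw [← evalFn_apply p x]
      simp only [map_sub, map_add, map_sum, map_mul, AlgHom.commutes]
      simp only [evalFn_apply, coordFn, Algebra.algebraMap_self, RingHom.id_apply]
      rw [hx, sub_self]
    have h2 : polyFn p (MvPolynomial.C (G.1 p) +
        ∑ i, (MvPolynomial.X i - MvPolynomial.C (p i)) * P i) = algebraMap ℂ _ (G.1 p) +
        ∑ i, (coordFn p i - algebraMap ℂ _ (p i)) * polyFn p (P i) := by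
      simp [polyFn]
    have h3 : ∑ i, (coordFn p i - algebraMap ℂ _ (p i)) * (D i - polyFn p (P i)) ∈
        pointIdeal p ^ (n + 1) := by
      refine Ideal.sum_mem _ fun i _ => ?_
      rw [pow_succ']
      refine Ideal.mul_mem_mul (mem_pointIdeal.2 ?_) (hP i)
      change p i - p i = 0
      exact sub_self _
    convert Ideal.add_mem _ h1 h3 using 1
    rw [h2]
    simp only [mul_sub, Finset.sum_sub_distrib]
    ring

/-- Restriction to a line through `p`. -/
def lineHom (p z : ι → ℂ) : analyticFunctionsAt p →ₐ[ℂ] analyticAtZero where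
  toFun G := ⟨fun t => G.1 (fun i => p i + t * z i), by
    have h0 : (fun i => p i + (0 : ℂ) * z i) = p := by funext i; ring
    refine AnalyticAt.comp (g := G.1) (f := fun (t : ℂ) i => p i + t * z i) ?_ ?_
    · rw [h0]; exact G.2
    · rw [analyticAt_pi_iff]
      intro i
      exact analyticAt_const.add (analyticAt_id.mul analyticAt_const)⟩
  map_one' := rfl
  map_mul' _ _ := rfl
  map_zero' := rfl
  map_add' _ _ := rfl
  commutes' _ := rfl

theorem X_pow_dvd_taylorHom_lineHom (z : ι → ℂ) {n : ℕ} {G : analyticFunctionsAt p}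
    (hG : G ∈ pointIdeal p ^ n) : PowerSeries.X ^ n ∣ taylorHom (lineHom p z G) := by
  have h1 : (pointIdeal p).map (taylorHom.comp (lineHom p z)) ≤ Ideal.span {PowerSeries.X} := by
    rw [Ideal.map_le_iff_le_comap]
    intro F hF
    rw [Ideal.mem_comap, Ideal.mem_span_singleton, PowerSeries.X_dvd_iff,
      ← PowerSeries.coeff_zero_eq_constantCoeff_apply]
    change PowerSeries.coeff 0 (taylorSeries fun t => F.1 fun i => p i + t * z i) = 0
    rw [coeff_taylorSeries, taylorCoeff, iteratedDeriv_zero]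
    have : (fun i => p i + (0 : ℂ) * z i) = p := by funext i; ring
    rw [this, mem_pointIdeal.1 hF, zero_div]
  have h2 := Ideal.mem_map_of_mem (taylorHom.comp (lineHom p z)) hG
  rw [Ideal.map_pow] at h2
  have h3 := Ideal.pow_right_mono h1 n h2
  rwa [Ideal.span_singleton_pow, Ideal.mem_span_singleton] at h3

theorem coeff_aeval_mul_X {ι : Type*} (z : ι → ℂ) (Q : MvPolynomial ι ℂ) (d : ℕ) :
    PowerSeries.coeff d (MvPolynomial.aeval
      (fun i => algebraMap ℂ (PowerSeries ℂ) (z i) * PowerSeries.X) Q) =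
      MvPolynomial.eval z (MvPolynomial.homogeneousComponent d Q) := by
  induction Q using MvPolynomial.induction_on' with
  | add P Q hP hQ => simp only [map_add, hP, hQ]
  | monomial s c =>
    have h1 : MvPolynomial.aeval
        (fun i => algebraMap ℂ (PowerSeries ℂ) (z i) * PowerSeries.X) (MvPolynomial.monomial s c) =
        algebraMap ℂ (PowerSeries ℂ) (MvPolynomial.eval z (MvPolynomial.monomial s c)) *
          PowerSeries.X ^ s.degree := by
      rw [MvPolynomial.aeval_monomial, MvPolynomial.eval_monomial, Finsupp.degree_apply,
        map_mul, mul_assoc, Finsupp.prod, Finsupp.prod, ← Finset.prod_pow_eq_pow_sum, map_prod,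
        ← Finset.prod_mul_distrib]
      simp only [mul_pow, map_pow]
    rw [h1, MvPolynomial.homogeneousComponent_of_mem
      (MvPolynomial.isHomogeneous_monomial c rfl)]
    have h2 : algebraMap ℂ (PowerSeries ℂ) (MvPolynomial.eval z (MvPolynomial.monomial s c)) =
      PowerSeries.C (MvPolynomial.eval z (MvPolynomial.monomial s c)) := rfl
    rw [h2, PowerSeries.coeff_C_mul, PowerSeries.coeff_X_pow]
    split_ifs <;> simp

theorem aeval_translate {ι C : Type*} [CommRing C] [Algebra ℂ C] (b : ι → C) (p : ι → ℂ)
    (P : MvPolynomial ι ℂ) : MvPolynomial.aeval (fun i => b i + algebraMap ℂ C (p i)) P =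
      MvPolynomial.aeval b
        (MvPolynomial.aeval (fun i => MvPolynomial.X i + MvPolynomial.C (p i)) P) := by
  rw [MvPolynomial.comp_aeval_apply]
  congr 2
  funext i
  simp

variable {A : Type*} [CommRing A] [Algebra ℂ A]

/-- A polynomial in the `n`-th power of the maximal ideal of `p` is zero at points that differ
from `p` by elements of an ideal with `n`-th power zero. -/
theorem aeval_eq_zero_of_polyFn_mem {I : Ideal A} {n : ℕ} (hI : I ^ n = ⊥) {a : ι → A}
    (ha : ∀ i, a i - algebraMap ℂ A (p i) ∈ I) {P : MvPolynomial ι ℂ}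
    (hP : polyFn p P ∈ pointIdeal p ^ n) : MvPolynomial.aeval a P = 0 := by
  set Q : MvPolynomial ι ℂ :=
    MvPolynomial.aeval (fun i => MvPolynomial.X i + MvPolynomial.C (p i)) P with hQ
  -- the restriction of `P` to a line through `p`, as a power series
  have hline : ∀ z : ι → ℂ, taylorHom (lineHom p z (polyFn p P)) = MvPolynomial.aeval
      (fun i => algebraMap ℂ (PowerSeries ℂ) (z i) * PowerSeries.X) Q := by
    intro z
    rw [hQ, ← aeval_translate, polyFn, MvPolynomial.comp_aeval_apply, MvPolynomial.comp_aeval_apply]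
    congr 2
    funext i
    have h0 : lineHom p z (coordFn p i) = algebraMap ℂ _ (z i) * ⟨fun t => t, analyticAt_id⟩ +
        algebraMap ℂ _ (p i) := by
      refine Subtype.ext (funext fun t => ?_)
      change p i + t * z i = z i * t + p i
      ring
    rw [h0, map_add, map_mul, AlgHom.commutes, AlgHom.commutes]
    congr 2
    exact taylorSeries_id
  have hcomp : ∀ d < n, MvPolynomial.homogeneousComponent d Q = 0 := by
    intro d hd
    refine MvPolynomial.funext fun z => ?_
    rw [← coeff_aeval_mul_X, ← hline, map_zero]
    exact PowerSeries.X_pow_dvd_iff.1 (X_pow_dvd_taylorHom_lineHom z hP) d hd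
  have h1 : MvPolynomial.aeval a P =
      MvPolynomial.aeval (fun i => a i - algebraMap ℂ A (p i)) Q := by
    rw [hQ, ← aeval_translate]
    simp
  rw [h1, MvPolynomial.aeval_def, MvPolynomial.eval₂_eq]
  refine Finset.sum_eq_zero fun s hs => ?_
  have hsn : n ≤ s.degree := by
    by_contra hlt
    push Not at hlt
    have := congrArg (MvPolynomial.coeff s) (hcomp _ hlt)
    rw [MvPolynomial.coeff_homogeneousComponent, if_pos rfl, MvPolynomial.coeff_zero] at this
    exact MvPolynomial.mem_support_iff.1 hs this
  have h2 : ∏ i ∈ s.support, (a i - algebraMap ℂ A (p i)) ^ s i ∈ I ^ n := by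
    refine Ideal.pow_le_pow_right hsn ?_
    rw [Finsupp.degree_apply, ← Finset.prod_pow_eq_pow_sum]
    exact Ideal.prod_mem_prod fun i _ => Ideal.pow_mem_pow (ha i) _
  rw [hI, Ideal.mem_bot] at h2
  rw [h2, mul_zero]

variable [IsLocalRing A]

/-- Taylor expansion at `p`, evaluated at a point of a test ring that reduces to `p`. -/
theorem exists_killsGerms [Module.Finite ℂ A] {a : ι → A}
    (ha : ∀ i, a i - algebraMap ℂ A (p i) ∈ IsLocalRing.maximalIdeal A) :
    ∃ φ : analyticFunctionsAt p →ₐ[ℂ] A, KillsGerms φ ∧ ∀ i, φ (coordFn p i) = a i := by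
  obtain ⟨N, hN⟩ := exists_maximalIdeal_pow_eq_bot (A := A)
  set α := (Ideal.Quotient.mkₐ ℂ (pointIdeal p ^ N)).comp (polyFn p) with hα
  have hsurj : Function.Surjective α := by
    intro x
    obtain ⟨G, rfl⟩ := Ideal.Quotient.mk_surjective x
    obtain ⟨P, hP⟩ := exists_polyFn_sub_mem N G
    exact ⟨P, ((Ideal.Quotient.mk_eq_mk_iff_sub_mem _ _).2 hP).symm⟩
  have hker : ∀ P ∈ RingHom.ker α, MvPolynomial.aeval a P = 0 := fun P hP =>
    aeval_eq_zero_of_polyFn_mem hN ha (Ideal.Quotient.eq_zero_iff_mem.1 hP)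
  let e := Ideal.quotientKerAlgEquivOfSurjective hsurj
  let φ := ((Ideal.Quotient.liftₐ (RingHom.ker α) (MvPolynomial.aeval a) hker).comp
    e.symm.toAlgHom).comp (Ideal.Quotient.mkₐ ℂ (pointIdeal p ^ N))
  have hφ : ∀ P, φ (polyFn p P) = MvPolynomial.aeval a P := by
    intro P
    have h1 : e.symm (α P) = Ideal.Quotient.mk _ P := by
      rw [AlgEquiv.symm_apply_eq]
      rfl
    change Ideal.Quotient.liftₐ (RingHom.ker α) (MvPolynomial.aeval a) hker (e.symm (α P)) = _
    rw [h1]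
    rfl
  refine ⟨φ, fun G hG => ?_, fun i => ?_⟩
  · have h2 : Ideal.Quotient.mkₐ ℂ (pointIdeal p ^ N) G = 0 :=
      Ideal.Quotient.eq_zero_iff_mem.2 (mem_pointIdeal_pow_of_eventually hG N)
    rw [AlgHom.comp_apply, h2, map_zero]
  · have h3 := hφ (MvPolynomial.X i)
    rwa [polyFn, MvPolynomial.aeval_X, MvPolynomial.aeval_X] at h3

end JetEvaluation

/-! ### Power series solutions over test rings -/

section SeriesSolutions

variable {M : ℕ}

theorem exponent_apply_zero (p : PolyIdx M) : p.exponent 0 = p.1.1 := by simp [PolyIdx.exponent]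

theorem exponent_apply_one (p : PolyIdx M) : p.exponent 1 = p.1.2 := by simp [PolyIdx.exponent]

theorem exponent_injective : Function.Injective (PolyIdx.exponent (M := M)) := by
  intro p q hpq
  have h0 := congrArg (fun s : Fin 2 →₀ ℕ => s 0) hpq
  have h1 := congrArg (fun s : Fin 2 →₀ ℕ => s 1) hpq
  simp only [exponent_apply_zero, exponent_apply_one] at h0 h1
  exact Subtype.ext (Prod.ext (Fin.ext h0) (Fin.ext h1))

theorem exists_exponent_eq {s : Fin 2 →₀ ℕ} (hs : s 0 + s 1 ≤ M) :
    ∃ p : PolyIdx M, p.exponent = s := by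
  refine ⟨⟨(⟨s 0, by omega⟩, ⟨s 1, by omega⟩), hs⟩, ?_⟩
  ext i
  fin_cases i
  · exact exponent_apply_zero _
  · exact exponent_apply_one _

theorem coeff_eq_zero_of_lt {C : Type*} [CommRing C] {F : MvPolynomial (Fin 2) C}
    (hF : F.totalDegree ≤ M) {s : Fin 2 →₀ ℕ} (hs : M < s 0 + s 1) : F.coeff s = 0 := by
  by_contra hne
  have h2 := MvPolynomial.le_totalDegree (MvPolynomial.mem_support_iff.mpr hne)
  rw [Finsupp.sum_fintype _ _ (by simp)] at h2
  simp [Fin.sum_univ_two] at h2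
  omega

theorem coeff_sum_monomial {C : Type*} [CommRing C] (c : PolyIdx M → C) (p : PolyIdx M) :
    (∑ q : PolyIdx M, MvPolynomial.monomial q.exponent (c q)).coeff p.exponent = c p := by
  rw [MvPolynomial.coeff_sum, Finset.sum_eq_single p]
  · simp
  · intro q _ hq
    rw [MvPolynomial.coeff_monomial, if_neg]
    exact fun h => hq (exponent_injective h)
  · simp

theorem totalDegree_sum_monomial_le {C : Type*} [CommRing C] (c : PolyIdx M → C) :
    (∑ q : PolyIdx M, MvPolynomial.monomial q.exponent (c q)).totalDegree ≤ M := by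
  refine MvPolynomial.totalDegree_finsetSum_le fun q _ => ?_
  refine (MvPolynomial.totalDegree_monomial_le _ _).trans ?_
  rw [Finsupp.sum_fintype _ _ (by simp), Fin.sum_univ_two, exponent_apply_zero, exponent_apply_one]
  exact q.2

theorem sum_monomial_coeff {C : Type*} [CommRing C] {F : MvPolynomial (Fin 2) C}
    (hF : F.totalDegree ≤ M) :
    ∑ q : PolyIdx M, MvPolynomial.monomial q.exponent (F.coeff q.exponent) = F := by
  ext s
  by_cases hs : s 0 + s 1 ≤ M
  · obtain ⟨p, rfl⟩ := exists_exponent_eq hs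
    exact coeff_sum_monomial (fun q => F.coeff q.exponent) p
  · push Not at hs
    rw [coeff_eq_zero_of_lt hF hs, coeff_eq_zero_of_lt (totalDegree_sum_monomial_le _) hs]

/-- The power series `F(t, H(t))`, where `c` is the coefficient vector of `F`. -/
def substSeries {C : Type*} [CommRing C] (c : PolyIdx M → C) (H : PowerSeries C) : PowerSeries C :=
  ∑ p : PolyIdx M, PowerSeries.C (c p) * (PowerSeries.X ^ (p.1.1 : ℕ) * H ^ (p.1.2 : ℕ))

theorem map_substSeries {C C' : Type*} [CommRing C] [CommRing C'] (φ : C →+* C')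
    (c : PolyIdx M → C) (H : PowerSeries C) : PowerSeries.map φ (substSeries c H) =
      substSeries (fun p => φ (c p)) (PowerSeries.map φ H) := by
  simp only [substSeries, map_sum, map_mul, map_pow, PowerSeries.map_X, PowerSeries.map_C]

theorem aeval_sum_monomial {C : Type*} [CommRing C] (c : PolyIdx M → C) (H : PowerSeries C) :
    MvPolynomial.aeval ![(PowerSeries.X : PowerSeries C), H]
      (∑ q : PolyIdx M, MvPolynomial.monomial q.exponent (c q)) = substSeries c H := by
  rw [map_sum, substSeries]
  refine Finset.sum_congr rfl fun p _ => ?_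
  rw [aeval_monomial_exponent, PowerSeries.smul_eq_C_mul]

/-- Uniqueness of infinitesimal deformations: over a ring `A`, among the deformations of `f` with
given coefficients at the monomials other than `x ^ i` with `i < m`, at most one has a power
series solution deforming that of `f`. The reason is that the linearized equation expresses zero
as `∑_{i < m} δ_i t^i + t^m ε(t)`, up to a unit and to terms of higher order. -/
theorem eq_of_substSeries_eq_zero {m : ℕ} (hm : m ≤ M) {A : Type*} [CommRing A] [Algebra ℂ A]
    {I : Ideal A} {N : ℕ} (hI : I ^ N = ⊥) {f : PolySpace M} {h E : PowerSeries ℂ}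
    (hE : IsUnit E)
    (hq : MvPolynomial.aeval ![(PowerSeries.X : PowerSeries ℂ), h]
      (MvPolynomial.pderiv 1 (toPoly f)) = PowerSeries.X ^ m * E)
    {c c' : PolyIdx M → A} {H H' : PowerSeries A}
    (hc : ∀ p, c p - algebraMap ℂ A (f p) ∈ I)
    (hH : ∀ k, PowerSeries.coeff k H - algebraMap ℂ A (PowerSeries.coeff k h) ∈ I)
    (hH' : ∀ k, PowerSeries.coeff k H' - algebraMap ℂ A (PowerSeries.coeff k h) ∈ I)
    (hcc : ∀ p : HighIdx M m, c p.1 = c' p.1)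
    (h0 : substSeries c H = 0) (h0' : substSeries c' H' = 0) : c = c' := by
  set D := H - H' with hD
  -- the divided difference of `F(t, ·)` at `H` and `H'`
  set Q : PowerSeries A := ∑ p : PolyIdx M, PowerSeries.C (c p) * (PowerSeries.X ^ (p.1.1 : ℕ) *
    ∑ i ∈ Finset.range (p.1.2 : ℕ), H ^ i * H' ^ ((p.1.2 : ℕ) - 1 - i)) with hQ
  set δ : Fin m → A := fun i => c (lowIdx hm i) - c' (lowIdx hm i) with hδ
  have hdiff : D * Q = substSeries c H - substSeries c H' := by
    rw [substSeries, substSeries, ← Finset.sum_sub_distrib, hQ, Finset.mul_sum]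
    refine Finset.sum_congr rfl fun p _ => ?_
    have := geom_sum₂_mul H H' (p.1.2 : ℕ)
    rw [← mul_sub, ← mul_sub, ← this, hD]
    ring
  have hlow : substSeries c H' - substSeries c' H' =
      ∑ i : Fin m, PowerSeries.C (δ i) * PowerSeries.X ^ (i : ℕ) := by
    rw [substSeries, substSeries, ← Finset.sum_sub_distrib]
    rw [← Finset.sum_subset (Finset.subset_univ (Finset.univ.map ⟨lowIdx hm, lowIdx_injective hm⟩))]
    · rw [Finset.sum_map]
      refine Finset.sum_congr rfl fun i _ => ?_
      rw [Function.Embedding.coeFn_mk, ← sub_mul, ← map_sub]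
      simp [lowIdx, hδ]
    · intro p _ hp
      have hnl : ¬ IsLow m p := by
        intro hl
        apply hp
        rw [Finset.mem_map]
        exact ⟨_, Finset.mem_univ _, (hl.eq_lowIdx hm).symm⟩
      rw [hcc ⟨p, hnl⟩, sub_self]
  have hmain : D * Q + ∑ i : Fin m, PowerSeries.C (δ i) * PowerSeries.X ^ (i : ℕ) = 0 := by
    rw [hdiff, ← hlow, h0, h0']
    ring
  -- modulo `I`, the divided difference is the derivative
  set E' : PowerSeries A := PowerSeries.map (algebraMap ℂ A) E with hE'
  have hE'u : IsUnit E' := hE.map _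
  have hQI : ∀ k, PowerSeries.coeff k (Q - PowerSeries.X ^ m * E') ∈ I := by
    intro k
    rw [← Ideal.Quotient.eq_zero_iff_mem, ← PowerSeries.coeff_map]
    set π := Ideal.Quotient.mk I with hπ
    have hHπ : ∀ {G : PowerSeries A}, (∀ k, PowerSeries.coeff k G -
        algebraMap ℂ A (PowerSeries.coeff k h) ∈ I) → PowerSeries.map π G =
        PowerSeries.map (π.comp (algebraMap ℂ A)) h := by
      intro G hG
      ext k
      rw [PowerSeries.coeff_map, PowerSeries.coeff_map, RingHom.comp_apply]
      exact (Ideal.Quotient.mk_eq_mk_iff_sub_mem _ _).2 (hG k)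
    have h1 : PowerSeries.map π (PowerSeries.X ^ m * E') =
        PowerSeries.map (π.comp (algebraMap ℂ A)) (PowerSeries.X ^ m * E) := by
      simp only [map_mul, map_pow, PowerSeries.map_X, hE']
      rw [PowerSeries.map_comp]
      rfl
    have h2 : PowerSeries.map π Q =
        PowerSeries.map (π.comp (algebraMap ℂ A)) (PowerSeries.X ^ m * E) := by
      rw [← hq, aeval_pderiv_toPoly, hQ, map_sum, map_sum]
      refine Finset.sum_congr rfl fun p _ => ?_
      have h3 : π (c p) = π.comp (algebraMap ℂ A) (f p) :=
        (Ideal.Quotient.mk_eq_mk_iff_sub_mem _ _).2 (hc p)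
      simp only [map_mul, map_sum, map_pow, PowerSeries.map_X, PowerSeries.map_C, hHπ hH, hHπ hH',
        PowerSeries.smul_eq_C_mul, map_nsmul, h3]
      congr 2
      rw [geom_sum₂_self, nsmul_eq_mul]
    rw [map_sub, h1, h2, sub_self, map_zero]
  have key : ∀ n : ℕ, (∀ i, δ i ∈ I ^ n) ∧ ∀ k, PowerSeries.coeff k D ∈ I ^ n := by
    intro n
    induction n with
    | zero => simp
    | succ n ih =>
      have h1 : ∀ k, PowerSeries.coeff k (D * (Q - PowerSeries.X ^ m * E')) ∈ I ^ (n + 1) := by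
        intro k
        rw [PowerSeries.coeff_mul, pow_succ]
        exact Ideal.sum_mem _ fun x _ => Ideal.mul_mem_mul (ih.2 _) (hQI _)
      have h2 : PowerSeries.X ^ m * (D * E') +
          ∑ i : Fin m, PowerSeries.C (δ i) * PowerSeries.X ^ (i : ℕ) =
          -(D * (Q - PowerSeries.X ^ m * E')) := by
        linear_combination hmain
      have h3 : ∀ k, PowerSeries.coeff k (PowerSeries.X ^ m * (D * E')) +
          PowerSeries.coeff k (∑ i : Fin m, PowerSeries.C (δ i) * PowerSeries.X ^ (i : ℕ)) ∈
          I ^ (n + 1) := by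
        intro k
        rw [← map_add, h2, map_neg]
        exact neg_mem (h1 k)
      have h4 : ∀ k, PowerSeries.coeff k
          (∑ i : Fin m, PowerSeries.C (δ i) * PowerSeries.X ^ (i : ℕ)) =
          if hk : k < m then δ ⟨k, hk⟩ else 0 := by
        intro k
        simp only [map_sum, PowerSeries.coeff_C_mul, PowerSeries.coeff_X_pow]
        split_ifs with hk
        · rw [Finset.sum_eq_single ⟨k, hk⟩]
          · simp
          · intro j _ hj
            rw [if_neg, mul_zero]
            exact fun h => hj (Fin.ext h.symm)
          · simp
        · refine Finset.sum_eq_zero fun j _ => ?_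
          rw [if_neg, mul_zero]
          have := j.2
          omega
      have h5 : ∀ k, PowerSeries.coeff k (D * E') ∈ I ^ (n + 1) := by
        intro k
        have := h3 (k + m)
        rwa [h4, dif_neg (by omega), add_zero, PowerSeries.coeff_X_pow_mul] at this
      refine ⟨fun i => ?_, fun k => ?_⟩
      · have := h3 i
        rwa [h4, dif_pos i.2, PowerSeries.coeff_X_pow_mul', if_neg (by have := i.2; omega),
          zero_add] at this
      · obtain ⟨u, hu⟩ := hE'u
        have h6 : D = D * E' * (↑u⁻¹ : PowerSeries A) := by
          rw [← hu, mul_assoc, Units.mul_inv, mul_one]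
        rw [h6, PowerSeries.coeff_mul]
        exact Ideal.sum_mem _ fun x _ => Ideal.mul_mem_right _ _ (h5 _)
  funext p
  by_cases hp : IsLow m p
  · have := (key N).1 ⟨p.1.1, hp.2⟩
    rw [hI, Ideal.mem_bot, hδ] at this
    simp only at this
    rw [← hp.eq_lowIdx hm, sub_eq_zero] at this
    exact this
  · exact hcc ⟨p, hp⟩

end SeriesSolutions

/-! ### The formal neighborhood of the branch locus -/

section FormalNeighborhood

variable {M m : ℕ} {f : PolySpace M} {h e : ℂ → ℂ} {ρ : ℝ}

theorem coeff_toPoly (g : PolySpace M) (p : PolyIdx M) : (toPoly g).coeff p.exponent = g p :=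
  coeff_sum_monomial g p

theorem totalDegree_toPoly_le (g : PolySpace M) : (toPoly g).totalDegree ≤ M :=
  totalDegree_sum_monomial_le g

theorem IsBranchOver.taylorSeries_pderiv (H : IsBranchOver f h e m ρ) (hρ : 0 < ρ) :
    MvPolynomial.aeval ![(PowerSeries.X : PowerSeries ℂ), taylorSeries h]
      (MvPolynomial.pderiv 1 (toPoly f)) = PowerSeries.X ^ m * taylorSeries e := by
  have h0 : (0 : ℂ) ∈ Metric.closedBall (0 : ℂ) ρ := Metric.mem_closedBall_self hρ.le
  rw [← taylorSeries_eval (H.analytic 0 h0)]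
  have h1 : (fun t => MvPolynomial.eval ![t, h t] (MvPolynomial.pderiv 1 (toPoly f))) =ᶠ[𝓝 0]
      (fun t => t ^ m) * e := by
    filter_upwards [Metric.closedBall_mem_nhds (0 : ℂ) hρ] with z hz
    exact H.eval_pderiv z hz
  rw [taylorSeries_congr h1, taylorSeries_mul (by fun_prop) (H.analytic_unit 0 h0)]
  congr 1
  have h2 : (fun t : ℂ => t ^ m) = ((⟨fun t => t, analyticAt_id⟩ : analyticAtZero) ^ m).1 := rfl
  rw [h2]
  change taylorHom (_ ^ m) = _
  rw [map_pow]
  congr 1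
  exact taylorSeries_id

theorem IsBranchOver.isUnit_taylorSeries (H : IsBranchOver f h e m ρ) (hρ : 0 < ρ) :
    IsUnit (taylorSeries e) := by
  rw [PowerSeries.isUnit_iff_constantCoeff, ← PowerSeries.coeff_zero_eq_constantCoeff_apply,
    coeff_taylorSeries, taylorCoeff, iteratedDeriv_zero]
  simpa using H.unit_ne_zero 0 (Metric.mem_closedBall_self hρ.le)

variable {H : IsBranchOver f h e m ρ} {γ : (HighIdx M m → ℂ) → PolySpace M}
  {w : (HighIdx M m → ℂ) → DiscAlgebra ρ}

/-- The coefficients of the member of the chart with given high coefficients. -/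
def IsBranchChart.polyCoeff (C : IsBranchChart H γ w) (p : PolyIdx M) : analyticFunctionsAt f :=
  ⟨fun g => γ (high m g) p, by
    have h1 : AnalyticAt ℂ (fun g => γ (high m g)) f :=
      AnalyticAt.comp (g := γ) (f := high m) C.analytic ((high m).analyticAt f)
    exact ((ContinuousLinearMap.proj (R := ℂ) (φ := fun _ : PolyIdx M => ℂ) p).analyticAt _).comp
      h1⟩

/-- The Taylor coefficients of the branch of the member of the chart with given high
coefficients. -/
def IsBranchChart.branchCoeff (C : IsBranchChart H γ w) (hρ : 0 < ρ) (k : ℕ) :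
    analyticFunctionsAt f :=
  ⟨fun g => taylorCoeff k (discExt (w (high m g)).1), by
    have h1 : AnalyticAt ℂ (fun g => w (high m g)) f :=
      AnalyticAt.comp (g := w) (f := high m) C.analytic_branch ((high m).analyticAt f)
    exact ((discTaylorCoeff hρ k).analyticAt _).comp h1⟩

theorem eventually_high {P : (HighIdx M m → ℂ) → Prop} (hP : ∀ᶠ s in 𝓝 (high m f), P s) :
    ∀ᶠ g in 𝓝 f, P (high m g) :=
  (show Tendsto (high m) (𝓝 f) (𝓝 (high m f)) from continuous_high.continuousAt).eventually hP

theorem IsBranchChart.eventually_substSeries (C : IsBranchChart H γ w) (hρ : 0 < ρ) :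
    ∀ᶠ g in 𝓝 f, substSeries (γ (high m g)) (taylorSeries (discExt (w (high m g)).1)) = 0 := by
  filter_upwards [eventually_high C.eventually_solution] with g hg
  have h0 : (0 : ℂ) ∈ Metric.ball (0 : ℂ) ρ := Metric.mem_ball_self hρ
  rw [← aeval_sum_monomial]
  change MvPolynomial.aeval _ (toPoly _) = 0
  rw [← taylorSeries_eval (analyticOnNhd_discExt _ 0 h0)]
  have h1 : (fun t => MvPolynomial.eval ![t, discExt (w (high m g)).1 t]
      (toPoly (γ (high m g)))) =ᶠ[𝓝 0] fun _ => 0 := by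
    filter_upwards [Metric.closedBall_mem_nhds (0 : ℂ) hρ] with z hz
    rw [← discExt_aeval _ _ hz, hg.2, discExt_apply _ hz]
    rfl
  rw [taylorSeries_congr h1, taylorSeries_const, map_zero]

theorem map_evalFn_branchCoeff (C : IsBranchChart H γ w) (hρ : 0 < ρ) (g : PolySpace M) :
    PowerSeries.map (evalFn f g : analyticFunctionsAt f →+* ℂ)
      (PowerSeries.mk (C.branchCoeff hρ)) = taylorSeries (discExt (w (high m g)).1) := by
  ext k
  rw [PowerSeries.coeff_map, PowerSeries.coeff_mk, coeff_taylorSeries]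
  rfl

variable {A : Type*} [CommRing A] [Algebra ℂ A]

/-- The tautological solution over a ring in which the germs vanishing on the locus are zero. -/
theorem IsBranchChart.substSeries_map_eq_zero (C : IsBranchChart H γ w) (hρ : 0 < ρ)
    (c : PolyIdx M → analyticFunctionsAt f) (φ : analyticFunctionsAt f →ₐ[ℂ] A)
    {S : Set (PolySpace M)} (hφ : ∀ G : analyticFunctionsAt f, (∀ᶠ g in 𝓝[S] f, G.1 g = 0) → φ G = 0)
    (hc : ∀ᶠ g in 𝓝[S] f, ∀ p, (c p).1 g = γ (high m g) p) :
    substSeries (fun p => φ (c p))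
      (PowerSeries.map (φ : analyticFunctionsAt f →+* A) (PowerSeries.mk (C.branchCoeff hρ))) = 0 := by
  have h1 := map_substSeries (φ : analyticFunctionsAt f →+* A) c
    (PowerSeries.mk (C.branchCoeff hρ))
  change _ = substSeries (fun p => φ (c p)) _ at h1
  rw [← h1]
  ext k
  rw [PowerSeries.coeff_map, map_zero]
  refine hφ _ ?_
  filter_upwards [hc, nhdsWithin_le_nhds (C.eventually_substSeries hρ)] with g hg hg'
  change (evalFn f g : analyticFunctionsAt f →+* ℂ) _ = 0
  rw [← PowerSeries.coeff_map, map_substSeries, map_evalFn_branchCoeff]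
  have h2 : (fun p => (evalFn f g : analyticFunctionsAt f →+* ℂ) (c p)) = γ (high m g) :=
    funext hg
  rw [h2, hg', map_zero]

/-- Pullback of functions along the projection of the coefficient space to the locus. -/
def IsBranchChart.pullback (C : IsBranchChart H γ w) :
    analyticFunctionsAt f →ₐ[ℂ] analyticFunctionsAt f where
  toFun G := ⟨fun g => G.1 (γ (high m g)), by
    have h1 : AnalyticAt ℂ (fun g => γ (high m g)) f :=
      AnalyticAt.comp (g := γ) (f := high m) C.analytic ((high m).analyticAt f)
    refine AnalyticAt.comp (g := G.1) (f := fun g => γ (high m g)) ?_ h1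
    rw [C.map_base]
    exact G.2⟩
  map_one' := rfl
  map_mul' _ _ := rfl
  map_zero' := rfl
  map_add' _ _ := rfl
  commutes' _ := rfl

theorem IsBranchChart.tendsto (C : IsBranchChart H γ w) :
    Tendsto (fun g => γ (high m g)) (𝓝 f) (𝓝 f) := by
  have h1 := C.analytic.continuousAt.tendsto
  rw [C.map_base] at h1
  exact h1.comp continuous_high.continuousAt

variable [IsLocalRing A] [Module.Finite ℂ A]

/-- The points of the formal neighborhood of `f` in the locus are the deformations of `f` over the
test ring that have a power series solution deforming `h`. -/
theorem IsBranchChart.formalNbhd_eq (C : IsBranchChart H γ w) (hρ : 0 < ρ) (hm : m ≤ M)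
    {R : Set (PolySpace M)} (hR : ∀ᶠ g in 𝓝 f, g ∈ R ↔ γ (high m g) = g) :
    formalNbhd R f A = {F : MvPolynomial (Fin 2) A | F.totalDegree ≤ M ∧
      (∀ s, F.coeff s - algebraMap ℂ A ((toPoly f).coeff s) ∈ IsLocalRing.maximalIdeal A) ∧
      ∃ H : PowerSeries A,
        (∀ k, PowerSeries.coeff k H - algebraMap ℂ A (taylorCoeff k h) ∈
          IsLocalRing.maximalIdeal A) ∧
        MvPolynomial.aeval ![(PowerSeries.X : PowerSeries A), H] F = 0} := by
  have hbase : ∀ k, (C.branchCoeff hρ k).1 f = taylorCoeff k h := by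
    intro k
    change taylorCoeff k (discExt (w (high m f)).1) = _
    rw [C.branch_base]
    refine taylorCoeff_congr ?_ k
    filter_upwards [Metric.closedBall_mem_nhds (0 : ℂ) hρ] with z hz
    exact H.discExt_fn hz
  ext F
  constructor
  · rintro ⟨hF, φ, hφ⟩
    set Φ : analyticFunctionsAt f →ₐ[ℂ] A := φ.comp (Ideal.Quotient.mkₐ ℂ (vanishingIdeal R f))
      with hΦ
    have hΦR : ∀ G : analyticFunctionsAt f, (∀ᶠ g in 𝓝[R] f, G.1 g = 0) → Φ G = 0 := by
      intro G hG
      have : Ideal.Quotient.mkₐ ℂ (vanishingIdeal R f) G = 0 :=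
        Ideal.Quotient.eq_zero_iff_mem.2 hG
      rw [hΦ, AlgHom.comp_apply, this, map_zero]
    have hΦg : KillsGerms Φ := fun G hG => hΦR G (nhdsWithin_le_nhds hG)
    have hΦc : ∀ p, Φ (coordFn f p) = F.coeff p.exponent := hφ
    refine ⟨hF, fun s => ?_, PowerSeries.map (Φ : analyticFunctionsAt f →+* A)
      (PowerSeries.mk (C.branchCoeff hρ)), fun k => ?_, ?_⟩
    · by_cases hs : s 0 + s 1 ≤ M
      · obtain ⟨p, rfl⟩ := exists_exponent_eq hs
        rw [coeff_toPoly, ← hΦc]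
        exact hΦg.sub_mem (coordFn f p)
      · push Not at hs
        rw [coeff_eq_zero_of_lt hF hs, coeff_eq_zero_of_lt (totalDegree_toPoly_le f) hs]
        simp
    · rw [PowerSeries.coeff_map, PowerSeries.coeff_mk, ← hbase]
      exact hΦg.sub_mem _
    · rw [← sum_monomial_coeff hF, aeval_sum_monomial, ← funext hΦc]
      refine C.substSeries_map_eq_zero hρ (coordFn f) Φ hΦR ?_
      filter_upwards [nhdsWithin_le_nhds hR, self_mem_nhdsWithin] with g hg hgR p
      rw [hg.1 hgR]
      rfl
  · rintro ⟨hF, hFf, G, hG, hFG⟩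
    refine ⟨hF, ?_⟩
    have hFf' : ∀ p : PolyIdx M, F.coeff p.exponent - algebraMap ℂ A (f p) ∈
        IsLocalRing.maximalIdeal A := fun p => by
      have := hFf p.exponent
      rwa [coeff_toPoly] at this
    obtain ⟨Φ, hΦg, hΦc⟩ := exists_killsGerms (p := f) hFf'
    obtain ⟨N, hN⟩ := exists_maximalIdeal_pow_eq_bot (A := A)
    -- the projection of the point to the locus is the point itself
    have hproj : (fun p : PolyIdx M => F.coeff p.exponent) = fun p => Φ (C.polyCoeff p) := by
      refine eq_of_substSeries_eq_zero hm hN (H.isUnit_taylorSeries hρ) (H.taylorSeries_pderiv hρ)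
        (H := G) (H' := PowerSeries.map (Φ : analyticFunctionsAt f →+* A)
          (PowerSeries.mk (C.branchCoeff hρ))) hFf' (fun k => ?_) (fun k => ?_)
        (fun p => ?_) ?_ ?_
      · rw [coeff_taylorSeries]; exact hG k
      · rw [coeff_taylorSeries, PowerSeries.coeff_map, PowerSeries.coeff_mk, ← hbase]
        exact hΦg.sub_mem _
      · rw [← hΦc, ← sub_eq_zero, ← map_sub]
        refine hΦg _ ?_
        filter_upwards [eventually_high C.eventually_solution] with g hg
        have h1 : γ (high m g) p.1 = g p.1 := congrFun hg.1 p
        change g p.1 - γ (high m g) p.1 = 0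
        rw [h1, sub_self]
      · rw [← hFG, ← aeval_sum_monomial, sum_monomial_coeff hF]
      · refine C.substSeries_map_eq_zero hρ C.polyCoeff Φ (S := Set.univ) (fun G hG => hΦg G ?_)
          (Eventually.of_forall fun _ _ => rfl)
        rwa [nhdsWithin_univ] at hG
    have hpull : Φ = Φ.comp C.pullback := by
      refine hΦg.eq_of_coord (fun G hG => hΦg _ (C.tendsto.eventually hG)) fun p => ?_
      rw [hΦc]
      exact congrFun hproj p
    have hvan : ∀ G ∈ vanishingIdeal R f, Φ G = 0 := by
      intro G hG
      rw [hpull, AlgHom.comp_apply]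
      refine hΦg _ ?_
      have hG' : ∀ᶠ g in 𝓝 f, g ∈ R → G.1 g = 0 := eventually_nhdsWithin_iff.1 hG
      filter_upwards [C.tendsto.eventually hG', C.tendsto.eventually hR,
        eventually_high C.eventually_solution] with g hg hgR hgs
      exact hg (hgR.2 (by rw [hgs.1]))
    exact ⟨Ideal.Quotient.liftₐ (vanishingIdeal R f) Φ hvan, fun p => hΦc p⟩

end FormalNeighborhood

/-! ### Weierstrass polynomials of nearby branches -/

section Weierstrass

/-- The monic polynomial `X ^ m + ∑ c_i X ^ i`. -/
def monicPoly {S : Type*} [CommRing S] {m : ℕ} (c : Fin m → S) : Polynomial S :=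
  Polynomial.X ^ m + ∑ i : Fin m, Polynomial.C (c i) * Polynomial.X ^ (i : ℕ)

/-- The polynomial `∑ r_i X ^ i` of degree less than `m`. -/
def lowerPoly {S : Type*} [CommRing S] {m : ℕ} (r : Fin m → S) : Polynomial S :=
  ∑ i : Fin m, Polynomial.C (r i) * Polynomial.X ^ (i : ℕ)

theorem degree_lowerPoly_lt {S : Type*} [CommRing S] {m : ℕ} (r : Fin m → S) :
    (lowerPoly r).degree < m := by
  refine lt_of_le_of_lt (Polynomial.degree_sum_le _ _) ?_
  rw [Finset.sup_lt_iff (WithBot.bot_lt_coe _)]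
  intro i _
  exact lt_of_le_of_lt (Polynomial.degree_C_mul_X_pow_le _ _) (by exact_mod_cast i.2)

theorem monicPoly_eq {S : Type*} [CommRing S] {m : ℕ} (c : Fin m → S) :
    monicPoly c = Polynomial.X ^ m + lowerPoly c := rfl

theorem monicPoly_monic {S : Type*} [CommRing S] {m : ℕ} (c : Fin m → S) : (monicPoly c).Monic :=
  Polynomial.monic_X_pow_add (degree_lowerPoly_lt c)

theorem natDegree_monicPoly {S : Type*} [CommRing S] [Nontrivial S] {m : ℕ} (c : Fin m → S) :
    (monicPoly c).natDegree = m := by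
  rw [monicPoly_eq, Polynomial.natDegree_add_eq_left_of_degree_lt, Polynomial.natDegree_X_pow]
  rw [Polynomial.degree_X_pow]
  exact degree_lowerPoly_lt c

variable {B : Type*} [NormedCommRing B] [NormedAlgebra ℂ B]

theorem aeval_lowerPoly (T : B) {m : ℕ} (r : Fin m → ℂ) :
    Polynomial.aeval T (lowerPoly r) = ∑ i : Fin m, r i • T ^ (i : ℕ) := by
  simp [lowerPoly, Algebra.smul_def]

theorem aeval_monicPoly (T : B) {m : ℕ} (c : Fin m → ℂ) :
    Polynomial.aeval T (monicPoly c) = T ^ m + ∑ i : Fin m, c i • T ^ (i : ℕ) := by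
  rw [monicPoly_eq, map_add, map_pow, Polynomial.aeval_X, aeval_lowerPoly]

theorem continuous_aeval_monicPoly (T : B) (m : ℕ) :
    Continuous fun c : Fin m → ℂ => Polynomial.aeval T (monicPoly c) := by
  simp only [aeval_monicPoly]
  fun_prop

/-- Weierstrass preparation: elements near `T ^ m e` with `e` a unit are divisible by monic
polynomials of degree `m` in `T` with small lower coefficients. -/
theorem eventually_exists_monicPoly_dvd [CompleteSpace B] {T : B} (hT : IsCoordinate T) (m : ℕ)
    {e : B} (he : IsUnit e) {p : (Fin m → ℂ) → Prop} (hp : ∀ᶠ c in 𝓝 0, p c) :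
    ∀ᶠ q in 𝓝 (T ^ m * e), ∃ c : Fin m → ℂ, p c ∧ Polynomial.aeval T (monicPoly c) ∣ q := by
  let L : (Fin m → ℂ) × B →L[ℂ] B :=
    (divOp T m 0).comp ((ContinuousLinearMap.fst ℂ (Fin m → ℂ) B).prod 0)
  have hL : ∀ x, L x = ∑ i : Fin m, x.1 i • T ^ (i : ℕ) := by
    intro x; simp [L, divOp_apply]
  have h1 : HasStrictFDerivAt (fun x : (Fin m → ℂ) × B => T ^ m + L x) L (0, e) :=
    L.hasStrictFDerivAt.const_add _
  obtain ⟨L', h2, hL'⟩ : ∃ L' : (Fin m → ℂ) × B →L[ℂ] B,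
      HasStrictFDerivAt (fun x : (Fin m → ℂ) × B => (T ^ m + L x) * x.2) L' (0, e) ∧
      ∀ r b, L' (r, b) = (∑ i : Fin m, r i • T ^ (i : ℕ)) * e + T ^ m * b := by
    refine ⟨_, h1.mul (hasStrictFDerivAt_snd (𝕜 := ℂ) (p := ((0 : Fin m → ℂ), e))), fun r b => ?_⟩
    simp [hL]
    ring
  have hsurj : Function.Surjective L' := by
    intro a
    obtain ⟨u, rfl⟩ := he
    obtain ⟨⟨r, b⟩, hrb⟩ := (divOp_pow_bijective hT m).2 ((↑u⁻¹ : B) * a)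
    refine ⟨(r, u * b), ?_⟩
    rw [divOp_apply] at hrb
    have h6 : a = u * ((↑u⁻¹ : B) * a) := by simp
    rw [hL', h6, ← hrb]
    ring
  have h3 := h2.map_nhds_eq_of_surj (LinearMap.range_eq_top.2 hsurj)
  have h4 : (T ^ m + L (0, e)) * e = T ^ m * e := by rw [hL]; simp
  rw [h4] at h3
  rw [← h3, eventually_map]
  have h5 : ∀ᶠ x : (Fin m → ℂ) × B in 𝓝 (0, e), p x.1 :=
    (continuous_fst.tendsto ((0 : Fin m → ℂ), e)).eventually hp
  filter_upwards [h5] with x hx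
  exact ⟨x.1, hx, Dvd.intro _ (by rw [aeval_monicPoly, hL])⟩

/-- Taylor's formula of order two in the second variable. -/
theorem exists_aeval_add_eq {C : Type*} [CommRing C] [Algebra ℂ C] (T a b : C)
    (P : MvPolynomial (Fin 2) ℂ) : ∃ k, MvPolynomial.aeval ![T, a + b] P =
      MvPolynomial.aeval ![T, a] P + MvPolynomial.aeval ![T, a] (MvPolynomial.pderiv 1 P) * b +
        b ^ 2 * k := by
  induction P using MvPolynomial.induction_on with
  | C c => exact ⟨0, by simp⟩
  | add P Q hP hQ =>
    obtain ⟨k, hk⟩ := hP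
    obtain ⟨l, hl⟩ := hQ
    refine ⟨k + l, ?_⟩
    rw [map_add, hk, hl, map_add, map_add, map_add]
    ring
  | mul_X P i hP =>
    obtain ⟨k, hk⟩ := hP
    fin_cases i
    · refine ⟨k * T, ?_⟩
      simp [hk, Derivation.leibniz, MvPolynomial.pderiv_X]
      ring
    · refine ⟨MvPolynomial.aeval ![T, a] (MvPolynomial.pderiv 1 P) + k * a + k * b, ?_⟩
      simp [hk, Derivation.leibniz, MvPolynomial.pderiv_X]
      ring

theorem aeval_aeval_X {C : Type*} [CommRing C] [Algebra ℂ C] (T : C) (v : Polynomial ℂ)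
    (P : MvPolynomial (Fin 2) ℂ) :
    Polynomial.aeval T (MvPolynomial.aeval ![(Polynomial.X : Polynomial ℂ), v] P) =
      MvPolynomial.aeval ![T, Polynomial.aeval T v] P := by
  rw [MvPolynomial.comp_aeval_apply]
  congr 2
  ext1 i
  fin_cases i <;> simp

/-- A solution `u` of `g(T, u) = 0` is congruent to a polynomial `v` of degree less than `m` modulo
the Weierstrass polynomial `d` of `g_y(T, u)`, and then `g_y(X, v)` is divisible by `d` and
`g(X, v)` by its square. -/
theorem exists_monicPoly_lowerPoly [CompleteSpace B] {T : B} (hT : IsCoordinate T) (m : ℕ)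
    {e : B} (he : IsUnit e) : ∀ᶠ q in 𝓝 (T ^ m * e), ∀ (P : MvPolynomial (Fin 2) ℂ) (u : B),
      MvPolynomial.aeval ![T, u] P = 0 → MvPolynomial.aeval ![T, u] (MvPolynomial.pderiv 1 P) = q →
      ∃ c r : Fin m → ℂ,
        monicPoly c ∣ MvPolynomial.aeval ![Polynomial.X, lowerPoly r] (MvPolynomial.pderiv 1 P) ∧
        monicPoly c ^ 2 ∣ MvPolynomial.aeval ![Polynomial.X, lowerPoly r] P := by
  have hreg : ∀ᶠ c : Fin m → ℂ in 𝓝 0,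
      Function.Bijective (divOp T m (Polynomial.aeval T (monicPoly c))) := by
    have h1 := (continuous_aeval_monicPoly T m).tendsto 0
    have h2 : Polynomial.aeval T (monicPoly (0 : Fin m → ℂ)) = T ^ m := by
      simp [aeval_monicPoly]
    rw [h2] at h1
    exact h1.eventually (eventually_divOp_bijective (divOp_pow_bijective hT m))
  filter_upwards [eventually_exists_monicPoly_dvd hT m he hreg] with q hq P u hP hPq
  obtain ⟨c, hc, hdvd⟩ := hq
  obtain ⟨⟨r, z⟩, hrz⟩ := hc.2 u
  rw [divOp_apply, ← aeval_lowerPoly] at hrz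
  simp only at hrz
  set D := Polynomial.aeval T (monicPoly c) with hD
  set v := Polynomial.aeval T (lowerPoly r) with hv
  have hmon := monicPoly_monic c
  have hdeg := natDegree_monicPoly c
  have h1 : D ∣ MvPolynomial.aeval ![T, v] (MvPolynomial.pderiv 1 P) := by
    obtain ⟨k, hk⟩ := exists_aeval_add_eq T v (D * z) (MvPolynomial.pderiv 1 P)
    rw [hrz, hPq] at hk
    obtain ⟨l, hl⟩ := hdvd
    refine ⟨l - MvPolynomial.aeval ![T, v] (MvPolynomial.pderiv 1 (MvPolynomial.pderiv 1 P)) * z -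
      D * z ^ 2 * k, ?_⟩
    linear_combination -hk + hl
  have h2 : D ^ 2 ∣ MvPolynomial.aeval ![T, v] P := by
    obtain ⟨k, hk⟩ := exists_aeval_add_eq T v (D * z) P
    rw [hrz, hP] at hk
    obtain ⟨l, hl⟩ := h1
    rw [hl] at hk
    exact ⟨-(l * z) - z ^ 2 * k, by linear_combination -hk⟩
  refine ⟨c, r, dvd_of_aeval_dvd hmon hdeg hc.1 ?_, ?_⟩
  · rw [aeval_aeval_X]
    exact h1
  · refine dvd_of_aeval_dvd (n := 2 * m) (hmon.pow 2) (by rw [hmon.natDegree_pow, hdeg])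
      (divOp_sq_injective hmon hdeg hc.1) ?_
    rw [aeval_aeval_X, map_pow]
    exact h2

variable {M m : ℕ} {f : PolySpace M} {h e : ℂ → ℂ} {ρ : ℝ}
  {H : IsBranchOver f h e m ρ} {γ : (HighIdx M m → ℂ) → PolySpace M}
  {w : (HighIdx M m → ℂ) → DiscAlgebra ρ}

theorem IsBranchChart.eventually_exists_monicPoly (C : IsBranchChart H γ w) (hρ : 0 < ρ) :
    ∀ᶠ s in 𝓝 (high m f), ∃ c r : Fin m → ℂ,
      monicPoly c ∣ MvPolynomial.aeval ![Polynomial.X, lowerPoly r]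
        (MvPolynomial.pderiv 1 (toPoly (γ s))) ∧
      monicPoly c ^ 2 ∣ MvPolynomial.aeval ![Polynomial.X, lowerPoly r] (toPoly (γ s)) := by
  have h1 := exists_monicPoly_lowerPoly (isCoordinate_discCoord hρ) m H.isUnit_unit
  rw [← H.aeval_pderiv] at h1
  have hcont : Continuous fun x : PolySpace M × DiscAlgebra ρ =>
      MvPolynomial.aeval ![discCoord ρ, x.2] (MvPolynomial.pderiv 1 (toPoly x.1)) := by
    simp only [aeval_pderiv_toPoly]
    fun_prop
  have h2 : Tendsto (fun s => (γ s, w s)) (𝓝 (high m f)) (𝓝 (f, H.fn)) := by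
    have ha := C.analytic.continuousAt.tendsto
    have hb := C.analytic_branch.continuousAt.tendsto
    rw [C.map_base] at ha
    rw [C.branch_base] at hb
    exact ha.prodMk_nhds hb
  filter_upwards [((hcont.tendsto (f, H.fn)).comp h2).eventually h1, C.eventually_solution]
    with s hs hs'
  exact hs (toPoly (γ s)) (w s) hs'.2 rfl

end Weierstrass

/-! ### A polynomial family containing the branch locus -/

section Family

variable {M m : ℕ} {S S' : Type*} [CommRing S] [CommRing S']

/-- The polynomial `g(X, v)`. -/
def substPoly (c : PolyIdx M → S) (v : Polynomial S) : Polynomial S :=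
  ∑ p : PolyIdx M, Polynomial.C (c p) * (Polynomial.X ^ (p.1.1 : ℕ) * v ^ (p.1.2 : ℕ))

/-- The polynomial `g_y(X, v)`. -/
def substPolyDeriv (c : PolyIdx M → S) (v : Polynomial S) : Polynomial S :=
  ∑ p : PolyIdx M, Polynomial.C (c p) *
    (Polynomial.X ^ (p.1.1 : ℕ) * ((p.1.2 : ℕ) • v ^ ((p.1.2 : ℕ) - 1)))

theorem map_substPoly (φ : S →+* S') (c : PolyIdx M → S) (v : Polynomial S) :
    (substPoly c v).map φ = substPoly (fun p => φ (c p)) (v.map φ) := by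
  simp [substPoly, Polynomial.map_sum]

theorem map_substPolyDeriv (φ : S →+* S') (c : PolyIdx M → S) (v : Polynomial S) :
    (substPolyDeriv c v).map φ = substPolyDeriv (fun p => φ (c p)) (v.map φ) := by
  simp [substPolyDeriv, Polynomial.map_sum]

theorem aeval_X_toPoly (g : PolySpace M) (v : Polynomial ℂ) :
    MvPolynomial.aeval ![Polynomial.X, v] (toPoly g) = substPoly g v := by
  simp only [aeval_toPoly, substPoly, Polynomial.smul_eq_C_mul]

theorem aeval_X_pderiv_toPoly (g : PolySpace M) (v : Polynomial ℂ) :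
    MvPolynomial.aeval ![Polynomial.X, v] (MvPolynomial.pderiv 1 (toPoly g)) =
      substPolyDeriv g v := by
  simp only [aeval_pderiv_toPoly, substPolyDeriv, Polynomial.smul_eq_C_mul]

theorem map_lowerPoly (φ : S →+* S') (r : Fin m → S) :
    (lowerPoly r).map φ = lowerPoly fun i => φ (r i) := by
  simp [lowerPoly, Polynomial.map_sum]

theorem map_monicPoly (φ : S →+* S') (c : Fin m → S) :
    (monicPoly c).map φ = monicPoly fun i => φ (c i) := by
  simp [monicPoly, Polynomial.map_sum]

theorem coeff_lowerPoly (r : Fin m → S) (i : Fin m) : (lowerPoly r).coeff i = r i := by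
  rw [lowerPoly, Polynomial.finsetSum_coeff, Finset.sum_eq_single i]
  · simp
  · intro j _ hj
    rw [Polynomial.coeff_C_mul, Polynomial.coeff_X_pow, if_neg, mul_zero]
    exact fun h => hj (Fin.ext h.symm)
  · simp

/-- The monomial is `x ^ i y` with `i < m`. -/
abbrev IsLin (m : ℕ) (p : PolyIdx M) : Prop := (p.1.2 : ℕ) = 1 ∧ (p.1.1 : ℕ) < m

/-- The index of `x ^ i y`. -/
def linIdx (hM : 2 * m ≤ M) (i : Fin m) : PolyIdx M :=
  ⟨(⟨i, by omega⟩, ⟨1, by have := i.2; omega⟩), by change (i : ℕ) + 1 ≤ M; omega⟩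

theorem linIdx_injective (hM : 2 * m ≤ M) : Function.Injective (linIdx (M := M) hM) := by
  intro i j hij
  exact Fin.ext (congrArg (fun p : PolyIdx M => (p.1.1 : ℕ)) hij)

theorem isLin_linIdx (hM : 2 * m ≤ M) (i : Fin m) : IsLin m (linIdx hM i) := ⟨rfl, i.2⟩

theorem IsLin.eq_linIdx (hM : 2 * m ≤ M) {p : PolyIdx M} (hp : IsLin m p) :
    p = linIdx hM ⟨p.1.1, hp.2⟩ :=
  Subtype.ext (Prod.ext rfl (Fin.ext hp.1))

/-- The parameter that serves as the coefficient of `X ^ i` in the Weierstrass polynomial: it takes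
the place of the coefficient of `x ^ (m + i)`. -/
def monicIdx (hM : 2 * m ≤ M) (i : Fin m) : HighIdx M m :=
  ⟨⟨(⟨m + i, by omega⟩, 0), by simp; omega⟩, by simp [IsLow]⟩

/-- The parameter that serves as the coefficient of `X ^ i` in the truncated branch: it takes the
place of the coefficient of `x ^ i y`. -/
def branchIdx (hM : 2 * m ≤ M) (i : Fin m) : HighIdx M m :=
  ⟨linIdx hM i, by simp [IsLow, linIdx]⟩

/-- The coefficients that are parameters themselves, at the monomials other than `x ^ i` with
`i < 2 m` and `x ^ i y` with `i < m`. -/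
def familyFree (m : ℕ) (θ : HighIdx M m → S) (p : PolyIdx M) : S :=
  if hp : IsLow (2 * m) p ∨ IsLin m p then 0 else
    θ ⟨p, fun h => hp (Or.inl ⟨h.1, by have := h.2; omega⟩)⟩

/-- The Weierstrass polynomial of a member of the family. -/
def familyMonic (hM : 2 * m ≤ M) (θ : HighIdx M m → S) : Polynomial S :=
  monicPoly fun i => θ (monicIdx hM i)

theorem monic_familyMonic (hM : 2 * m ≤ M) (θ : HighIdx M m → S) : (familyMonic hM θ).Monic :=
  monicPoly_monic _

/-- The truncated branch of a member of the family. -/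
def familyBranch (hM : 2 * m ≤ M) (θ : HighIdx M m → S) : Polynomial S :=
  lowerPoly fun i => θ (branchIdx hM i)

/-- The coefficients at the monomials other than `x ^ i` with `i < 2 m`, those at `x ^ i y` with
`i < m` being determined by divisibility of `g_y(X, v)` by the Weierstrass polynomial. -/
def familyLin (hM : 2 * m ≤ M) (θ : HighIdx M m → S) (p : PolyIdx M) : S :=
  if IsLin m p then (-(substPolyDeriv (familyFree m θ) (familyBranch hM θ) %ₘ
    familyMonic hM θ)).coeff p.1.1 else familyFree m θ p

/-- The polynomials `g` such that `d ∣ g_y(X, v)` and `d ^ 2 ∣ g(X, v)` for some monic `d` of degree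
`m` and some `v` of degree less than `m`, as a family depending polynomially on parameters that
are as many as the monomials other than `x ^ i` with `i < m`. -/
def family (hM : 2 * m ≤ M) (θ : HighIdx M m → S) (p : PolyIdx M) : S :=
  if IsLow (2 * m) p then (-(substPoly (familyLin hM θ) (familyBranch hM θ) %ₘ
    familyMonic hM θ ^ 2)).coeff p.1.1 else familyLin hM θ p

theorem map_family (hM : 2 * m ≤ M) (φ : S →+* S') (θ : HighIdx M m → S) (p : PolyIdx M) :
    φ (family hM θ p) = family hM (fun q => φ (θ q)) p := by
  have h1 : (familyMonic hM θ).map φ = familyMonic hM fun q => φ (θ q) := map_monicPoly _ _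
  have h2 : (familyBranch hM θ).map φ = familyBranch hM fun q => φ (θ q) := map_lowerPoly _ _
  have h3 : ∀ p, φ (familyFree m θ p) = familyFree m (fun q => φ (θ q)) p := by
    intro p
    unfold familyFree
    split_ifs <;> simp
  have h4 : ∀ p, φ (familyLin hM θ p) = familyLin hM (fun q => φ (θ q)) p := by
    intro p
    unfold familyLin
    split_ifs
    · rw [← Polynomial.coeff_map, Polynomial.map_neg, Polynomial.map_modByMonic _
        (monic_familyMonic hM θ), map_substPolyDeriv, h1, h2]
      simp only [h3]
    · exact h3 p
  unfold family
  split_ifs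
  · rw [← Polynomial.coeff_map, Polynomial.map_neg, Polynomial.map_modByMonic _
      ((monic_familyMonic hM θ).pow 2), map_substPoly, Polynomial.map_pow, h1, h2]
    simp only [h4]
  · exact h4 p

theorem sum_eq_sum_add_of_injective {n : ℕ} {idx : Fin n → PolyIdx M}
    (hidx : Function.Injective idx) {c c' : PolyIdx M → S} (t : PolyIdx M → Polynomial S)
    (h : ∀ p, (∀ i, idx i ≠ p) → c p = c' p) (h' : ∀ i, c' (idx i) = 0) :
    ∑ p, Polynomial.C (c p) * t p = ∑ p, Polynomial.C (c' p) * t p +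
      ∑ i, Polynomial.C (c (idx i)) * t (idx i) := by
  rw [← sub_eq_iff_eq_add', ← Finset.sum_sub_distrib]
  rw [← Finset.sum_subset (Finset.subset_univ (Finset.univ.map ⟨idx, hidx⟩))]
  · rw [Finset.sum_map]
    refine Finset.sum_congr rfl fun i _ => ?_
    rw [Function.Embedding.coeFn_mk, h', map_zero, zero_mul, sub_zero]
  · intro p _ hp
    rw [h p, sub_self]
    intro i hi
    apply hp
    rw [Finset.mem_map]
    exact ⟨i, Finset.mem_univ _, hi⟩

theorem eq_coeff_of_dvd_add_lowerPoly [Nontrivial S] {d Q : Polynomial S} {n : ℕ} (hd : d.Monic)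
    (hn : d.natDegree = n) {r : Fin n → S} (h : d ∣ Q + lowerPoly r) (i : Fin n) :
    r i = (-(Q %ₘ d)).coeff i := by
  have h1 : lowerPoly r %ₘ d = lowerPoly r := by
    rw [Polynomial.modByMonic_eq_self_iff hd, Polynomial.degree_eq_natDegree hd.ne_zero, hn]
    exact degree_lowerPoly_lt r
  rw [← Polynomial.modByMonic_eq_zero_iff_dvd hd, Polynomial.add_modByMonic, h1,
    ← eq_neg_iff_add_eq_zero] at h
  have h2 : lowerPoly r = -(Q %ₘ d) := by rw [h, neg_neg]
  rw [← h2, coeff_lowerPoly]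

/-- Polynomials with the two divisibility properties belong to the family. -/
theorem exists_family_eq [Nontrivial S] (hM : 2 * m ≤ M) {g : PolyIdx M → S} {c r : Fin m → S}
    (h1 : monicPoly c ∣ substPolyDeriv g (lowerPoly r))
    (h2 : monicPoly c ^ 2 ∣ substPoly g (lowerPoly r)) :
    ∃ θ : HighIdx M m → S, family hM θ = g := by
  have hm : m ≤ M := by omega
  set θ : HighIdx M m → S := fun q =>
    if hq : IsLow (2 * m) q.1 then c ⟨(q.1.1.1 : ℕ) - m, by
      have h1 := q.2
      have h2 := hq
      simp only [IsLow] at h1 h2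
      omega⟩ else
    if hq' : IsLin m q.1 then r ⟨q.1.1.1, hq'.2⟩ else g q.1 with hθ
  have hc : familyMonic hM θ = monicPoly c := by
    unfold familyMonic
    congr 1
    funext i
    have : IsLow (2 * m) (monicIdx hM i).1 := ⟨rfl, by simp [monicIdx]; omega⟩
    rw [hθ]
    simp only
    rw [dif_pos this]
    congr 1
    exact Fin.ext (by simp [monicIdx])
  have hr : familyBranch hM θ = lowerPoly r := by
    unfold familyBranch
    congr 1
    funext i
    have h3 : ¬ IsLow (2 * m) (branchIdx hM i).1 := by simp [IsLow, branchIdx, linIdx]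
    have h4 : IsLin m (branchIdx hM i).1 := isLin_linIdx hM i
    rw [hθ]
    simp only
    rw [dif_neg h3, dif_pos h4]
    rfl
  have hfree : ∀ p, ¬ IsLow (2 * m) p → ¬ IsLin m p → familyFree m θ p = g p := by
    intro p hp hp'
    rw [familyFree, dif_neg (not_or.2 ⟨hp, hp'⟩), hθ]
    simp only
    rw [dif_neg hp, dif_neg hp']
  have hzero : ∀ p, IsLow (2 * m) p ∨ IsLin m p → familyFree m θ p = 0 := by
    intro p hp
    rw [familyFree, dif_pos hp]
  -- the constant terms in `y` do not matter for the derivative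
  have hsum1 : substPolyDeriv g (lowerPoly r) =
      substPolyDeriv (familyFree m θ) (lowerPoly r) + lowerPoly fun i => g (linIdx hM i) := by
    set g' : PolyIdx M → S := fun p => if IsLow (2 * m) p then 0 else g p with hg'
    have e1 : substPolyDeriv g (lowerPoly r) = substPolyDeriv g' (lowerPoly r) := by
      refine Finset.sum_congr rfl fun p _ => ?_
      by_cases hp : IsLow (2 * m) p
      · rw [hp.1, zero_smul, mul_zero, mul_zero, mul_zero]
      · simp only [hg']
        rw [if_neg hp]
    rw [e1, substPolyDeriv, sum_eq_sum_add_of_injective (linIdx_injective hM)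
      (c' := familyFree m θ)]
    · congr 1
      refine Finset.sum_congr rfl fun i _ => ?_
      have : ¬ IsLow (2 * m) (linIdx hM i) := by simp [IsLow, linIdx]
      simp only [hg']
      rw [if_neg this]
      simp [linIdx]
    · intro p hp
      have hnl : ¬ IsLin m p := fun hl => hp _ (hl.eq_linIdx hM).symm
      simp only [hg']
      split_ifs with hlow
      · rw [hzero p (Or.inl hlow)]
      · rw [hfree p hlow hnl]
    · intro i
      exact hzero _ (Or.inr (isLin_linIdx hM i))
  rw [hsum1] at h1
  have hlin : ∀ p, ¬ IsLow (2 * m) p → familyLin hM θ p = g p := by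
    intro p hp
    unfold familyLin
    split_ifs with hp'
    · have := eq_coeff_of_dvd_add_lowerPoly (monicPoly_monic c) (natDegree_monicPoly c) h1
        ⟨p.1.1, hp'.2⟩
      rw [hc, hr, ← this, ← hp'.eq_linIdx hM]
    · exact hfree p hp hp'
  have hlin0 : ∀ p, IsLow (2 * m) p → familyLin hM θ p = 0 := by
    intro p hp
    have : ¬ IsLin m p := fun h => by
      have h3 := h.1
      rw [hp.1] at h3
      omega
    rw [familyLin, if_neg this, hzero p (Or.inl hp)]
  have hsum2 : substPoly g (lowerPoly r) =
      substPoly (familyLin hM θ) (lowerPoly r) + lowerPoly fun i => g (lowIdx hM i) := by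
    rw [substPoly, sum_eq_sum_add_of_injective (lowIdx_injective hM) (c' := familyLin hM θ)]
    · congr 1
      refine Finset.sum_congr rfl fun i _ => ?_
      simp [lowIdx]
    · intro p hp
      exact (hlin p fun hl => hp _ (hl.eq_lowIdx hM).symm).symm
    · intro i
      exact hlin0 _ (lowIdx_isLow hM i)
  rw [hsum2] at h2
  refine ⟨θ, funext fun p => ?_⟩
  unfold family
  split_ifs with hp
  · have := eq_coeff_of_dvd_add_lowerPoly ((monicPoly_monic c).pow 2)
      (by rw [(monicPoly_monic c).natDegree_pow, natDegree_monicPoly]) h2 ⟨p.1.1, hp.2⟩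
    rw [hc, hr, ← this, ← hp.eq_lowIdx hM]
  · exact hlin p hp

/-- Any coefficient of the members of the family is algebraic over those at the monomials other
than `x ^ i` with `i < m`, because these are as many as the parameters. -/
theorem exists_relation (hM : 2 * m ≤ M) (j : PolyIdx M) :
    ∃ P : Polynomial (MvPolynomial (HighIdx M m) ℂ), P ≠ 0 ∧ ∀ θ : HighIdx M m → ℂ,
      P.eval₂ (MvPolynomial.eval (high m (family hM θ))) (family hM θ j) = 0 := by
  set x : Option (HighIdx M m) → MvPolynomial (HighIdx M m) ℂ := fun o =>
    o.elim (family hM MvPolynomial.X j) fun q => family hM MvPolynomial.X q.1 with hx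
  have hdep : ¬ AlgebraicIndependent ℂ x := by
    intro hind
    have h1 := hind.cardinalMk_le_trdeg
    rw [MvPolynomial.trdeg_of_isDomain, Cardinal.lift_id, Cardinal.mk_fintype, Cardinal.mk_fintype,
      Nat.cast_le, Fintype.card_option] at h1
    omega
  rw [algebraicIndependent_iff] at hdep
  push Not at hdep
  obtain ⟨Q, hQ, hQ0⟩ := hdep
  refine ⟨MvPolynomial.optionEquivLeft ℂ _ Q, (map_ne_zero_iff _ (AlgEquiv.injective _)).2 hQ0,
    fun θ => ?_⟩
  have h1 : ∀ Q : MvPolynomial (Option (HighIdx M m)) ℂ,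
      (MvPolynomial.optionEquivLeft ℂ _ Q).eval₂ (MvPolynomial.eval (high m (family hM θ)))
        (family hM θ j) = MvPolynomial.eval θ (MvPolynomial.aeval x Q) := by
    intro Q
    induction Q using MvPolynomial.induction_on with
    | C a => simp
    | add P Q hP hQ => simp only [map_add, Polynomial.eval₂_add, hP, hQ]
    | mul_X P o hP =>
      simp only [map_mul, Polynomial.eval₂_mul, hP, MvPolynomial.aeval_X]
      congr 1
      have h2 : ∀ p, MvPolynomial.eval θ (family hM MvPolynomial.X p) = family hM θ p := by
        intro p
        rw [map_family]
        simp
      rcases o with _ | q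
      · simp [hx, h2]
      · simp [hx, h2]
  rw [h1, hQ, map_zero]

end Family

/-! ### Zero divisors among analytic germs -/

section AnalyticGerms

variable {E : Type*} [NormedAddCommGroup E] [NormedSpace ℂ E] {x : E}

theorem eventually_eq_zero_or_of_mul {F G : E → ℂ} (hF : AnalyticAt ℂ F x) (hG : AnalyticAt ℂ G x)
    (h : ∀ᶠ y in 𝓝 x, F y * G y = 0) : (∀ᶠ y in 𝓝 x, F y = 0) ∨ ∀ᶠ y in 𝓝 x, G y = 0 := by
  obtain ⟨r, hr, hball⟩ := Metric.eventually_nhds_iff_ball.1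
    ((hF.eventually_analyticAt.and hG.eventually_analyticAt).and h)
  by_cases h0 : ∀ y ∈ Metric.ball x r, F y = 0
  · exact Or.inl (eventually_of_mem (Metric.ball_mem_nhds x hr) h0)
  · push Not at h0
    obtain ⟨y, hy, hFy⟩ := h0
    right
    have hGan : AnalyticOnNhd ℂ G (Metric.ball x r) := fun z hz => (hball z hz).1.2
    have h1 : G =ᶠ[𝓝 y] 0 := by
      filter_upwards [(hball y hy).1.1.continuousAt.eventually_ne hFy,
        Metric.isOpen_ball.mem_nhds hy] with z hz hz'
      exact (mul_eq_zero.1 (hball z hz').2).resolve_left hz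
    exact eventually_of_mem (Metric.ball_mem_nhds x hr)
      (hGan.eqOn_zero_of_preconnected_of_eventuallyEq_zero (convex_ball x r).isPreconnected hy h1)

theorem exists_eventually_eq_zero_of_prod {κ : Type*} (s : Finset κ) {F : κ → E → ℂ}
    (hF : ∀ i ∈ s, AnalyticAt ℂ (F i) x) (h : ∀ᶠ y in 𝓝 x, ∏ i ∈ s, F i y = 0) :
    ∃ i ∈ s, ∀ᶠ y in 𝓝 x, F i y = 0 := by
  classical
  induction s using Finset.induction_on with
  | empty =>
    obtain ⟨y, hy⟩ := h.exists
    simp at hy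
  | insert a s ha ih =>
    simp only [Finset.prod_insert ha] at h
    have hs : AnalyticAt ℂ (fun y => ∏ i ∈ s, F i y) x :=
      Finset.analyticAt_fun_prod s fun i hi => hF i (Finset.mem_insert_of_mem hi)
    rcases eventually_eq_zero_or_of_mul (hF a (Finset.mem_insert_self a s)) hs h with h1 | h1
    · exact ⟨a, Finset.mem_insert_self a s, h1⟩
    · obtain ⟨i, hi, hi'⟩ := ih (fun i hi => hF i (Finset.mem_insert_of_mem hi)) h1
      exact ⟨i, Finset.mem_insert_of_mem hi, hi'⟩

end AnalyticGerms

/-! ### Algebraic equations of the branch locus -/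

section Equations

variable {σ : Type*}

/-- Divided difference of a polynomial `P(s, ·)` in one variable. -/
def dividedDiff (P : Polynomial (MvPolynomial σ ℂ)) (s : σ → ℂ) (y z : ℂ) : ℂ :=
  ∑ n ∈ Finset.range (P.natDegree + 1), MvPolynomial.eval s (P.coeff n) *
    ∑ k ∈ Finset.range n, y ^ k * z ^ (n - 1 - k)

theorem dividedDiff_mul_sub (P : Polynomial (MvPolynomial σ ℂ)) (s : σ → ℂ) (y z : ℂ) :
    dividedDiff P s y z * (y - z) =
      P.eval₂ (MvPolynomial.eval s) y - P.eval₂ (MvPolynomial.eval s) z := by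
  rw [Polynomial.eval₂_eq_sum_range, Polynomial.eval₂_eq_sum_range, dividedDiff, Finset.sum_mul,
    ← Finset.sum_sub_distrib]
  refine Finset.sum_congr rfl fun n _ => ?_
  rw [mul_assoc, geom_sum₂_mul]
  ring

theorem dividedDiff_self (P : Polynomial (MvPolynomial σ ℂ)) (s : σ → ℂ) (z : ℂ) :
    dividedDiff P s z z = P.derivative.eval₂ (MvPolynomial.eval s) z := by
  rw [Polynomial.derivative_apply, Polynomial.sum_over_range _ (by simp),
    Polynomial.eval₂_finsetSum, dividedDiff]
  refine Finset.sum_congr rfl fun n _ => ?_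
  rw [geom_sum₂_self]
  simp [mul_assoc]

theorem analyticAt_eval₂ [Fintype σ] {E : Type*} [NormedAddCommGroup E] [NormedSpace ℂ E] {x : E}
    (P : Polynomial (MvPolynomial σ ℂ)) {s : E → σ → ℂ} {y : E → ℂ}
    (hs : ∀ i, AnalyticAt ℂ (fun t => s t i) x) (hy : AnalyticAt ℂ y x) :
    AnalyticAt ℂ (fun t => P.eval₂ (MvPolynomial.eval (s t)) (y t)) x := by
  simp only [Polynomial.eval₂_eq_sum_range]
  refine Finset.analyticAt_fun_sum _ fun n _ => ?_
  exact (AnalyticAt.aeval_mvPolynomial hs (P.coeff n)).mul (hy.pow n)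

theorem analyticAt_dividedDiff [Fintype σ] {E : Type*} [NormedAddCommGroup E] [NormedSpace ℂ E]
    {x : E} (P : Polynomial (MvPolynomial σ ℂ)) {s : E → σ → ℂ} {y z : E → ℂ}
    (hs : ∀ i, AnalyticAt ℂ (fun t => s t i) x) (hy : AnalyticAt ℂ y x) (hz : AnalyticAt ℂ z x) :
    AnalyticAt ℂ (fun t => dividedDiff P (s t) (y t) (z t)) x := by
  unfold dividedDiff
  refine Finset.analyticAt_fun_sum _ fun n _ => ?_
  refine (AnalyticAt.aeval_mvPolynomial hs (P.coeff n)).mul ?_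
  exact Finset.analyticAt_fun_sum _ fun k _ => (hy.pow k).mul (hz.pow _)

/-- A function germ that is algebraic over the polynomials is a simple root, generically, of some
polynomial: take one of minimal degree. -/
theorem exists_simple_relation [Fintype σ] {s₀ : σ → ℂ} {y : (σ → ℂ) → ℂ}
    {Q : Polynomial (MvPolynomial σ ℂ)} (hQ : Q ≠ 0)
    (hQy : ∀ᶠ s in 𝓝 s₀, Q.eval₂ (MvPolynomial.eval s) (y s) = 0) :
    ∃ P : Polynomial (MvPolynomial σ ℂ), (∀ᶠ s in 𝓝 s₀, P.eval₂ (MvPolynomial.eval s) (y s) = 0) ∧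
      ¬ ∀ᶠ s in 𝓝 s₀, P.derivative.eval₂ (MvPolynomial.eval s) (y s) = 0 := by
  classical
  have hex : ∃ (n : ℕ) (P : Polynomial (MvPolynomial σ ℂ)), P.natDegree = n ∧ P ≠ 0 ∧
      ∀ᶠ s in 𝓝 s₀, P.eval₂ (MvPolynomial.eval s) (y s) = 0 := ⟨_, Q, rfl, hQ, hQy⟩
  obtain ⟨P, hPn, hP0, hP⟩ := Nat.find_spec hex
  refine ⟨P, hP, fun hder => ?_⟩
  have hn : P.natDegree ≠ 0 := by
    intro hn
    rw [Polynomial.natDegree_eq_zero] at hn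
    obtain ⟨a, rfl⟩ := hn
    simp only [Polynomial.eval₂_C] at hP
    have h1 : Set.EqOn (fun s => MvPolynomial.eval s a) 0 Set.univ :=
      (AnalyticOnNhd.eval_mvPolynomial a).eqOn_zero_of_preconnected_of_eventuallyEq_zero
        isPreconnected_univ (Set.mem_univ s₀) hP
    apply hP0
    rw [Polynomial.C_eq_zero]
    exact MvPolynomial.funext fun s => by simpa using h1 (Set.mem_univ s)
  have hder0 : P.derivative ≠ 0 := fun h =>
    hn (Polynomial.derivative_eq_zero.1 h)
  have hlt := Polynomial.natDegree_derivative_lt hn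
  rw [hPn] at hlt
  exact Nat.find_min hex hlt ⟨_, rfl, hder0, hder⟩

variable {M m : ℕ} {f : PolySpace M} {h e : ℂ → ℂ} {ρ : ℝ}
  {H : IsBranchOver f h e m ρ} {γ : (HighIdx M m → ℂ) → PolySpace M}
  {w : (HighIdx M m → ℂ) → DiscAlgebra ρ}

theorem IsBranchChart.exists_simple_relation (C : IsBranchChart H γ w) (hρ : 0 < ρ)
    (hM : 2 * m ≤ M) (j : PolyIdx M) : ∃ P : Polynomial (MvPolynomial (HighIdx M m) ℂ),
      (∀ᶠ s in 𝓝 (high m f), P.eval₂ (MvPolynomial.eval s) (γ s j) = 0) ∧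
      ¬ ∀ᶠ s in 𝓝 (high m f), P.derivative.eval₂ (MvPolynomial.eval s) (γ s j) = 0 := by
  obtain ⟨Q, hQ, hQfam⟩ := exists_relation hM j
  refine PlaneCurves.exists_simple_relation hQ ?_
  filter_upwards [C.eventually_exists_monicPoly hρ, C.eventually_solution] with s hs hs'
  obtain ⟨c, r, h1, h2⟩ := hs
  rw [aeval_X_pderiv_toPoly] at h1
  rw [aeval_X_toPoly] at h2
  obtain ⟨θ, hθ⟩ := exists_family_eq hM h1 h2
  have := hQfam θ
  rwa [hθ, hs'.1] at this

end Equations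

/-! ### The geometry of the branch locus -/

section Geometry

variable {M m : ℕ} {f : PolySpace M} {h e : ℂ → ℂ} {ρ : ℝ}
  {H : IsBranchOver f h e m ρ} {γ : (HighIdx M m → ℂ) → PolySpace M}
  {w : (HighIdx M m → ℂ) → DiscAlgebra ρ} {P R : Set (PolySpace M)}

/-- The equations `g_i = γ_i` of the locus, at the monomials `x ^ i` with `i < m`. -/
def graphEquations (hm : m ≤ M) (γ : (HighIdx M m → ℂ) → PolySpace M) (g : PolySpace M)
    (i : Fin m) : ℂ := g (lowIdx hm i) - γ (high m g) (lowIdx hm i)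

theorem graphEquations_eq_zero_iff (hm : m ≤ M) {g : PolySpace M}
    (hg : high m (γ (high m g)) = high m g) : graphEquations hm γ g = 0 ↔ γ (high m g) = g := by
  constructor
  · intro h0
    refine ext_high_low hm hg fun i => ?_
    have := congrFun h0 i
    rw [graphEquations, Pi.zero_apply, sub_eq_zero] at this
    exact this.symm
  · intro h0
    funext i
    rw [graphEquations, h0, sub_self, Pi.zero_apply]

theorem analyticAt_comp_high {g : PolySpace M} (hγ : AnalyticAt ℂ γ (high m g)) :
    AnalyticAt ℂ (fun g => γ (high m g)) g :=
  AnalyticAt.comp (g := γ) (f := high m) hγ ((high m).analyticAt g)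

theorem analyticAt_coord (j : PolyIdx M) (g : PolySpace M) :
    AnalyticAt ℂ (fun g : PolySpace M => g j) g :=
  (ContinuousLinearMap.proj (R := ℂ) (φ := fun _ : PolyIdx M => ℂ) j).analyticAt g

theorem analyticAt_coord_comp_high (j : PolyIdx M) {g : PolySpace M}
    (hγ : AnalyticAt ℂ γ (high m g)) : AnalyticAt ℂ (fun g => γ (high m g) j) g :=
  (analyticAt_coord j _).comp (analyticAt_comp_high hγ)

theorem analyticAt_graphEquations (hm : m ≤ M) {g : PolySpace M}
    (hγ : AnalyticAt ℂ γ (high m g)) : AnalyticAt ℂ (graphEquations hm γ) g := by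
  rw [analyticAt_pi_iff]
  intro i
  exact (analyticAt_coord _ _).sub (analyticAt_coord_comp_high _ hγ)

theorem surjective_fderiv_graphEquations (hm : m ≤ M) {g : PolySpace M}
    (hγ : AnalyticAt ℂ γ (high m g)) :
    Function.Surjective (fderiv ℂ (graphEquations hm γ) g) := by
  intro c
  refine ⟨glue 0 c, ?_⟩
  have hd : DifferentiableAt ℂ (graphEquations hm γ) g :=
    (analyticAt_graphEquations hm hγ).differentiableAt
  -- along the direction `glue 0 c` the high coefficients are constant
  have h1 : HasDerivAt (fun t : ℂ => graphEquations hm γ (g + t • glue 0 c))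
      (fderiv ℂ (graphEquations hm γ) g (glue 0 c)) 0 := hd.hasFDerivAt.hasLineDerivAt _
  have h2 : (fun t : ℂ => graphEquations hm γ (g + t • glue 0 c)) =
      fun t => graphEquations hm γ g + t • c := by
    funext t i
    simp only [graphEquations, map_add, map_smul, high_glue, smul_zero, add_zero, Pi.add_apply,
      Pi.smul_apply, glue_lowIdx]
    ring
  rw [h2] at h1
  have h3 : HasDerivAt (fun t : ℂ => graphEquations hm γ g + t • c) ((1 : ℂ) • c) 0 :=
    ((hasDerivAt_id (0 : ℂ)).smul_const c).const_add _
  rw [h1.unique h3, one_smul]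

/-- A set is the graph of `γ` over an open set where `γ` is analytic. -/
structure IsGraphOn (γ : (HighIdx M m → ℂ) → PolySpace M) (P R : Set (PolySpace M)) : Prop where
  isOpen : IsOpen P
  analytic : ∀ g ∈ P, AnalyticAt ℂ γ (high m g)
  high_eq : ∀ g ∈ P, high m (γ (high m g)) = high m g
  mem_iff : ∀ g, g ∈ R ↔ g ∈ P ∧ γ (high m g) = g

theorem IsGraphOn.inter_eq (G : IsGraphOn γ P R) (hm : m ≤ M) :
    R ∩ P = {g | g ∈ P ∧ graphEquations hm γ g = 0} := by
  ext g
  constructor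
  · rintro ⟨hR, hP⟩
    exact ⟨hP, (graphEquations_eq_zero_iff hm (G.high_eq g hP)).2 ((G.mem_iff g).1 hR).2⟩
  · rintro ⟨hP, h0⟩
    exact ⟨(G.mem_iff g).2 ⟨hP, (graphEquations_eq_zero_iff hm (G.high_eq g hP)).1 h0⟩, hP⟩

theorem IsGraphOn.isSmoothAnalyticSubvariety (G : IsGraphOn γ P R) (hm : m ≤ M) :
    IsSmoothAnalyticSubvariety P R m := by
  have hsub : R ⊆ P := fun g hg => ((G.mem_iff g).1 hg).1
  refine ⟨⟨hsub, fun p hp => ⟨P, G.isOpen, hp, subset_rfl, m,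
    fun i g => graphEquations hm γ g i, fun i g hg => ?_, ?_⟩⟩, fun p hp =>
    ⟨P, G.isOpen, hsub hp, subset_rfl, graphEquations hm γ, fun g hg =>
      analyticAt_graphEquations hm (G.analytic g hg), fun g hg =>
      surjective_fderiv_graphEquations hm (G.analytic g hg), G.inter_eq hm⟩⟩
  · exact (analyticAt_pi_iff.1 (analyticAt_graphEquations hm (G.analytic g hg))) i
  · rw [G.inter_eq hm]
    ext g
    exact and_congr_right fun _ => funext_iff

theorem IsGraphOn.eventually_mem (G : IsGraphOn γ P R) (C : IsBranchChart H γ w) (hf : f ∈ P) :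
    ∀ᶠ s in 𝓝 (high m f), γ s ∈ R := by
  have h1 := C.analytic.continuousAt.tendsto
  rw [C.map_base] at h1
  filter_upwards [h1.eventually (G.isOpen.mem_nhds hf), C.eventually_solution] with s hs hs'
  exact (G.mem_iff _).2 ⟨hs, by rw [hs'.1]⟩

theorem IsGraphOn.germSubset_of_eventually (G : IsGraphOn γ P R) {T : Set (PolySpace M)}
    (h : ∀ᶠ s in 𝓝 (high m f), γ s ∈ T) : GermSubset f R T := by
  filter_upwards [eventually_high h] with g hg hgR
  rw [← ((G.mem_iff g).1 hgR).2]
  exact hg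

theorem analyticAt_comp_chart (C : IsBranchChart H γ w) {F : PolySpace M → ℂ}
    (hF : AnalyticAt ℂ F f) : AnalyticAt ℂ (fun s => F (γ s)) (high m f) := by
  refine AnalyticAt.comp (g := F) (f := γ) ?_ C.analytic
  rwa [C.map_base]

/-- The locus is parametrized by an open set, where a product of two nonzero analytic germs is
nonzero. -/
theorem IsGraphOn.isIrreducibleGerm (G : IsGraphOn γ P R) (C : IsBranchChart H γ w) (hf : f ∈ P) :
    IsIrreducibleGerm f R := by
  refine ⟨(G.mem_iff f).2 ⟨hf, C.map_base⟩, fun V hV hfV S₁ S₂ hS₁ hS₂ hsub => ?_⟩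
  -- if the germ of `R` is not in `S`, one of the equations of `S` is nonzero on it
  have key : ∀ S, IsAnalyticSubset V S → ¬ GermSubset f R S →
      ∃ F : PolySpace M → ℂ, AnalyticAt ℂ F f ∧ (∀ᶠ g in 𝓝 f, g ∈ S → F g = 0) ∧
        ¬ ∀ᶠ s in 𝓝 (high m f), F (γ s) = 0 := by
    intro S hS hnot
    obtain ⟨V', hV', hfV', -, n, F, hF, hSF⟩ := hS.2 f hfV
    by_contra hcon
    push Not at hcon
    apply hnot
    refine G.germSubset_of_eventually ?_
    have h1 := C.analytic.continuousAt.tendsto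
    rw [C.map_base] at h1
    have h2 : ∀ i, ∀ᶠ s in 𝓝 (high m f), F i (γ s) = 0 := by
      intro i
      refine hcon (F i) (hF i f hfV') ?_
      filter_upwards [hV'.mem_nhds hfV'] with g hg hgS
      have : g ∈ S ∩ V' := ⟨hgS, hg⟩
      rw [hSF] at this
      exact this.2 i
    filter_upwards [h1.eventually (hV'.mem_nhds hfV'), eventually_all.2 h2] with s hs hs'
    have : γ s ∈ S ∩ V' := by
      rw [hSF]
      exact ⟨hs, hs'⟩
    exact this.1
  by_contra hcon
  push Not at hcon
  obtain ⟨F₁, hF₁, hz₁, hn₁⟩ := key S₁ hS₁ hcon.1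
  obtain ⟨F₂, hF₂, hz₂, hn₂⟩ := key S₂ hS₂ hcon.2
  have h1 := C.analytic.continuousAt.tendsto
  rw [C.map_base] at h1
  have hprod : ∀ᶠ s in 𝓝 (high m f), F₁ (γ s) * F₂ (γ s) = 0 := by
    filter_upwards [h1.eventually hz₁, h1.eventually hz₂, h1.eventually hsub,
      G.eventually_mem C hf] with s hs₁ hs₂ hs hsR
    rcases hs hsR with hs | hs
    · rw [hs₁ hs, zero_mul]
    · rw [hs₂ hs, mul_zero]
  rcases eventually_eq_zero_or_of_mul (analyticAt_comp_chart C hF₁) (analyticAt_comp_chart C hF₂)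
    hprod with h2 | h2
  · exact hn₁ h2
  · exact hn₂ h2

/-- The polynomial relation `P(s, y_j)` as a polynomial on the coefficient space. -/
def relationPoly (P : Polynomial (MvPolynomial (HighIdx M m) ℂ)) (j : PolyIdx M) :
    MvPolynomial (PolyIdx M) ℂ :=
  P.eval₂ (MvPolynomial.rename Subtype.val : _ →ₐ[ℂ] _).toRingHom (MvPolynomial.X j)

theorem aeval_relationPoly (Q : Polynomial (MvPolynomial (HighIdx M m) ℂ)) (j : PolyIdx M)
    (g : PolySpace M) : MvPolynomial.aeval g (relationPoly Q j) =
      Q.eval₂ (MvPolynomial.eval (high m g)) (g j) := by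
  rw [relationPoly, ← AlgHom.coe_toRingHom, Polynomial.hom_eval₂]
  congr 1
  · refine RingHom.ext fun q => ?_
    change MvPolynomial.aeval g (MvPolynomial.rename Subtype.val q) = _
    rw [MvPolynomial.aeval_rename, MvPolynomial.aeval_eq_eval]
    rfl
  · exact MvPolynomial.aeval_X _ _

/-- The locus is a branch of the algebraic set of the `g` whose low coefficients `g_i` satisfy
polynomial relations `Q_i(s, g_i) = 0` of which the functions `γ_i(s)` are generically simple roots.
The rest of that algebraic set lies in the zero set of the product of the divided differences of
the `Q_i` between `g_i` and `γ_i(s)`, and this product is not identically zero on the locus. -/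
theorem IsGraphOn.isLocalAnalyticBranch (G : IsGraphOn γ P R) (C : IsBranchChart H γ w)
    (hf : f ∈ P) (hm : m ≤ M) {Q : Fin m → Polynomial (MvPolynomial (HighIdx M m) ℂ)}
    (hQ : ∀ g ∈ P, ∀ i, (Q i).eval₂ (MvPolynomial.eval (high m g))
      (γ (high m g) (lowIdx hm i)) = 0)
    (hQ' : ∀ i, ¬ ∀ᶠ s in 𝓝 (high m f),
      (Q i).derivative.eval₂ (MvPolynomial.eval s) (γ s (lowIdx hm i)) = 0) :
    IsLocalAnalyticBranch P f R (MvPolynomial.zeroLocus ℂ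
      (Ideal.span (Set.range fun i => relationPoly (Q i) (lowIdx hm i)))) := by
  have hZ : ∀ g : PolySpace M, g ∈ MvPolynomial.zeroLocus ℂ
      (Ideal.span (Set.range fun i => relationPoly (Q i) (lowIdx hm i))) ↔
      ∀ i, (Q i).eval₂ (MvPolynomial.eval (high m g)) (g (lowIdx hm i)) = 0 := by
    intro g
    rw [MvPolynomial.zeroLocus_span]
    simp only [Set.forall_mem_range, Set.mem_ofPred_eq, aeval_relationPoly]
  set D : PolySpace M → ℂ := fun g => ∏ i, dividedDiff (Q i) (high m g) (g (lowIdx hm i))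
    (γ (high m g) (lowIdx hm i)) with hD
  have hhigh : ∀ (g : PolySpace M) (q : HighIdx M m),
      AnalyticAt ℂ (fun g : PolySpace M => high m g q) g := fun g q => analyticAt_coord q.1 g
  have hDan : ∀ g ∈ P, ∀ i, AnalyticAt ℂ (fun g => dividedDiff (Q i) (high m g)
      (g (lowIdx hm i)) (γ (high m g) (lowIdx hm i))) g := fun g hg i =>
    analyticAt_dividedDiff _ (hhigh g) (analyticAt_coord _ _)
      (analyticAt_coord_comp_high _ (G.analytic g hg))
  refine ⟨(G.isSmoothAnalyticSubvariety hm).1, G.isIrreducibleGerm C hf,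
    {g | g ∈ P ∧ (∀ i, (Q i).eval₂ (MvPolynomial.eval (high m g)) (g (lowIdx hm i)) = 0) ∧
      D g = 0}, ⟨fun g hg => hg.1, fun p hp => ⟨P, G.isOpen, hp, subset_rfl, m + 1,
        Fin.snoc (α := fun _ => PolySpace M → ℂ) (fun i g => (Q i).eval₂
          (MvPolynomial.eval (high m g)) (g (lowIdx hm i))) D, fun i g hg => ?_, ?_⟩⟩, ?_, ?_⟩
  · refine Fin.lastCases ?_ (fun i => ?_) i
    · rw [Fin.snoc_last]
      exact Finset.analyticAt_fun_prod _ fun i _ => hDan g hg i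
    · rw [Fin.snoc_castSucc]
      exact analyticAt_eval₂ _ (hhigh g) (analyticAt_coord _ _)
  · ext g
    simp only [Set.mem_inter_iff, Set.mem_ofPred_eq, Fin.forall_fin_succ', Fin.snoc_castSucc,
      Fin.snoc_last]
    tauto
  · ext g
    rw [Set.mem_inter_iff, hZ, Set.mem_union, Set.mem_ofPred_eq]
    constructor
    · rintro ⟨hg, hgP⟩
      by_cases hgR : g ∈ R
      · exact Or.inl hgR
      refine Or.inr ⟨hgP, hg, ?_⟩
      have h1 : ¬ graphEquations hm γ g = 0 := fun h0 =>
        hgR ((G.mem_iff g).2 ⟨hgP, (graphEquations_eq_zero_iff hm (G.high_eq g hgP)).1 h0⟩)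
      obtain ⟨i, hi⟩ := Function.ne_iff.1 h1
      refine Finset.prod_eq_zero (Finset.mem_univ i) ?_
      have h2 := dividedDiff_mul_sub (Q i) (high m g) (g (lowIdx hm i))
        (γ (high m g) (lowIdx hm i))
      rw [hg i, hQ g hgP i, sub_self] at h2
      exact (mul_eq_zero.1 h2).resolve_right hi
    · rintro (hgR | hg)
      · obtain ⟨hgP, hγ⟩ := (G.mem_iff g).1 hgR
        refine ⟨fun i => ?_, hgP⟩
        have := hQ g hgP i
        rwa [hγ] at this
      · exact ⟨hg.2.1, hg.1⟩
  · intro hsub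
    have h1 := C.analytic.continuousAt.tendsto
    rw [C.map_base] at h1
    have h2 : ∀ᶠ s in 𝓝 (high m f), ∏ i, (Q i).derivative.eval₂ (MvPolynomial.eval s)
        (γ s (lowIdx hm i)) = 0 := by
      filter_upwards [h1.eventually hsub, G.eventually_mem C hf, C.eventually_solution]
        with s hs hsR hs'
      have h3 := (hs hsR).2.2
      simp only [hD, hs'.1, dividedDiff_self] at h3
      exact h3
    obtain ⟨i, -, hi⟩ := exists_eventually_eq_zero_of_prod Finset.univ (fun i _ =>
      analyticAt_eval₂ (Q i).derivative (s := fun s => s) (fun q =>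
        (ContinuousLinearMap.proj (R := ℂ) (φ := fun _ : HighIdx M m => ℂ) q).analyticAt _)
        (analyticAt_comp_chart C (analyticAt_coord (lowIdx hm i) f))) h2
    exact hQ' i hi

end Geometry

/-! ### From a factorization of the curve to a chart of the branch locus -/

section Factorization

theorem hasDerivAt_eval_snd (P : MvPolynomial (Fin 2) ℂ) (x y : ℂ) :
    HasDerivAt (fun y => MvPolynomial.eval ![x, y] P)
      (MvPolynomial.eval ![x, y] (MvPolynomial.pderiv 1 P)) y := by
  induction P using MvPolynomial.induction_on with
  | C c => simpa using hasDerivAt_const y c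
  | add P Q hP hQ =>
    simp only [map_add]
    exact hP.add hQ
  | mul_X P i hP =>
    fin_cases i
    · simpa [Derivation.leibniz, MvPolynomial.pderiv_X, mul_comm] using hP.mul_const x
    · have := hP.mul (hasDerivAt_id y)
      simpa [Derivation.leibniz, MvPolynomial.pderiv_X, mul_comm, add_comm] using! this

theorem eval_pderiv_snd_of_factor_eq_zero {f : MvPolynomial (Fin 2) ℂ} {U : Set (ℂ × ℂ)}
    (hU : IsOpen U) {f₁ f₂ : ℂ × ℂ → ℂ} (hf₁ : AnalyticOnNhd ℂ f₁ U) (hf₂ : AnalyticOnNhd ℂ f₂ U)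
    (hf : ∀ p ∈ U, MvPolynomial.eval ![p.1, p.2] f = f₁ p * f₂ p) {x y : ℂ} (hxy : (x, y) ∈ U)
    (h0 : f₁ (x, y) = 0) :
    MvPolynomial.eval ![x, y] (MvPolynomial.pderiv 1 f) =
      fderiv ℂ f₁ (x, y) (0, 1) * f₂ (x, y) := by
  have hline : HasDerivAt (fun y : ℂ => (x, y)) ((0 : ℂ), (1 : ℂ)) y :=
    (hasDerivAt_const y x).prodMk (hasDerivAt_id y)
  have h1 : HasDerivAt (fun y => f₁ (x, y)) (fderiv ℂ f₁ (x, y) (0, 1)) y :=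
    HasFDerivAt.comp_hasDerivAt (l := f₁) (f := fun y : ℂ => (x, y)) y
      (hf₁ (x, y) hxy).differentiableAt.hasFDerivAt hline
  have h2 : HasDerivAt (fun y => f₂ (x, y)) (fderiv ℂ f₂ (x, y) (0, 1)) y :=
    HasFDerivAt.comp_hasDerivAt (l := f₂) (f := fun y : ℂ => (x, y)) y
      (hf₂ (x, y) hxy).differentiableAt.hasFDerivAt hline
  have h3 : HasDerivAt (fun y => f₁ (x, y) * f₂ (x, y))
      (fderiv ℂ f₁ (x, y) (0, 1) * f₂ (x, y) + f₁ (x, y) * fderiv ℂ f₂ (x, y) (0, 1)) y :=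
    HasDerivAt.fun_mul (c := fun y => f₁ (x, y)) (d := fun y => f₂ (x, y)) h1 h2
  have hc : Continuous fun y : ℂ => (x, y) := by fun_prop
  have hU' : ∀ᶠ z in 𝓝 y, (x, z) ∈ U := (hU.preimage hc).mem_nhds hxy
  have h4 : (fun z => MvPolynomial.eval ![x, z] f) =ᶠ[𝓝 y] fun z => f₁ (x, z) * f₂ (x, z) :=
    hU'.mono fun z hz => hf (x, z) hz
  have h5 := (hasDerivAt_eval_snd f x y).unique (h3.congr_of_eventuallyEq h4)
  rw [h5, h0, zero_mul, add_zero]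

/-- On the branch `f₁ = 0` of `f = f₁ f₂`, the derivative `∂f/∂y` is `∂f₁/∂y` times `f₂`, hence
vanishes at the origin to the order of `f₂`. -/
theorem exists_isBranchOver {f : MvPolynomial (Fin 2) ℂ} {U : Set (ℂ × ℂ)} (hU : IsOpen U)
    (h0U : (0 : ℂ × ℂ) ∈ U) {f₁ f₂ : ℂ × ℂ → ℂ} (hf₁ : AnalyticOnNhd ℂ f₁ U)
    (hf₂ : AnalyticOnNhd ℂ f₂ U) (hf : ∀ p ∈ U, MvPolynomial.eval ![p.1, p.2] f = f₁ p * f₂ p)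
    (hdf₁ : HasFDerivAt f₁ (ContinuousLinearMap.snd ℂ ℂ ℂ) 0)
    {h : ℂ → ℂ} (hh : AnalyticAt ℂ h 0) (hh0 : h 0 = 0)
    (hhf : ∀ᶠ t in 𝓝 (0 : ℂ), f₁ (t, h t) = 0)
    {m : ℕ} (hm : analyticOrderAt (fun t : ℂ => f₂ (t, h t)) 0 = m) :
    ∃ (e : ℂ → ℂ) (ρ : ℝ), 0 < ρ ∧ ∀ M ≥ f.totalDegree, IsBranchOver (coeffVec M f) h e m ρ := by
  have hg : AnalyticAt ℂ (fun t : ℂ => (t, h t)) 0 := analyticAt_id.prod hh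
  have hg0 : ((0 : ℂ), h 0) = 0 := by rw [hh0]; rfl
  have hf₂0 : AnalyticAt ℂ (fun t : ℂ => f₂ (t, h t)) 0 :=
    AnalyticAt.comp (g := f₂) (f := fun t : ℂ => (t, h t)) (by rw [hg0]; exact hf₂ 0 h0U) hg
  obtain ⟨e₂, he₂, he₂0, he₂f⟩ := hf₂0.analyticOrderAt_eq_natCast.1 hm
  set a : ℂ → ℂ := fun t => fderiv ℂ f₁ (t, h t) (0, 1) with ha
  have haan : AnalyticAt ℂ a 0 := by
    have h1 : AnalyticAt ℂ (fun t => fderiv ℂ f₁ (t, h t)) 0 :=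
      AnalyticAt.comp (g := fderiv ℂ f₁) (f := fun t : ℂ => (t, h t))
        (by rw [hg0]; exact (hf₁ 0 h0U).fderiv) hg
    exact ((ContinuousLinearMap.apply ℂ ℂ ((0 : ℂ), (1 : ℂ))).analyticAt _).comp h1
  have ha0 : a 0 = 1 := by
    rw [ha]
    simp only [hg0]
    rw [hdf₁.fderiv]
    simp
  have heaan : AnalyticAt ℂ (a * e₂) 0 := haan.mul he₂
  have hea0 : (a * e₂) 0 ≠ 0 := by
    rw [Pi.mul_apply, ha0, one_mul]
    exact he₂0
  have hgU : ∀ᶠ t in 𝓝 (0 : ℂ), (t, h t) ∈ U := by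
    have h1 := hg.continuousAt.tendsto
    rw [hg0] at h1
    exact h1.eventually (hU.mem_nhds h0U)
  have hq : ∀ᶠ t in 𝓝 (0 : ℂ), MvPolynomial.eval ![t, h t] (MvPolynomial.pderiv 1 f) =
      t ^ m * (a * e₂) t := by
    filter_upwards [hgU, hhf, he₂f] with t htU ht1 ht2
    rw [eval_pderiv_snd_of_factor_eq_zero hU hf₁ hf₂ hf htU ht1, ht2, Pi.mul_apply, sub_zero,
      smul_eq_mul]
    ring
  have hall : ∀ᶠ t in 𝓝 (0 : ℂ), AnalyticAt ℂ h t ∧ AnalyticAt ℂ (a * e₂) t ∧ (a * e₂) t ≠ 0 ∧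
      MvPolynomial.eval ![t, h t] f = 0 ∧
      MvPolynomial.eval ![t, h t] (MvPolynomial.pderiv 1 f) = t ^ m * (a * e₂) t := by
    filter_upwards [hh.eventually_analyticAt, heaan.eventually_analyticAt,
      heaan.continuousAt.eventually_ne hea0, hgU, hhf, hq] with t h1 h2 h3 h4 h5 h6
    exact ⟨h1, h2, h3, by rw [hf _ h4, h5, zero_mul], h6⟩
  obtain ⟨ρ, hρ, hball⟩ := Metric.eventually_nhds_iff_ball.1 hall
  refine ⟨a * e₂, ρ / 2, by linarith, fun M hM => ?_⟩
  have hsub : Metric.closedBall (0 : ℂ) (ρ / 2) ⊆ Metric.ball 0 ρ :=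
    Metric.closedBall_subset_ball (by linarith)
  have hpoly := toPoly_coeffVec f hM
  constructor
  · exact fun t ht => (hball t (hsub ht)).1
  · exact fun t ht => (hball t (hsub ht)).2.1
  · exact fun t ht => (hball t (hsub ht)).2.2.1
  · rw [hpoly]
    exact fun t ht => (hball t (hsub ht)).2.2.2.1
  · rw [hpoly]
    exact fun t ht => (hball t (hsub ht)).2.2.2.2

end Factorization

end PlaneCurves

end

theorem lemma2p1
    (f : MvPolynomial (Fin 2) ℂ)
    (U : Set (ℂ × ℂ)) (hU : IsOpen U) (h0U : (0 : ℂ × ℂ) ∈ U)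
    (hcrit : ∀ p ∈ U, p ≠ 0 → ∃ i : Fin 2,
      MvPolynomial.eval ![p.1, p.2] (MvPolynomial.pderiv i f) ≠ 0)
    (f₁ f₂ : ℂ × ℂ → ℂ) (hf₁ : AnalyticOnNhd ℂ f₁ U) (hf₂ : AnalyticOnNhd ℂ f₂ U)
    (hf : ∀ p ∈ U, MvPolynomial.eval ![p.1, p.2] f = f₁ p * f₂ p)
    (hf₁0 : f₁ 0 = 0) (hdf₁ : HasFDerivAt f₁ (ContinuousLinearMap.snd ℂ ℂ ℂ) 0)
    (hmeet : ∀ p ∈ U, f₁ p = 0 → f₂ p = 0 → p = 0)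
    -- the graph of `h` is the germ of the branch `f₁ = 0`
    (h : ℂ → ℂ) (hh : AnalyticAt ℂ h 0) (hh0 : h 0 = 0)
    (hhf : ∀ᶠ t in 𝓝 (0 : ℂ), f₁ (t, h t) = 0)
    -- the intersection multiplicity at the origin of this branch with `f₂ = 0`
    (m : ℕ) (hm : analyticOrderAt (fun t : ℂ => f₂ (t, h t)) 0 = m) :
    ∃ M₀ : ℕ, ∀ M ≥ M₀,
    -- sufficiently small discs, closeness, and neighborhoods of `f`
    ∃ r₀ > (0 : ℝ), ∀ r : ℝ, 0 < r → r ≤ r₀ →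
    ∀ K : ℕ, ∃ ε₀ > (0 : ℝ), ∀ ε : ℝ, 0 < ε → ε ≤ ε₀ →
    ∃ P₀ : Set (PlaneCurves.PolySpace M), IsOpen P₀ ∧ PlaneCurves.coeffVec M f ∈ P₀ ∧
    ∀ P ⊆ P₀, IsOpen P → PlaneCurves.coeffVec M f ∈ P →
      -- the branch function of each member of the locus is unique
      (∀ g ∈ PlaneCurves.branchLocus P h r K ε, ∀ u v : ℂ → ℂ,
        PlaneCurves.IsCloseBranch h r K ε g u → PlaneCurves.IsCloseBranch h r K ε g v →
        Set.EqOn u v (Metric.ball 0 r)) ∧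
      -- (i)
      (PlaneCurves.coeffVec M f ∈ PlaneCurves.branchLocus P h r K ε ∧
        PlaneCurves.IsSmoothAnalyticSubvariety P (PlaneCurves.branchLocus P h r K ε) m) ∧
      -- (ii)
      (∃ I : Ideal (MvPolynomial (PlaneCurves.PolyIdx M) ℂ),
        PlaneCurves.IsLocalAnalyticBranch P (PlaneCurves.coeffVec M f)
          (PlaneCurves.branchLocus P h r K ε) (MvPolynomial.zeroLocus ℂ I)) ∧
      -- (iii)
      (∀ k : ℕ, PlaneCurves.IsAnalyticOnSubvariety (PlaneCurves.branchLocus P h r K ε)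
        (fun g => PlaneCurves.taylorCoeff k (PlaneCurves.branchFun h r K ε g))) ∧
      -- (iv)
      (∀ (A : Type*) [CommRing A] [Algebra ℂ A] [IsLocalRing A] [Module.Finite ℂ A],
        PlaneCurves.formalNbhd (PlaneCurves.branchLocus P h r K ε)
            (PlaneCurves.coeffVec M f) A =
          {F : MvPolynomial (Fin 2) A | F.totalDegree ≤ M ∧
            (∀ s, F.coeff s - algebraMap ℂ A (f.coeff s) ∈ IsLocalRing.maximalIdeal A) ∧
            ∃ H : PowerSeries A,
              (∀ k, PowerSeries.coeff k H - algebraMap ℂ A (PlaneCurves.taylorCoeff k h) ∈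
                IsLocalRing.maximalIdeal A) ∧
              MvPolynomial.aeval ![(PowerSeries.X : PowerSeries A), H] F = 0}) := by
  classical
  obtain ⟨e, ρ, hρ, hbr⟩ :=
    PlaneCurves.exists_isBranchOver hU h0U hf₁ hf₂ hf hdf₁ hh hh0 hhf hm
  -- the family of polynomials used for algebraicity needs the monomials `x ^ i` with `i < 2 m`
  refine ⟨max f.totalDegree (2 * m), fun M hM => ⟨ρ / 2, by linarith, fun r hr hrρ K => ?_⟩⟩
  have hdeg : f.totalDegree ≤ M := (le_max_left _ _).trans hM
  have h2m : 2 * m ≤ M := (le_max_right _ _).trans hM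
  have hmM : m ≤ M := by omega
  have hrρ' : r < ρ := by linarith
  have H := hbr M hdeg
  have hpoly := PlaneCurves.toPoly_coeffVec f hdeg
  obtain ⟨γ, w, C⟩ := H.exists_chart hρ hmM
  choose Q hQ hQ' using fun i : Fin m => C.exists_simple_relation hρ h2m (PlaneCurves.lowIdx hmM i)
  obtain ⟨ε₀, hε₀, hclose⟩ := C.eventually_of_isCloseBranch hmM hr hrρ'
  refine ⟨ε₀, hε₀, fun ε hε hεε₀ => ?_⟩
  have hall := (PlaneCurves.eventually_high ((C.analytic.eventually_analyticAt.and
    C.analytic_branch.eventually_analyticAt).and (C.eventually_solution.and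
    ((C.eventually_isCloseBranch hrρ' K hε).and (eventually_all.2 hQ))))).and hclose
  obtain ⟨P₀, hP₀, hP₀o, hfP₀⟩ := mem_nhds_iff.1 hall
  refine ⟨P₀, hP₀o, hfP₀, fun P hP hPo hfP => ?_⟩
  set R := PlaneCurves.branchLocus P h r K ε with hR
  have hbranch : ∀ g ∈ R, ∀ u, PlaneCurves.IsCloseBranch h r K ε g u →
      Set.EqOn u (PlaneCurves.discExt (w (PlaneCurves.high m g)).1) (Metric.ball 0 r) :=
    fun g hg u hu => ((hP₀ (hP hg.1)).2 K ε hεε₀ u hu).2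
  have G : PlaneCurves.IsGraphOn γ P R := by
    refine ⟨hPo, fun g hg => (hP₀ (hP hg)).1.1.1, fun g hg => (hP₀ (hP hg)).1.2.1.1, fun g =>
      ⟨fun ⟨hg, u, hu⟩ => ⟨hg, ((hP₀ (hP hg)).2 K ε hεε₀ u hu).1⟩, fun ⟨hg, hγ⟩ => ⟨hg, ?_⟩⟩⟩
    have := (hP₀ (hP hg)).1.2.2.1
    rw [hγ] at this
    exact ⟨_, this⟩
  have hfR : PlaneCurves.coeffVec M f ∈ R := (G.mem_iff _).2 ⟨hfP, C.map_base⟩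
  refine ⟨fun g hg u v hu hv t ht => ?_, ⟨hfR, G.isSmoothAnalyticSubvariety hmM⟩,
    ⟨_, G.isLocalAnalyticBranch C hfP hmM (fun g hg => (hP₀ (hP hg)).1.2.2.2) hQ'⟩,
    fun k p hp => ?_, fun A _ _ _ _ => ?_⟩
  · rw [hbranch g hg u hu ht, hbranch g hg v hv ht]
  · refine ⟨fun g => PlaneCurves.taylorCoeff k
      (PlaneCurves.discExt (w (PlaneCurves.high m g)).1), ?_, ?_⟩
    · have h1 : AnalyticAt ℂ (fun g => w (PlaneCurves.high m g)) p :=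
        AnalyticAt.comp (g := w) (f := PlaneCurves.high m) (hP₀ (hP hp.1)).1.1.2
          ((PlaneCurves.high m).analyticAt p)
      exact ((PlaneCurves.discTaylorCoeff hρ k).analyticAt _).comp h1
    · filter_upwards [self_mem_nhdsWithin] with g hg
      refine PlaneCurves.taylorCoeff_congr ?_ k
      rw [PlaneCurves.branchFun, dif_pos hg.2]
      exact Filter.eventuallyEq_of_mem (Metric.ball_mem_nhds 0 hr)
        (hbranch g hg _ hg.2.choose_spec)
  · rw [← hpoly]
    have := C.formalNbhd_eq (A := A) hρ hmM (R := R) (by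
      filter_upwards [hPo.mem_nhds hfP] with g hg
      exact (G.mem_iff g).trans (and_iff_right hg))
    rw [hpoly] at this ⊢
    exact this
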